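/- **Theorem (stability of the semi-discrete system).** *Setting.* Let $\Omega\subset\mathbb R^2$ be a bounded polygonal domain whose boundary is split into disjoint relatively open parts $\Gamma^{u},\Gamma^{\sigma}$ of positive length with $\partial\Omega=\overline{\Gamma^{u}}\cup\overline{\Gamma^{\sigma}}$, and let $k\ge 1$. Let $\mathcal T_h$ be a polygonal mesh of $\Omega$ such that, for fixed $\eta_1,\eta_2>0$, each $K\in\mathcal T_h$ (of diameter $h_K$) is star-shaped with respect to a ball of radius greater than $\eta_1h_K$ and each of its edges has length $\ge\eta_2h_K$. Put $$\mathbb S(K)=\{\tau\in \mathbb H(\mathbf{div},K)\cap\mathbb H(\mathbf{curl},K):\ \tau n|_F\in \mathbf P_k(F)\ \forall F\subset\partial K,\ \mathbf{div}\,\tau\in \mathbf P_k(K),\ \mathbf{curl}\,\tau\in \mathbf P_{k-1}(K)\}$$ (div and the scalar curl act on rows), $\mathbb S_h=\{\tau\in\mathbb H(\mathbf{div},\Omega):\tau n=0\text{ on }\Gamma^{\sigma},\ \tau|_K\in\mathbb S(K)\ \forall K\}$, $\mathbf V_h=\{v\in \mathbf L^2(\Omega): v|_K\in \mathbf P_k(K)\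 \forall K\}$, and $\mathbb K_h=\{\eta\in\mathbb L^2(\Omega):\eta=-\eta^{t},\ \eta|_K\in\mathbb P_k(K)\ \forall K\}$. Let $\Pi$ be the $L^2(\Omega)$-orthogonal projection onto piecewise polynomial tensors of degree $\le k$. The degrees of freedom $\chi_i$ of $\tau\in\mathbb S(K)$ are $\frac1{|F|}\int_F(\tau n)_j m$ for each edge $F$ (midpoint $x_F$, length $h_F$), $j=1,2$, and $m$ a normalised monomial $((x-x_F)/h_F)^\beta$ along $F$, $0\le\beta\le k$, together with $\frac1{|K|}\int_K\tau:g$, with $g$ running through a basis of $\mathbb G_{k-1}(K)=\nabla \mathbf P_k(K)$ and through a basis of $\mathbb G_k^{\perp}(K)$, the $L^2(K)$-orthogonal of $\nabla\mathbf P_{k+1}(K)$ in $\mathbb P_k(K)$. Both bases $(g_l)$ are scaled uniformly: $\theta_1|c|^2\le\frac1{|K|}\|\sum_l c_lg_l\|_{0,K}^2\le\theta_2|c|^2$ for all coefficient vectors $c$, with fixed $\theta_1,\theta_2>0$. Given a Lamé pair with $\mu>0$, $2\mu+2\lambda>0$ and the compliance $\mathcal A\tau=\frac1{2\mu}\big(\tau-\frac{\lambda}{2\mu+2\lambda}\mathrm{tr}(\tau)I\big)$,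 let $$a_h(\sigma,\tau)=\sum_{K\in\mathcal T_h}\Big(\int_K\mathcal A\,\Pi\sigma:\Pi\tau\,dx+|K|\sum_i\chi_i(\sigma-\Pi\sigma)\,\chi_i(\tau-\Pi\tau)\Big),$$ and let $a_{0,h},a_{0,h}',a_{1,h}$ be the forms obtained from Lamé pairs $(\mu_0,\lambda_0),(\mu_0',\lambda_0'),(\mu_1,\lambda_1)$. Let $\varrho>0$ be a constant, $T>0$, $f\in L^1([0,T],\mathbf L^2(\Omega))$, and let $(\sigma_{0,h},\sigma_{1,h},v_h,r_h)\in C^1([0,T],\mathbb S_h\times\mathbb S_h\times\mathbf V_h\times\mathbb K_h)$ solve, for every $t\in[0,T]$, $$\begin{aligned} a_{0,h}(\dot\sigma_{0,h},\tau)+a_{0,h}'(\sigma_{0,h},\tau)+(\mathbf{div}\,\tau,v_h)+(\tau,\dot r_h)&=0&&\forall\tau\in\mathbb S_h,\\ a_{1,h}(\dot\sigma_{1,h},\tau)+(\mathbf{div}\,\tau,v_h)+(\tau,\dot r_h)&=0&&\forall\tau\in\mathbb S_h,\\ (\varrho\dot v_h,w)-(\mathbf{div}(\sigma_{0,h}+\sigma_{1,h}),w)-(\varrho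 f,w)&=0&&\forall w\in\mathbf V_h,\\ (\dot\sigma_{0,h}+\dot\sigma_{1,h},\eta)&=0&&\forall\eta\in\mathbb K_h, \end{aligned}$$ with initial stresses that are weakly symmetric: $(\sigma_{0,h}(0)+\sigma_{1,h}(0),\eta)=0$ for all $\eta\in\mathbb K_h$. Here $(\cdot,\cdot)$ and $\|\cdot\|$ are the inner product and norm of $L^2(\Omega)$. *Claim.* For every $t\in[0,T]$ the energy identity $$\tfrac12\tfrac{d}{dt}\big(a_{0,h}(\sigma_{0,h},\sigma_{0,h})+a_{1,h}(\sigma_{1,h},\sigma_{1,h})+(\varrho v_h,v_h)\big)+a_{0,h}'(\sigma_{0,h},\sigma_{0,h})=(\varrho f,v_h)$$ holds, with $a_{0,h}'(\sigma_{0,h},\sigma_{0,h})\ge0$, and $$\max_{s\in[0,T]}\big(\|\sigma_{0,h}(s)\|+\|\sigma_{1,h}(s)\|+\|v_h(s)\|\big)\le C\Big(\|\sigma_{0,h}(0)\|+\|\sigma_{1,h}(0)\|+\|v_h(0)\|+\int_0^T\|f(s)\|\,ds\Big),$$ where $C$ depends only on $\Omega,\Gamma^u,\Gamma^\sigma,k,\eta_1,\eta_2,\theta_1,\theta_2,\varrho$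 and the Lamé pairs, and not on the mesh (in particular not on $h$), the bases, $T$, $f$ or the solution. -/

import Mathlib

open MeasureTheory
open scoped ContDiff

noncomputable section

namespace ViscoVEM

/-! ### Plane fields, polynomials and weak derivatives -/

/-- The Euclidean plane. -/
abbrev Plane := EuclideanSpace ℝ (Fin 2)

/-- Index type of `2 × 2` tensors; `EuclideanSpace ℝ TIdx` carries the Frobenius inner product. -/
abbrev TIdx := Fin 2 × Fin 2

/-- `L²(Ω)` fields with components indexed by `ι`: vector fields for `ι = Fin 2`,
tensor fields for `ι = TIdx`. -/
abbrev L2 (Ω : Set Plane) (ι : Type) [Fintype ι] :=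
  Lp (EuclideanSpace ℝ ι) 2 (volume.restrict Ω)

/-- Partial derivative in the `j`-th coordinate direction. -/
def pd (j : Fin 2) (φ : Plane → ℝ) (x : Plane) : ℝ :=
  fderiv ℝ φ x (EuclideanSpace.single j 1)

/-- Value of a bivariate polynomial at a point of the plane. -/
def pval (q : MvPolynomial (Fin 2) ℝ) (x : Plane) : ℝ :=
  MvPolynomial.eval (fun j => x j) q

/-- `φ ∈ C_c^∞(ℝ²)`. -/
def IsTest (φ : Plane → ℝ) : Prop := ContDiff ℝ ∞ φ ∧ HasCompactSupport φ

/-- All components of `u` are, on `K`, polynomials of total degree at most `k`. -/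
def IsPolyOn {ι : Type} (k : ℕ) (K : Set Plane) (u : Plane → EuclideanSpace ℝ ι) : Prop :=
  ∃ q : ι → MvPolynomial (Fin 2) ℝ, (∀ i, (q i).totalDegree ≤ k) ∧
    ∀ᵐ x ∂(volume.restrict K), ∀ i, u x i = pval (q i) x

/-- `d` is the distributional row-wise divergence of `τ` on the open set `U`. -/
def HasWeakDiv (U : Set Plane) (τ : Plane → EuclideanSpace ℝ TIdx)
    (d : Plane → EuclideanSpace ℝ (Fin 2)) : Prop :=
  ∀ i : Fin 2, ∀ φ : Plane → ℝ, IsTest φ → tsupport φ ⊆ U →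
    ∫ x in U, ∑ j : Fin 2, τ x (i, j) * pd j φ x = - ∫ x in U, d x i * φ x

/-- `c` is the distributional row-wise (scalar, two-dimensional) curl
`∂₁ τ_{i2} - ∂₂ τ_{i1}` of `τ` on the open set `U`. -/
def HasWeakCurl (U : Set Plane) (τ : Plane → EuclideanSpace ℝ TIdx)
    (c : Plane → EuclideanSpace ℝ (Fin 2)) : Prop :=
  ∀ i : Fin 2, ∀ φ : Plane → ℝ, IsTest φ → tsupport φ ⊆ U →
    ∫ x in U, (τ x (i, 1) * pd 0 φ x - τ x (i, 0) * pd 1 φ x) = - ∫ x in U, c x i * φ x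

/-! ### Polygons, domain, meshes -/

/-- An open polygon: the bounded open set whose boundary is a simple closed polygonal curve with
the given cyclically ordered vertices (indices are taken modulo the number of vertices).
Consecutive edges may be aligned. -/
structure Polygon where
  m : ℕ
  vert : Fin (m + 3) → Plane
  carrier : Set Plane
  isOpen : IsOpen carrier
  bounded : Bornology.IsBounded carrier
  frontier_eq : frontier carrier = ⋃ i, segment ℝ (vert i) (vert (i + 1))
  vert_injective : Function.Injective vert
  vert_notMem : ∀ i j, vert j ∉ openSegment ℝ (vert i) (vert (i + 1))
  edges_disjoint : ∀ i j, i ≠ j →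
    Disjoint (openSegment ℝ (vert i) (vert (i + 1))) (openSegment ℝ (vert j) (vert (j + 1)))

namespace Polygon

/-- Diameter `h_K`. -/
def diam (K : Polygon) : ℝ := Metric.diam K.carrier

/-- Area `|K|`. -/
def area (K : Polygon) : ℝ := volume.real K.carrier

/-- Length `h_F = |F|` of the `e`-th edge. -/
def edgeLength (K : Polygon) (e : Fin (K.m + 3)) : ℝ := dist (K.vert e) (K.vert (e + 1))

/-- Parametrization `s ↦ x_F + s (b - a)`, `s ∈ [-1/2, 1/2]`, of the edge `F = [a, b]` with
midpoint `x_F`; in this parameter the normalised monomials of the edge are `s ^ β`. -/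
def edgePoint (K : Polygon) (e : Fin (K.m + 3)) (s : ℝ) : Plane :=
  midpoint ℝ (K.vert e) (K.vert (e + 1)) + s • (K.vert (e + 1) - K.vert e)

/-- Shape regularity: `K` is star-shaped with respect to a ball of radius greater than `η₁ h_K`,
and every edge has length at least `η₂ h_K`. -/
def ShapeRegular (K : Polygon) (η₁ η₂ : ℝ) : Prop :=
  (∃ c : Plane, ∃ ρ : ℝ, η₁ * K.diam < ρ ∧ ∀ y ∈ Metric.ball c ρ, StarConvex ℝ y K.carrier) ∧
    ∀ e, η₂ * K.diam ≤ K.edgeLength e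

/-- `g` is the trace `τ n` of `τ ∈ H(div, K)` on the edges of `K` (`n` the outward unit normal):
`g e i` is, in the parameter of the edge `e`, the `i`-th component of `τ n` on `e`. The trace is
understood, as usual in `H(div, K)`, through Green's formula. -/
def IsNormalTrace (K : Polygon) (τ : Plane → EuclideanSpace ℝ TIdx)
    (g : Fin (K.m + 3) → Fin 2 → Polynomial ℝ) : Prop :=
  ∃ d : Plane → EuclideanSpace ℝ (Fin 2), MemLp d 2 (volume.restrict K.carrier) ∧
    HasWeakDiv K.carrier τ d ∧
    ∀ i : Fin 2, ∀ φ : Plane → ℝ, IsTest φ →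
      ∫ x in K.carrier, ((∑ j : Fin 2, τ x (i, j) * pd j φ x) + d x i * φ x) =
        ∑ e, K.edgeLength e * ∫ s in (-1 / 2 : ℝ)..(1 / 2), (g e i).eval s * φ (K.edgePoint e s)

/-- The local virtual space `𝕊(K)`. -/
def localSpace (K : Polygon) (k : ℕ) : Set (Plane → EuclideanSpace ℝ TIdx) :=
  {τ | MemLp τ 2 (volume.restrict K.carrier) ∧
    (∃ d : Plane → EuclideanSpace ℝ (Fin 2), IsPolyOn k K.carrier d ∧
      HasWeakDiv K.carrier τ d) ∧
    (∃ c : Plane → EuclideanSpace ℝ (Fin 2), IsPolyOn (k - 1) K.carrier c ∧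
      HasWeakCurl K.carrier τ c) ∧
    ∃ g, K.IsNormalTrace τ g ∧ ∀ e i, (g e i).natDegree ≤ k}

open Classical in
/-- The (unique) edgewise polynomial normal trace of `τ`, if there is one. -/
def normalTrace (K : Polygon) (τ : Plane → EuclideanSpace ℝ TIdx) :
    Fin (K.m + 3) → Fin 2 → Polynomial ℝ :=
  if h : ∃ g, K.IsNormalTrace τ g then h.choose else 0

/-- `(1/|F|) ∫_F (τ n)_i m_β ds`, with `m_β` the normalised monomial of degree `β` on the edge. -/
def edgeDof (K : Polygon) (τ : Plane → EuclideanSpace ℝ TIdx) (e : Fin (K.m + 3)) (i : Fin 2)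
    (β : ℕ) : ℝ :=
  ∫ s in (-1 / 2 : ℝ)..(1 / 2), (K.normalTrace τ e i).eval s * s ^ β

/-- `(1/|K|) ∫_K τ : g dx` for a tensor polynomial `g`. -/
def interiorDof (K : Polygon) (τ : Plane → EuclideanSpace ℝ TIdx)
    (g : TIdx → MvPolynomial (Fin 2) ℝ) : ℝ :=
  (K.area)⁻¹ * ∫ x in K.carrier, ∑ a : TIdx, τ x a * pval (g a) x

/-- `∫_K g : g' dx` for tensor polynomials. -/
def polyInner (K : Polygon) (g g' : TIdx → MvPolynomial (Fin 2) ℝ) : ℝ :=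
  ∫ x in K.carrier, ∑ a : TIdx, pval (g a) x * pval (g' a) x

/-- The family `b` is well scaled on `K`: it satisfies
`θ₁ |c|² ≤ |K|⁻¹ ‖∑ c_l b_l‖²_{0,K} ≤ θ₂ |c|²`. -/
def WellScaled (K : Polygon) {n : ℕ} (b : Fin n → TIdx → MvPolynomial (Fin 2) ℝ)
    (θ₁ θ₂ : ℝ) : Prop :=
  ∀ c : Fin n → ℝ,
    θ₁ * ∑ l, c l ^ 2 ≤ (K.area)⁻¹ * K.polyInner (∑ l, c l • b l) (∑ l, c l • b l) ∧
    (K.area)⁻¹ * K.polyInner (∑ l, c l • b l) (∑ l, c l • b l) ≤ θ₂ * ∑ l, c l ^ 2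

end Polygon

/-- `𝔾_k = ∇ P_{k+1}²`: row-wise gradients of vector polynomials of degree at most `k + 1`. -/
def gradPoly (k : ℕ) : Set (TIdx → MvPolynomial (Fin 2) ℝ) :=
  {g | ∃ q : Fin 2 → MvPolynomial (Fin 2) ℝ, (∀ i, (q i).totalDegree ≤ k + 1) ∧
    ∀ i j, g (i, j) = MvPolynomial.pderiv j (q i)}

/-- `𝔾_k^⊥(K)`: the `L²(K)`-orthogonal of `𝔾_k` in the tensor polynomials of degree at most `k`. -/
def gradPolyPerp (k : ℕ) (K : Polygon) : Set (TIdx → MvPolynomial (Fin 2) ℝ) :=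
  {g | (∀ a, (g a).totalDegree ≤ k) ∧ ∀ g' ∈ gradPoly k, K.polyInner g g' = 0}

/-- Bases of `𝔾_{k-1}(K)` and `𝔾_k^⊥(K)`, which fix the interior degrees of freedom of `𝕊(K)`. -/
structure InteriorBasis (k : ℕ) (K : Polygon) where
  n₁ : ℕ
  n₂ : ℕ
  grad : Fin n₁ → TIdx → MvPolynomial (Fin 2) ℝ
  perp : Fin n₂ → TIdx → MvPolynomial (Fin 2) ℝ
  grad_indep : LinearIndependent ℝ grad
  perp_indep : LinearIndependent ℝ perp
  grad_span : (Submodule.span ℝ (Set.range grad) : Set _) = gradPoly (k - 1)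
  perp_span : (Submodule.span ℝ (Set.range perp) : Set _) = gradPolyPerp k K

/-- The dofi-dofi stabilisation `S_h^K(σ, τ) = |K| ∑_i χ_i(σ) χ_i(τ)`. -/
def stab {k : ℕ} {K : Polygon} (B : InteriorBasis k K) (σ τ : Plane → EuclideanSpace ℝ TIdx) : ℝ :=
  K.area *
    ((∑ e, ∑ i : Fin 2, ∑ β ∈ Finset.range (k + 1), K.edgeDof σ e i β * K.edgeDof τ e i β) +
      (∑ l, K.interiorDof σ (B.grad l) * K.interiorDof τ (B.grad l)) +
      ∑ l, K.interiorDof σ (B.perp l) * K.interiorDof τ (B.perp l))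

/-- A bounded polygonal domain whose boundary is split into relatively open, disjoint parts
`Γu` (displacement) and `Γσ` (traction), both of positive length. -/
structure PolyDomain where
  carrier : Set Plane
  isOpen : IsOpen carrier
  connected : IsConnected carrier
  bounded : Bornology.IsBounded carrier
  interior_closure : interior (closure carrier) = carrier
  polygonal : ∃ (n : ℕ) (a b : Fin n → Plane), frontier carrier = ⋃ i, segment ℝ (a i) (b i)
  Γu : Set Plane
  Γσ : Set Plane
  Γu_open : ∃ U : Set Plane, IsOpen U ∧ Γu = U ∩ frontier carrier
  Γσ_open : ∃ U : Set Plane, IsOpen U ∧ Γσ = U ∩ frontier carrier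
  disjoint : Disjoint Γu Γσ
  cover : frontier carrier = closure Γu ∪ closure Γσ
  Γu_pos : 0 < Measure.hausdorffMeasure 1 Γu
  Γσ_pos : 0 < Measure.hausdorffMeasure 1 Γσ

/-- A polygonal mesh of the domain: disjoint polygons covering it, two edges of which either
coincide or do not overlap. -/
structure Mesh (D : PolyDomain) where
  N : ℕ
  elem : Fin N → Polygon
  subset : ∀ i, (elem i).carrier ⊆ D.carrier
  disjoint : ∀ i j, i ≠ j → Disjoint (elem i).carrier (elem j).carrier
  cover : closure D.carrier = ⋃ i, closure (elem i).carrier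
  conforming : ∀ i j e e',
    openSegment ℝ ((elem i).vert e) ((elem i).vert (e + 1)) =
      openSegment ℝ ((elem j).vert e') ((elem j).vert (e' + 1)) ∨
    Disjoint (openSegment ℝ ((elem i).vert e) ((elem i).vert (e + 1)))
      (openSegment ℝ ((elem j).vert e') ((elem j).vert (e' + 1)))

/-! ### Global discrete spaces -/

variable {D : PolyDomain}

open Classical in
/-- The weak divergence of `τ ∈ H(div, Ω)` (zero if `τ` is not in `H(div, Ω)`). -/
def weakDiv (τ : L2 D.carrier TIdx) : L2 D.carrier (Fin 2) :=
  if h : ∃ d : L2 D.carrier (Fin 2), HasWeakDiv D.carrier τ d then h.choose else 0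

/-- `H_⋆(div, Ω)`: `τ ∈ H(div, Ω)` with `τ n = 0` on `Γσ`, i.e. the normal trace of `τ` vanishes
against all test functions that vanish near `Γu`. -/
def HdivStar (D : PolyDomain) : Set (L2 D.carrier TIdx) :=
  {τ | HasWeakDiv D.carrier τ (weakDiv τ) ∧
    ∀ i : Fin 2, ∀ φ : Plane → ℝ, IsTest φ → Disjoint (tsupport φ) (closure D.Γu) →
      ∫ x in D.carrier, ((∑ j : Fin 2, τ x (i, j) * pd j φ x) + weakDiv τ x i * φ x) = 0}

/-- The virtual stress space `𝕊_h`. -/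
def stressSpace (M : Mesh D) (k : ℕ) : Set (L2 D.carrier TIdx) :=
  {τ | τ ∈ HdivStar D ∧ ∀ i, (τ : Plane → EuclideanSpace ℝ TIdx) ∈ (M.elem i).localSpace k}

theorem ae_restrict_elem (M : Mesh D) (i : Fin M.N) {p : Plane → Prop}
    (h : ∀ᵐ x ∂(volume.restrict D.carrier), p x) :
    ∀ᵐ x ∂(volume.restrict (M.elem i).carrier), p x :=
  ae_restrict_of_ae_restrict_of_subset (M.subset i) h

/-- Piecewise polynomial fields of degree at most `k`. -/
def pwPoly (M : Mesh D) (k : ℕ) (ι : Type) [Fintype ι] : Submodule ℝ (L2 D.carrier ι) where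
  carrier := {u | ∀ i, IsPolyOn k (M.elem i).carrier (u : Plane → EuclideanSpace ℝ ι)}
  zero_mem' := by
    intro i
    refine ⟨0, fun _ => by simp, ?_⟩
    filter_upwards [ae_restrict_elem M i
      (Lp.coeFn_zero (EuclideanSpace ℝ ι) 2 (volume.restrict D.carrier))] with x hx a
    rw [hx]
    simp [pval]
  add_mem' := by
    intro u w hu hw i
    obtain ⟨q, hq, hqu⟩ := hu i
    obtain ⟨q', hq', hqw⟩ := hw i
    refine ⟨q + q', fun a => (MvPolynomial.totalDegree_add _ _).trans (max_le (hq a) (hq' a)), ?_⟩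
    filter_upwards [ae_restrict_elem M i (Lp.coeFn_add u w), hqu, hqw] with x hx h1 h2 a
    rw [hx]
    simp [h1 a, h2 a, pval]
  smul_mem' := by
    intro c u hu i
    obtain ⟨q, hq, hqu⟩ := hu i
    refine ⟨c • q, fun a => (MvPolynomial.totalDegree_smul_le c (q a)).trans (hq a), ?_⟩
    filter_upwards [ae_restrict_elem M i (Lp.coeFn_smul c u), hqu] with x hx h1 a
    rw [hx]
    simp [h1 a, pval]

/-- The discrete rotations `𝕂_h`: skew-symmetric piecewise polynomial tensors. -/
def rotationSpace (M : Mesh D) (k : ℕ) : Set (L2 D.carrier TIdx) :=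
  {η | η ∈ pwPoly M k TIdx ∧
    ∀ᵐ x ∂(volume.restrict D.carrier), ∀ i j, η x (i, j) = - η x (j, i)}

/-- The `L²(Ω)`-orthogonal projection onto piecewise polynomial tensors (a finite-dimensional
space, which therefore equals its closure). -/
def proj (M : Mesh D) (k : ℕ) (τ : L2 D.carrier TIdx) : L2 D.carrier TIdx :=
  (pwPoly M k TIdx).topologicalClosure.starProjection τ

/-! ### Discrete bilinear forms and the semi-discrete problem -/

/-- A Lamé pair for which Hooke's law in two dimensions is positive definite. -/
structure Lame where
  μ : ℝ
  lam : ℝ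
  μ_pos : 0 < μ
  bulk_pos : 0 < 2 * μ + 2 * lam

/-- Trace of a `2 × 2` tensor. -/
def tr (A : EuclideanSpace ℝ TIdx) : ℝ := A (0, 0) + A (1, 1)

/-- The compliance tensor `𝒜 A = (1/2μ) (A - λ/(2μ+2λ) tr(A) I)`. -/
def compliance (P : Lame) (A : EuclideanSpace ℝ TIdx) : EuclideanSpace ℝ TIdx :=
  WithLp.toLp 2 fun a => (1 / (2 * P.μ)) *
    (A a - P.lam / (2 * P.μ + 2 * P.lam) * tr A * (if a.1 = a.2 then 1 else 0))

/-- The global discrete form `a_h(σ, τ) = ∑_K a_h^K(σ, τ)`, where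
`a_h^K(σ, τ) = ∫_K 𝒜 Πσ : Πτ dx + S_h^K(σ - Πσ, τ - Πτ)`. -/
def form {M : Mesh D} {k : ℕ} (B : ∀ i, InteriorBasis k (M.elem i)) (P : Lame)
    (σ τ : L2 D.carrier TIdx) : ℝ :=
  ∑ i, ((∫ x in (M.elem i).carrier, inner ℝ (compliance P (proj M k σ x)) (proj M k τ x)) +
    stab (B i) (σ - proj M k σ : L2 D.carrier TIdx) (τ - proj M k τ : L2 D.carrier TIdx))

/-- `(σ₀, σ₁, v, r)` is a (continuously differentiable) solution of the semi-discrete problem on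
`[0, T]` with load `f`, density `ρ` and Lamé pairs `P₀, P₀', P₁`. -/
structure IsSemiDiscreteSolution {M : Mesh D} {k : ℕ} (B : ∀ i, InteriorBasis k (M.elem i))
    (P₀ P₀' P₁ : Lame) (ρ T : ℝ) (f : ℝ → L2 D.carrier (Fin 2))
    (σ₀ σ₁ : ℝ → L2 D.carrier TIdx) (v : ℝ → L2 D.carrier (Fin 2))
    (r : ℝ → L2 D.carrier TIdx) : Prop where
  σ₀_mem : ∀ t ∈ Set.Icc 0 T, σ₀ t ∈ stressSpace M k
  σ₁_mem : ∀ t ∈ Set.Icc 0 T, σ₁ t ∈ stressSpace M k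
  v_mem : ∀ t ∈ Set.Icc 0 T, v t ∈ pwPoly M k (Fin 2)
  r_mem : ∀ t ∈ Set.Icc 0 T, r t ∈ rotationSpace M k
  σ₀_C1 : ContDiffOn ℝ 1 σ₀ (Set.Icc 0 T)
  σ₁_C1 : ContDiffOn ℝ 1 σ₁ (Set.Icc 0 T)
  v_C1 : ContDiffOn ℝ 1 v (Set.Icc 0 T)
  r_C1 : ContDiffOn ℝ 1 r (Set.Icc 0 T)
  eq₀ : ∀ t ∈ Set.Icc 0 T, ∀ τ ∈ stressSpace M k,
    form B P₀ (derivWithin σ₀ (Set.Icc 0 T) t) τ + form B P₀' (σ₀ t) τ +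
      inner ℝ (weakDiv τ) (v t) + inner ℝ τ (derivWithin r (Set.Icc 0 T) t) = 0
  eq₁ : ∀ t ∈ Set.Icc 0 T, ∀ τ ∈ stressSpace M k,
    form B P₁ (derivWithin σ₁ (Set.Icc 0 T) t) τ +
      inner ℝ (weakDiv τ) (v t) + inner ℝ τ (derivWithin r (Set.Icc 0 T) t) = 0
  eq_v : ∀ t ∈ Set.Icc 0 T, ∀ w ∈ pwPoly M k (Fin 2),
    inner ℝ (ρ • derivWithin v (Set.Icc 0 T) t) w - inner ℝ (weakDiv (σ₀ t + σ₁ t)) w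
      - inner ℝ (ρ • f t) w = 0
  eq_r : ∀ t ∈ Set.Icc 0 T, ∀ η ∈ rotationSpace M k,
    inner ℝ (derivWithin σ₀ (Set.Icc 0 T) t + derivWithin σ₁ (Set.Icc 0 T) t) η = 0

/-- The total (elastic potential plus kinetic) energy. -/
def energy {M : Mesh D} {k : ℕ} (B : ∀ i, InteriorBasis k (M.elem i)) (P₀ P₁ : Lame) (ρ : ℝ)
    (σ₀ σ₁ : L2 D.carrier TIdx) (v : L2 D.carrier (Fin 2)) : ℝ :=
  (1 / 2) * (form B P₀ σ₀ σ₀ + form B P₁ σ₁ σ₁ + inner ℝ (ρ • v) v)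

end ViscoVEM

end

open MeasureTheory
open scoped ContDiff

noncomputable section

namespace ViscoVEM

/-! ### Comparison of norms on finite-dimensional spaces -/

/-! The evolution is handled by an energy argument; most of the work goes into showing that each
discrete form is equivalent to the squared `L²` norm, with constants independent of the mesh
(`form_bounds`).

Energy. Testing the equations with the two stresses and the velocity cancels the divergence terms.
The remaining term `(σ₀ + σ₁, r')` vanishes: the last equation preserves the weak symmetry of the
initial stresses, and for a stress frozen at time `t` the identity `(σ₀ t + σ₁ t, r s) = 0` can be
differentiated in `s`. Let `N = ‖σ₀‖ + ‖σ₁‖ + ‖v‖` attain its maximum at `s₀`. Up to time `s₀` the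
energy grows by at most `ρ N(s₀) ∫ ‖f‖`, and it is comparable with `N²`; dividing by `N(s₀)` gives a
bound whose constant does not involve `T`.

Norm equivalence. Write `σ = Πσ + (σ - Πσ)`. The compliance controls the first part. On the second
part the interior degrees of freedom vanish, since their test tensors have degree at most `k`. What
is left is to compare `‖τ‖²` with `|K|` times the sum of squared edge moments, for `τ ∈ 𝕊(K)`
orthogonal to the polynomials of degree at most `k`.

Edge moments are bounded by the norm (`edgeSq_le_norm`): Green's formula is tested with a lift of
the trace supported over one triangle with apex at the star centre (`trace_le`), and an inverse
estimate absorbs the divergence (`inverse_div`).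

The norm is bounded by the edge moments (`norm_le_edgeSq`, resting on `coercive`): from a row `t`
subtract `(0, p)`, where `p` is a polynomial of degree at most `k` with `∂₀ p = curl t`. The
difference `w` is curl-free, its norm is bounded by that of `t`, and `(t, w) = ‖t‖²` by
orthogonality. On a star-shaped element `w` is an `L²` limit of gradients (`exists_test_approx`). By
Green's formula `(t, ∇φ)` is a boundary term minus `(div t, φ)`, and the trace and Poincaré
inequalities bound it by the normal trace (`pairing_grad_le`); the divergence itself is bounded by
testing with it (`div_le_trace`).

All local constants come from finite-dimensional norm comparison on reference sets and scaling.
Star-shapedness cuts the element into triangles over its edges, of area comparable to `h²`, which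
also yields Green's formula on the polygon (`Polygon.Star.green`). -/

theorem exists_norm_le_of_injective {V E F : Type*} [AddCommGroup V] [Module ℝ V]
    [FiniteDimensional ℝ V] [NormedAddCommGroup E] [NormedSpace ℝ E] [NormedAddCommGroup F]
    [NormedSpace ℝ F] (T : V →ₗ[ℝ] E) (hT : Function.Injective T) (S : V →ₗ[ℝ] F) :
    ∃ C > 0, ∀ v, ‖S v‖ ≤ C * ‖T v‖ := by
  let e := LinearEquiv.ofInjective T hT
  -- On the finite-dimensional range of `T` the map `S ∘ T⁻¹` is automatically continuous; its
  -- operator norm, raised by one to be positive, is the constant.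
  let g : LinearMap.range T →L[ℝ] F := LinearMap.toContinuousLinearMap (S ∘ₗ e.symm.toLinearMap)
  refine ⟨‖g‖ + 1, by positivity, fun v => ?_⟩
  have h1 : S v = g (e v) := by simp [g]
  have h2 : ‖e v‖ = ‖T v‖ := by simp [e, Submodule.coe_norm]
  calc ‖S v‖ = ‖g (e v)‖ := by rw [h1]
    _ ≤ ‖g‖ * ‖e v‖ := g.le_opNorm _
    _ ≤ (‖g‖ + 1) * ‖T v‖ := by rw [h2]; nlinarith [norm_nonneg (T v)]

section Lp
variable {α : Type*} [MeasurableSpace α] {μ : Measure α}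

theorem norm_toLp_sq {f : α → ℝ} (hf : MemLp f 2 μ) : ‖hf.toLp f‖ ^ 2 = ∫ x, f x ^ 2 ∂μ := by
  rw [← real_inner_self_eq_norm_sq, L2.inner_def]
  refine integral_congr_ae ?_
  filter_upwards [hf.coeFn_toLp] with x hx
  simp [hx, sq]

/-- A linear map into square integrable functions, as a map into `L²`. -/
def toL2 {V : Type*} [AddCommGroup V] [Module ℝ V] (L : V →ₗ[ℝ] (α → ℝ))
    (h : ∀ v, MemLp (L v) 2 μ) : V →ₗ[ℝ] Lp ℝ 2 μ where
  toFun v := (h v).toLp (L v)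
  map_add' v w := by
    rw [← MemLp.toLp_add]
    exact (MemLp.toLp_eq_toLp_iff _ _).2 (by simp)
  map_smul' c v := by
    rw [RingHom.id_apply, ← MemLp.toLp_const_smul]
    exact (MemLp.toLp_eq_toLp_iff _ _).2 (by simp)

/-- The source of all the constants on reference sets: they depend only on the finite-dimensional
space and the two maps, so after scaling they do not see the element. -/
theorem exists_integral_sq_le {β V : Type*} [MeasurableSpace β] {ν : Measure β}
    [AddCommGroup V] [Module ℝ V] [FiniteDimensional ℝ V]
    (L₁ : V →ₗ[ℝ] (α → ℝ)) (L₂ : V →ₗ[ℝ] (β → ℝ)) (h₁ : ∀ v, MemLp (L₁ v) 2 μ)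
    (h₂ : ∀ v, MemLp (L₂ v) 2 ν) (inj : ∀ v, L₁ v =ᵐ[μ] 0 → v = 0) :
    ∃ C > 0, ∀ v, ∫ x, L₂ v x ^ 2 ∂ν ≤ C * ∫ x, L₁ v x ^ 2 ∂μ := by
  obtain ⟨C, hC, h⟩ := exists_norm_le_of_injective (toL2 L₁ h₁)
    ((injective_iff_map_eq_zero _).2 fun v hv => inj v <| by
      have : (h₁ v).toLp (L₁ v) = 0 := hv
      have h0 := (h₁ v).coeFn_toLp
      rw [this] at h0
      exact h0.symm.trans (Lp.coeFn_zero ℝ 2 μ)) (toL2 L₂ h₂)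
  refine ⟨C ^ 2, by positivity, fun v => ?_⟩
  rw [← norm_toLp_sq (h₁ v), ← norm_toLp_sq (h₂ v), ← mul_pow]
  exact pow_le_pow_left₀ (norm_nonneg _) (h v) 2

theorem sq_integral_mul_le {f g : α → ℝ} (hf : MemLp f 2 μ) (hg : MemLp g 2 μ) :
    (∫ x, f x * g x ∂μ) ^ 2 ≤ (∫ x, f x ^ 2 ∂μ) * ∫ x, g x ^ 2 ∂μ := by
  have h : inner ℝ (hf.toLp f) (hg.toLp g) = ∫ x, f x * g x ∂μ := by
    rw [L2.inner_def]
    refine integral_congr_ae ?_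
    filter_upwards [hf.coeFn_toLp, hg.coeFn_toLp] with x hx hy
    simp [hx, hy, mul_comm]
  rw [← norm_toLp_sq hf, ← norm_toLp_sq hg, ← h, ← mul_pow]
  exact sq_le_sq' (neg_le_of_abs_le (abs_real_inner_le_norm _ _))
    (le_of_abs_le (abs_real_inner_le_norm _ _))

end Lp

/-! ### Polynomial functions on the plane -/

/-- Evaluation of polynomials, as a linear map. -/
def pvalLin : MvPolynomial (Fin 2) ℝ →ₗ[ℝ] (Plane → ℝ) where
  toFun q := pval q
  map_add' p q := by ext x; simp [pval]
  map_smul' c q := by ext x; simp [pval]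

/-- Polynomial functions of total degree at most `k`. -/
def polyFun (k : ℕ) : Submodule ℝ (Plane → ℝ) :=
  (MvPolynomial.restrictTotalDegree (Fin 2) ℝ k).map pvalLin

instance (k : ℕ) : FiniteDimensional ℝ (polyFun k) := by
  unfold polyFun; infer_instance

theorem mem_polyFun {k : ℕ} {f : Plane → ℝ} :
    f ∈ polyFun k ↔ ∃ q : MvPolynomial (Fin 2) ℝ, q.totalDegree ≤ k ∧ pval q = f := by
  simp only [polyFun, Submodule.mem_map, MvPolynomial.mem_restrictTotalDegree]
  rfl

theorem pval_mem_polyFun {k : ℕ} {q : MvPolynomial (Fin 2) ℝ} (hq : q.totalDegree ≤ k) :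
    pval q ∈ polyFun k := mem_polyFun.2 ⟨q, hq, rfl⟩

theorem polyFun_mono {k l : ℕ} (h : k ≤ l) : polyFun k ≤ polyFun l := by
  intro f hf
  obtain ⟨q, hq, rfl⟩ := mem_polyFun.1 hf
  exact pval_mem_polyFun (hq.trans h)

theorem mul_mem_polyFun {k l : ℕ} {f g : Plane → ℝ} (hf : f ∈ polyFun k) (hg : g ∈ polyFun l) :
    (fun x => f x * g x) ∈ polyFun (k + l) := by
  obtain ⟨p, hp, rfl⟩ := mem_polyFun.1 hf
  obtain ⟨q, hq, rfl⟩ := mem_polyFun.1 hg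
  exact mem_polyFun.2 ⟨p * q, (MvPolynomial.totalDegree_mul _ _).trans (add_le_add hp hq),
    by ext x; simp [pval]⟩

theorem const_mem_polyFun (k : ℕ) (a : ℝ) : (fun _ => a) ∈ polyFun k :=
  mem_polyFun.2 ⟨MvPolynomial.C a, by simp, by ext x; simp [pval]⟩

theorem coord_mem_polyFun (j : Fin 2) : (fun x : Plane => x j) ∈ polyFun 1 :=
  mem_polyFun.2 ⟨MvPolynomial.X j, by simp, by ext x; simp [pval]⟩

theorem pow_mem_polyFun {k : ℕ} {f : Plane → ℝ} (hf : f ∈ polyFun k) (n : ℕ) :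
    (fun x => f x ^ n) ∈ polyFun (n * k) := by
  induction n with
  | zero => simpa using const_mem_polyFun 0 1
  | succ n ih =>
    have := mul_mem_polyFun ih hf
    rw [Nat.succ_mul]
    simpa [pow_succ] using this

/-- Monomials span the polynomial functions. -/
theorem polyFun_le {k : ℕ} {S : Submodule ℝ (Plane → ℝ)}
    (h : ∀ a b, a + b ≤ k → (fun x : Plane => x 0 ^ a * x 1 ^ b) ∈ S) : polyFun k ≤ S := by
  intro f hf
  obtain ⟨q, hq, rfl⟩ := mem_polyFun.1 hf
  have h1 : pval q = ∑ m ∈ q.support, q.coeff m • fun x : Plane => x 0 ^ m 0 * x 1 ^ m 1 := by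
    ext x
    simp [pval, MvPolynomial.eval_eq']
  rw [h1]
  refine Submodule.sum_mem _ fun m hm => Submodule.smul_mem _ _ (h _ _ ?_)
  have := MvPolynomial.le_totalDegree hm
  rw [Finsupp.sum_fintype _ _ (by simp), Fin.sum_univ_two] at this
  omega

/-- On monomials an affine substitution does not raise the degree. This transports polynomials
between an element and the reference ball. -/
theorem comp_mem_polyFun {k : ℕ} {F : Plane → Plane} (hF : ∀ j, (fun x => F x j) ∈ polyFun 1)
    {f : Plane → ℝ} (hf : f ∈ polyFun k) : (fun x => f (F x)) ∈ polyFun k := by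
  let S : Submodule ℝ (Plane → ℝ) := (polyFun k).comap (LinearMap.funLeft ℝ ℝ F)
  suffices polyFun k ≤ S from this hf
  refine polyFun_le fun a b hab => ?_
  have := mul_mem_polyFun (pow_mem_polyFun (hF 0) a) (pow_mem_polyFun (hF 1) b)
  exact polyFun_mono (by omega) this

theorem affine_mem_polyFun (c : Plane) (h : ℝ) (j : Fin 2) :
    (fun x : Plane => (c + h • x) j) ∈ polyFun 1 := by
  have := Submodule.add_mem _ (const_mem_polyFun 1 (c j))
    (Submodule.smul_mem _ h (coord_mem_polyFun j))
  exact this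

theorem contDiff_of_mem_polyFun {k : ℕ} {f : Plane → ℝ} (hf : f ∈ polyFun k) : ContDiff ℝ ∞ f := by
  let S : Submodule ℝ (Plane → ℝ) :=
    { carrier := {f | ContDiff ℝ ∞ f}
      zero_mem' := show ContDiff ℝ ∞ fun _ : Plane => (0 : ℝ) from contDiff_const
      add_mem' := fun {f g} (h : ContDiff ℝ ∞ f) (h' : ContDiff ℝ ∞ g) => h.add h'
      smul_mem' := fun c f (h : ContDiff ℝ ∞ f) => h.const_smul c }
  suffices polyFun k ≤ S from this hf
  refine polyFun_le fun a b _ => ?_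
  change ContDiff ℝ ∞ _
  fun_prop

theorem pd_add {f g : Plane → ℝ} {x : Plane} (j : Fin 2) (hf : DifferentiableAt ℝ f x)
    (hg : DifferentiableAt ℝ g x) : pd j (f + g) x = pd j f x + pd j g x := by
  simp [pd, fderiv_add hf hg]

theorem pd_smul {f : Plane → ℝ} {x : Plane} (j : Fin 2) (c : ℝ) (hf : DifferentiableAt ℝ f x) :
    pd j (c • f) x = c * pd j f x := by
  simp [pd, fderiv_const_smul hf]

theorem pd_mul {f g : Plane → ℝ} {x : Plane} (j : Fin 2) (hf : DifferentiableAt ℝ f x)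
    (hg : DifferentiableAt ℝ g x) :
    pd j (fun y => f y * g y) x = f x * pd j g x + g x * pd j f x := by
  simp [pd, fderiv_fun_mul hf hg]

theorem pd_const (j : Fin 2) (a : ℝ) (x : Plane) : pd j (fun _ => a) x = 0 := by
  simp [pd]

theorem pd_coord (j i : Fin 2) (x : Plane) :
    pd j (fun y => y i) x = if i = j then 1 else 0 := by
  have : HasFDerivAt (fun y : Plane => y i) (EuclideanSpace.proj i : Plane →L[ℝ] ℝ) x :=
    (EuclideanSpace.proj i : Plane →L[ℝ] ℝ).hasFDerivAt
  simp [pd, this.fderiv]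

theorem pd_pow {f : Plane → ℝ} {x : Plane} (j : Fin 2) (n : ℕ) (hf : DifferentiableAt ℝ f x) :
    pd j (fun y => f y ^ n) x = n * f x ^ (n - 1) * pd j f x := by
  simp [pd, fderiv_fun_pow n hf]

theorem contDiff_pd {f : Plane → ℝ} (hf : ContDiff ℝ ∞ f) (j : Fin 2) : ContDiff ℝ ∞ (pd j f) :=
  (hf.fderiv_right (m := ∞) (by simp)).clm_apply contDiff_const

theorem diffAt_of_contDiff {f : Plane → ℝ} (hf : ContDiff ℝ ∞ f) (x : Plane) :
    DifferentiableAt ℝ f x := hf.contDiffAt.differentiableAt (by simp)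

theorem pd_monomial_zero (a b : ℕ) (x : Plane) :
    pd 0 (fun y => y 0 ^ a * y 1 ^ b) x = a * x 0 ^ (a - 1) * x 1 ^ b := by
  have h (i : Fin 2) : DifferentiableAt ℝ (fun y : Plane => y i) x := by fun_prop
  rw [pd_mul 0 ((h 0).fun_pow a) ((h 1).fun_pow b), pd_pow 0 a (h 0), pd_pow 0 b (h 1),
    pd_coord, pd_coord]
  simp
  ring

theorem pd_monomial_one (a b : ℕ) (x : Plane) :
    pd 1 (fun y => y 0 ^ a * y 1 ^ b) x = b * x 0 ^ a * x 1 ^ (b - 1) := by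
  have h (i : Fin 2) : DifferentiableAt ℝ (fun y : Plane => y i) x := by fun_prop
  rw [pd_mul 1 ((h 0).fun_pow a) ((h 1).fun_pow b), pd_pow 1 a (h 0), pd_pow 1 b (h 1),
    pd_coord, pd_coord]
  simp
  ring

theorem monomial_mem_polyFun {k a b : ℕ} (h : a + b ≤ k) (r : ℝ) :
    (fun x : Plane => r * x 0 ^ a * x 1 ^ b) ∈ polyFun k := by
  have := mul_mem_polyFun (mul_mem_polyFun (const_mem_polyFun 0 r)
    (pow_mem_polyFun (coord_mem_polyFun 0) a)) (pow_mem_polyFun (coord_mem_polyFun 1) b)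
  exact polyFun_mono (by omega) this

theorem pd_mem_polyFun_pred {k : ℕ} {f : Plane → ℝ} (hf : f ∈ polyFun k) (j : Fin 2) :
    pd j f ∈ polyFun (k - 1) := by
  let S : Submodule ℝ (Plane → ℝ) :=
    { carrier := {f | ContDiff ℝ ∞ f ∧ pd j f ∈ polyFun (k - 1)}
      zero_mem' := ⟨contDiff_const, by
        convert const_mem_polyFun (k - 1) 0 using 1; ext x; exact pd_const j 0 x⟩
      add_mem' := fun {f g} h h' => ⟨ContDiff.add h.1 h'.1, by
        convert Submodule.add_mem _ h.2 h'.2 using 1; ext x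
        exact pd_add j (diffAt_of_contDiff h.1 x) (diffAt_of_contDiff h'.1 x)⟩
      smul_mem' := fun c f h => ⟨ContDiff.const_smul c h.1, by
        convert Submodule.smul_mem _ c h.2 using 1; ext x
        exact pd_smul j c (diffAt_of_contDiff h.1 x)⟩ }
  suffices polyFun k ≤ S from (this hf).2
  refine polyFun_le fun a b hab => ⟨by fun_prop, ?_⟩
  have h0 : (fun _ : Plane => (0 : ℝ)) ∈ polyFun (k - 1) := const_mem_polyFun _ 0
  fin_cases j
  · rcases Nat.eq_zero_or_pos a with rfl | ha
    · convert h0 using 1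
      ext x; simpa using pd_monomial_zero 0 b x
    · convert monomial_mem_polyFun (show a - 1 + b ≤ k - 1 by omega) a using 1
      ext x; exact pd_monomial_zero a b x
  · rcases Nat.eq_zero_or_pos b with rfl | hb
    · convert h0 using 1
      ext x; simpa using pd_monomial_one a 0 x
    · convert monomial_mem_polyFun (show a + (b - 1) ≤ k - 1 by omega) b using 1
      ext x; exact pd_monomial_one a b x

theorem pd_mem_polyFun {k : ℕ} {f : Plane → ℝ} (hf : f ∈ polyFun k) (j : Fin 2) :
    pd j f ∈ polyFun k :=
  polyFun_mono (Nat.sub_le _ _) (pd_mem_polyFun_pred hf j)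

/-- Monomials are integrated in the first variable. This later produces a polynomial field with a
prescribed curl. -/
theorem exists_pd_eq {k : ℕ} {f : Plane → ℝ} (hf : f ∈ polyFun k) :
    ∃ p ∈ polyFun (k + 1), pd 0 p = f := by
  let S : Submodule ℝ (Plane → ℝ) :=
    { carrier := {f | ∃ p ∈ polyFun (k + 1), pd 0 p = f}
      zero_mem' := ⟨0, Submodule.zero_mem _, by ext x; exact pd_const 0 0 x⟩
      add_mem' := by
        rintro _ _ ⟨p, hp, rfl⟩ ⟨q, hq, rfl⟩
        exact ⟨p + q, Submodule.add_mem _ hp hq, by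
          ext x
          exact pd_add 0 (diffAt_of_contDiff (contDiff_of_mem_polyFun hp) x)
            (diffAt_of_contDiff (contDiff_of_mem_polyFun hq) x)⟩
      smul_mem' := by
        rintro c _ ⟨p, hp, rfl⟩
        exact ⟨c • p, Submodule.smul_mem _ c hp, by
          ext x
          exact pd_smul 0 c (diffAt_of_contDiff (contDiff_of_mem_polyFun hp) x)⟩ }
  suffices polyFun k ≤ S from this hf
  refine polyFun_le fun a b hab => ⟨_, monomial_mem_polyFun
    (show (a + 1) + b ≤ k + 1 by omega) ((a : ℝ) + 1)⁻¹, ?_⟩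
  ext x
  have h1 : (fun x : Plane => ((a : ℝ) + 1)⁻¹ * x 0 ^ (a + 1) * x 1 ^ b) =
      ((a : ℝ) + 1)⁻¹ • fun x : Plane => x 0 ^ (a + 1) * x 1 ^ b := by
    ext y; simp [mul_assoc]
  rw [h1, pd_smul _ _ (by fun_prop), pd_monomial_zero]
  have : (a : ℝ) + 1 ≠ 0 := by positivity
  push_cast
  field_simp

theorem polyFun_eq_zero {k : ℕ} {f : Plane → ℝ} (hf : f ∈ polyFun k) {U : Set Plane}
    (hU : IsOpen U) (hne : U.Nonempty) (h : ∀ x ∈ U, f x = 0) : f = 0 := by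
  obtain ⟨q, hq, rfl⟩ := mem_polyFun.1 hf
  obtain ⟨c, hc⟩ := hne
  obtain ⟨ε, hε, hε'⟩ := Metric.isOpen_iff.1 hU c hc
  -- The square with half-side `ε / 2` lies in the ball of radius `ε`, and a polynomial vanishing on
  -- a product of infinite sets is zero.
  let s : Fin 2 → Set ℝ := fun j => Set.Ioo (c j - ε / 2) (c j + ε / 2)
  have hs : ∀ j, (s j).Infinite := fun j => Set.Ioo_infinite (by linarith)
  have : q = 0 := by
    refine MvPolynomial.funext_set s hs fun x hx => ?_
    have h1 : WithLp.toLp 2 x ∈ U := by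
      apply hε'
      rw [Metric.mem_ball, EuclideanSpace.dist_eq, Fin.sum_univ_two]
      have h0 := hx 0 (Set.mem_univ _)
      have h1 := hx 1 (Set.mem_univ _)
      simp only [s, Set.mem_Ioo] at h0 h1
      rw [Real.sqrt_lt' hε, Real.dist_eq, Real.dist_eq, sq_abs, sq_abs]
      simp only
      nlinarith
    simpa [pval] using h _ h1
  subst this
  ext x; simp [pval]

/-! ### Scaling and test functions -/

theorem integral_scale (f : Plane → ℝ) (c : Plane) {h : ℝ} (hh : 0 < h) :
    ∫ x, f x = h ^ 2 * ∫ y, f (c + h • y) := by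
  have h1 := Measure.integral_comp_smul (volume : Measure Plane) (fun x => f (c + x)) h
  rw [h1, integral_add_left_eq_self]
  simp only [finrank_euclideanSpace, Fintype.card_fin, smul_eq_mul]
  rw [abs_of_pos (by positivity)]
  field_simp

theorem setIntegral_scale (f : Plane → ℝ) (c : Plane) {h : ℝ} (hh : 0 < h) {S : Set Plane}
    (hS : MeasurableSet S) :
    ∫ x in S, f x = h ^ 2 * ∫ y in {y | c + h • y ∈ S}, f (c + h • y) := by
  have hS' : MeasurableSet {y : Plane | c + h • y ∈ S} :=
    hS.preimage (by fun_prop : Measurable fun y : Plane => c + h • y)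
  rw [← integral_indicator hS, ← integral_indicator hS', integral_scale _ c hh]
  rfl

theorem scale_mem_closedBall {c y : Plane} {h r : ℝ} (hh : 0 < h) :
    c + h • y ∈ Metric.closedBall c (r * h) ↔ y ∈ Metric.closedBall 0 r := by
  rw [Metric.mem_closedBall, Metric.mem_closedBall, dist_self_add_left, dist_zero_right, norm_smul,
    Real.norm_of_nonneg hh.le, mul_comm]
  exact mul_le_mul_iff_left₀ hh

theorem scale_mem_ball {c y : Plane} {h r : ℝ} (hh : 0 < h) :
    c + h • y ∈ Metric.ball c (r * h) ↔ y ∈ Metric.ball 0 r := by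
  rw [Metric.mem_ball, Metric.mem_ball, dist_self_add_left, dist_zero_right, norm_smul,
    Real.norm_of_nonneg hh.le, mul_comm]
  exact mul_lt_mul_iff_left₀ hh

theorem setIntegral_closedBall (f : Plane → ℝ) (c : Plane) {h : ℝ} (hh : 0 < h) :
    ∫ x in Metric.closedBall c h, f x =
      h ^ 2 * ∫ y in Metric.closedBall 0 1, f (c + h • y) := by
  rw [setIntegral_scale f c hh measurableSet_closedBall]
  have : {y | c + h • y ∈ Metric.closedBall c h} = Metric.closedBall 0 1 := by
    ext y
    simpa using scale_mem_closedBall (c := c) (y := y) (r := 1) hh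
  rw [this]

theorem setIntegral_ball (f : Plane → ℝ) (c : Plane) {h : ℝ} (r : ℝ) (hh : 0 < h) :
    ∫ x in Metric.ball c (r * h), f x =
      h ^ 2 * ∫ y in Metric.ball 0 r, f (c + h • y) := by
  rw [setIntegral_scale f c hh measurableSet_ball]
  have : {y | c + h • y ∈ Metric.ball c (r * h)} = Metric.ball 0 r := by
    ext y
    rw [Set.mem_ofPred_eq, scale_mem_ball hh]
  rw [this]

theorem pd_scale {f : Plane → ℝ} (hf : ContDiff ℝ ∞ f) (c : Plane) (h : ℝ) (j : Fin 2)
    (y : Plane) : pd j (fun y => f (c + h • y)) y = h * pd j f (c + h • y) := by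
  have h1 : HasFDerivAt (fun y : Plane => c + h • y) (h • ContinuousLinearMap.id ℝ Plane) y :=
    ((hasFDerivAt_id y).const_smul h).const_add c
  have h2 := (diffAt_of_contDiff hf (c + h • y)).hasFDerivAt.comp y h1
  change fderiv ℝ (f ∘ fun y : Plane => c + h • y) y _ = _
  rw [h2.fderiv]
  simp [pd]

theorem memLp_of_continuous {f : Plane → ℝ} (hf : Continuous f) {S : Set Plane}
    (hS : Bornology.IsBounded S) : MemLp f 2 (volume.restrict S) := by
  obtain ⟨C, hC⟩ := (Metric.isCompact_of_isClosed_isBounded isClosed_closure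
    hS.closure).exists_bound_of_continuousOn hf.continuousOn
  have h1 : IsFiniteMeasure ((volume : Measure Plane).restrict (closure S)) :=
    ⟨by simpa using hS.closure.measure_lt_top⟩
  have : MemLp f 2 (volume.restrict (closure S)) :=
    MemLp.of_bound hf.aestronglyMeasurable C
      ((ae_restrict_iff' isClosed_closure.measurableSet).2 (ae_of_all _ fun x hx => hC x hx))
  exact this.mono_measure (Measure.restrict_mono subset_closure le_rfl)

theorem integrableOn_of_continuous {f : Plane → ℝ} (hf : Continuous f) {S : Set Plane}
    (hS : Bornology.IsBounded S) : IntegrableOn f S := by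
  have hfin : IsFiniteMeasure ((volume : Measure Plane).restrict S) :=
    ⟨by simpa using hS.measure_lt_top⟩
  exact (memLp_of_continuous hf hS).integrable (by norm_num)

theorem memLp_polyFun {k : ℕ} {f : Plane → ℝ} (hf : f ∈ polyFun k) {S : Set Plane}
    (hS : Bornology.IsBounded S) : MemLp f 2 (volume.restrict S) :=
  memLp_of_continuous (contDiff_of_mem_polyFun hf).continuous hS

theorem IsTest.continuous_pd {φ : Plane → ℝ} (h : IsTest φ) (j : Fin 2) :
    Continuous (pd j φ) := (contDiff_pd h.1 j).continuous

theorem hasCompactSupport_pd {φ : Plane → ℝ} (h : HasCompactSupport φ) (j : Fin 2) :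
    HasCompactSupport (pd j φ) :=
  (h.fderiv (𝕜 := ℝ)).mono fun x hx h0 => hx (by simp [pd, h0])

theorem IsTest.memLp {φ : Plane → ℝ} (h : IsTest φ) : MemLp φ 2 volume :=
  h.1.continuous.memLp_of_hasCompactSupport h.2

theorem IsTest.memLp_pd {φ : Plane → ℝ} (h : IsTest φ) (j : Fin 2) : MemLp (pd j φ) 2 volume :=
  (h.continuous_pd j).memLp_of_hasCompactSupport (hasCompactSupport_pd h.2 j)

/-- The restriction of a smooth function to a bounded set is that of a test function. -/
theorem exists_isTest_eqOn {f : Plane → ℝ} {S : Set Plane} (hS : Bornology.IsBounded S)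
    {U : Set Plane} (hU : IsOpen U) (hSU : closure S ⊆ U) (hf : ContDiffOn ℝ ∞ f U) :
    ∃ φ, IsTest φ ∧ ∀ x ∈ closure S, φ =ᶠ[nhds x] f := by
  have hc : IsCompact (closure S) :=
    Metric.isCompact_of_isClosed_isBounded isClosed_closure hS.closure
  -- Two nested neighbourhoods of `closure S`: the cutoff equals one on `closure V`, so the product
  -- agrees with `f` near every point of `closure S`, and its support `closure W` stays inside `U`,
  -- where `f` is smooth.
  obtain ⟨V, hV, hSV, hVU, hVc⟩ := exists_open_between_and_isCompact_closure hc hU hSU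
  obtain ⟨W, hW, hVW, hWU, hWc⟩ := exists_open_between_and_isCompact_closure hVc hU hVU
  obtain ⟨χ, hχ, -, hχs, hχ1⟩ := exists_contMDiff_support_eq_eq_one_iff
    (modelWithCornersSelf ℝ Plane) hW isClosed_closure hVW
  have hts : tsupport χ = closure W := by rw [tsupport, hχs]
  refine ⟨fun x => χ x * f x, ⟨?_, ?_⟩, fun x hx => ?_⟩
  · rw [contDiff_iff_contDiffAt]
    intro x
    by_cases hx : x ∈ U
    · exact hχ.contDiff.contDiffAt.mul (hf.contDiffAt (hU.mem_nhds hx))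
    · have hx' : x ∉ tsupport χ := fun h => hx (hWU (hts ▸ h))
      have : (fun x => χ x * f x) =ᶠ[nhds x] fun _ => 0 := by
        filter_upwards [notMem_tsupport_iff_eventuallyEq.1 hx'] with y hy
        simp [hy]
      exact contDiffAt_const.congr_of_eventuallyEq this
  · have : HasCompactSupport χ := by rw [HasCompactSupport, hts]; exact hWc
    exact this.mul_right
  · filter_upwards [hV.mem_nhds (hSV hx)] with y hy
    rw [(hχ1 y).1 (subset_closure hy), one_mul]

theorem pd_congr {f g : Plane → ℝ} {x : Plane} (h : f =ᶠ[nhds x] g) (j : Fin 2) :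
    pd j f x = pd j g x := by
  rw [pd, pd, h.fderiv_eq]

/-! ### Inverse inequalities for polynomials -/

/-- `d` is the distributional divergence of the vector field `t` on `U`. -/
def HasRowDiv (U : Set Plane) (t : Fin 2 → Plane → ℝ) (d : Plane → ℝ) : Prop :=
  ∀ φ : Plane → ℝ, IsTest φ → tsupport φ ⊆ U →
    ∫ x in U, ∑ j, t j x * pd j φ x = - ∫ x in U, d x * φ x

theorem exists_bump {η : ℝ} (hη : 0 < η) (c : Plane) : ∃ β : Plane → ℝ, IsTest β ∧
    tsupport β ⊆ Metric.ball c η ∧ ∀ x ∈ Metric.ball c (η / 4), β x = 1 := by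
  let b : ContDiffBump c := ⟨η / 4, η / 2, by positivity, by linarith⟩
  refine ⟨b, ⟨b.contDiff, b.hasCompactSupport⟩, ?_, fun x hx => ?_⟩
  · rw [b.tsupport_eq]
    exact Metric.closedBall_subset_ball (by change η / 2 < η; linarith)
  · exact b.one_of_mem_closedBall (Metric.ball_subset_closedBall hx)

theorem IsTest.mul_left {β f : Plane → ℝ} (hβ : IsTest β) (hf : ContDiff ℝ ∞ f) :
    IsTest fun x => β x * f x :=
  ⟨hβ.1.mul hf, hβ.2.mul_right⟩

/-- Multiplication of polynomial functions by a given function. -/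
def mulLin (k : ℕ) (β : Plane → ℝ) : polyFun k →ₗ[ℝ] (Plane → ℝ) where
  toFun q := fun x => β x * (q : Plane → ℝ) x
  map_add' p q := by ext x; simp [mul_add]
  map_smul' c q := by ext x; simp; ring

/-- Partial derivative of the product of polynomial functions and a given smooth function. -/
def pdMulLin (k : ℕ) (j : Fin 2) (β : Plane → ℝ) (hβ : ContDiff ℝ ∞ β) :
    polyFun k →ₗ[ℝ] (Plane → ℝ) where
  toFun q := pd j fun x => β x * (q : Plane → ℝ) x
  map_add' p q := by
    ext x
    have hp := diffAt_of_contDiff (hβ.mul (contDiff_of_mem_polyFun p.2)) x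
    have hq := diffAt_of_contDiff (hβ.mul (contDiff_of_mem_polyFun q.2)) x
    rw [Pi.add_apply, ← pd_add j hp hq]
    congr 1
    ext y; simp [mul_add]
  map_smul' c q := by
    ext x
    have hq := diffAt_of_contDiff (hβ.mul (contDiff_of_mem_polyFun q.2)) x
    rw [Pi.smul_apply, RingHom.id_apply, smul_eq_mul, ← pd_smul j c hq]
    congr 1
    ext y; simp; ring

/-- Makes `q ↦ ‖β q‖` a norm on polynomials, since `β` is one on a ball. -/
theorem mulLin_ae_eq_zero {k : ℕ} {β : Plane → ℝ} (hβ : Continuous β) {c : Plane} {η : ℝ}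
    (hη : 0 < η) (h1 : ∀ x ∈ Metric.ball c η, β x = 1) {q : polyFun k}
    (h : mulLin k β q =ᵐ[volume] 0) : q = 0 := by
  have h2 : mulLin k β q = 0 :=
    (Continuous.ae_eq_iff_eq volume
      (hβ.mul (contDiff_of_mem_polyFun q.2).continuous) continuous_const).1 h
  refine Subtype.ext (polyFun_eq_zero q.2 Metric.isOpen_ball ⟨c, Metric.mem_ball_self hη⟩
    fun x hx => ?_)
  have := congrFun h2 x
  simpa [mulLin, h1 x hx] using this

/-- The divergence is tested with `β² d`, where `β` is a bump scaled to the inner ball. The pairing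
is exactly `‖β d‖²`, which on polynomials dominates `‖d‖²` over the enclosing disc, while the
derivative of the test function costs one power of `h`. No smoothness of `t` is needed. -/
theorem inverse_div (k : ℕ) {η : ℝ} (hη : 0 < η) : ∃ C > 0, ∀ (K : Set Plane) (c : Plane) (h : ℝ),
    0 < h → MeasurableSet K → Metric.ball c (η * h) ⊆ K → K ⊆ Metric.closedBall c h →
    ∀ (t : Fin 2 → Plane → ℝ) (d : Plane → ℝ), (∀ j, MemLp (t j) 2 (volume.restrict K)) →
    d ∈ polyFun k → HasRowDiv K t d →
    h ^ 2 * ∫ x in K, d x ^ 2 ≤ C * ∑ j, ∫ x in K, t j x ^ 2 := by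
  obtain ⟨β, hβ, hβs, hβ1⟩ := exists_bump hη 0
  have hβ2 : IsTest fun x => β x * β x := hβ.mul_left hβ.1
  have hm1 (v : polyFun k) : MemLp (mulLin k β v) 2 volume :=
    (hβ.mul_left (contDiff_of_mem_polyFun v.2)).memLp
  obtain ⟨C₀, hC₀, H₀⟩ := exists_integral_sq_le (μ := volume)
    (ν := volume.restrict (Metric.closedBall 0 1)) (mulLin k β) (polyFun k).subtype hm1
    (fun v => memLp_polyFun v.2 Metric.isBounded_closedBall)
    (fun q hq => mulLin_ae_eq_zero hβ.1.continuous (by positivity) hβ1 hq)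
  have H (j : Fin 2) := exists_integral_sq_le (μ := volume)
    (ν := volume) (mulLin k β) (pdMulLin k j _ hβ2.1) hm1
    (fun v => (hβ2.mul_left (contDiff_of_mem_polyFun v.2)).memLp_pd j)
    (fun q hq => mulLin_ae_eq_zero hβ.1.continuous (by positivity) hβ1 hq)
  choose C hC H using H
  refine ⟨2 * C₀ * (C 0 + C 1), by have := hC 0; have := hC 1; positivity, ?_⟩
  intro K c h hh hK hball hKb t d ht hd hdiv
  have hdh : (fun y => d (c + h • y)) ∈ polyFun k := comp_mem_polyFun (affine_mem_polyFun c h) hd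
  set dh : polyFun k := ⟨_, hdh⟩ with hdhdef
  set N := ∫ x, mulLin k β dh x ^ 2 with hN
  have hN0 : 0 ≤ N := integral_nonneg fun x => sq_nonneg _
  -- The test function `β² d`, with `β` pulled back by the inverse of `y ↦ c + h y`.
  set φ : Plane → ℝ := fun x => β (-(h⁻¹ • c) + h⁻¹ • x) * β (-(h⁻¹ • c) + h⁻¹ • x) * d x with hφ
  have hback (y : Plane) : -(h⁻¹ • c) + h⁻¹ • (c + h • y) = y := by
    rw [smul_add, smul_smul, inv_mul_cancel₀ hh.ne', one_smul]; abel
  have hback' (x : Plane) : c + h • (-(h⁻¹ • c) + h⁻¹ • x) = x := by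
    rw [smul_add, smul_neg, smul_smul, smul_smul, mul_inv_cancel₀ hh.ne', one_smul, one_smul]; abel
  have hφd : ContDiff ℝ ∞ φ := by
    have h1 := hβ.1
    have h2 := contDiff_of_mem_polyFun hd
    fun_prop
  have hφs : tsupport φ ⊆ (fun x => -(h⁻¹ • c) + h⁻¹ • x) ⁻¹' tsupport β := by
    refine closure_minimal (fun x hx => ?_)
      ((isClosed_tsupport β).preimage (by fun_prop : Continuous _))
    refine subset_tsupport _ fun h0 => hx ?_
    simp [hφ, h0]
  have hφb : tsupport φ ⊆ Metric.ball c (η * h) := fun x hx => by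
    have := hβs (hφs hx)
    rw [← scale_mem_ball (c := c) hh, hback'] at this
    exact this
  have hφt : IsTest φ := ⟨hφd, Metric.isCompact_of_isClosed_isBounded (isClosed_tsupport _)
    (Metric.isBounded_ball.subset hφb)⟩
  have hφK : tsupport φ ⊆ K := hφb.trans hball
  have e1 : ∫ x in K, d x * φ x = h ^ 2 * N := by
    rw [setIntegral_eq_integral_of_forall_compl_eq_zero, integral_scale _ c hh, hN]
    · congr 2
      ext y
      simp only [hφ, hback, mulLin, hdhdef, LinearMap.coe_mk, AddHom.coe_mk]
      ring
    · intro x hx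
      rw [image_eq_zero_of_notMem_tsupport fun h0 => hx (hφK h0), mul_zero]
  have e2 (j : Fin 2) : ∫ x in K, pd j φ x ^ 2 ≤ C j * N := by
    calc ∫ x in K, pd j φ x ^ 2 ≤ ∫ x, pd j φ x ^ 2 :=
          setIntegral_le_integral (hφt.memLp_pd j).integrable_sq (ae_of_all _ fun x => sq_nonneg _)
      _ = ∫ y, pdMulLin k j _ hβ2.1 dh y ^ 2 := by
          rw [integral_scale _ c hh, ← integral_const_mul]
          congr 1
          ext y
          have := pd_scale hφd c h j y
          rw [← mul_pow, ← this]
          congr 2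
          ext z
          simp only [hφ, hback, hdhdef]
      _ ≤ C j * N := H j dh
  have hpm (j : Fin 2) : MemLp (pd j φ) 2 (volume.restrict K) := (hφt.memLp_pd j).restrict K
  have e3 : h ^ 2 * N = - ∑ j, ∫ x in K, t j x * pd j φ x := by
    have hint (j : Fin 2) : Integrable (fun x => t j x * pd j φ x) (volume.restrict K) :=
      (ht j).integrable_mul (hpm j)
    rw [← integral_finsetSum _ fun j _ => hint j, hdiv φ hφt hφK, e1, neg_neg]
  have e4 (j : Fin 2) : (∫ x in K, t j x * pd j φ x) ^ 2 ≤ (∫ x in K, t j x ^ 2) * (C j * N) :=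
    (sq_integral_mul_le (ht j) (hpm j)).trans
      (mul_le_mul_of_nonneg_left (e2 j) (integral_nonneg fun x => sq_nonneg _))
  have hA (j : Fin 2) : 0 ≤ ∫ x in K, t j x ^ 2 := integral_nonneg fun x => sq_nonneg _
  have e5 : h ^ 4 * N ≤ 2 * (C 0 + C 1) * ∑ j, ∫ x in K, t j x ^ 2 := by
    have h0 := e4 0
    have h1 := e4 1
    rw [Fin.sum_univ_two] at e3 ⊢
    have hA0 := hA 0
    have hA1 := hA 1
    have hc0 := hC 0
    have hc1 := hC 1
    generalize (∫ x in K, t 0 x * pd 0 φ x) = X at *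
    generalize (∫ x in K, t 1 x * pd 1 φ x) = Y at *
    generalize (∫ x in K, t 0 x ^ 2) = A at *
    generalize (∫ x in K, t 1 x ^ 2) = B at *
    -- Since `h² N = -(X + Y)`, this is Cauchy–Schwarz squared; one factor `N` cancels afterwards.
    have e6 : (h ^ 4 * N) * N ≤ (2 * (C 0 + C 1) * (A + B)) * N := by
      have : (h ^ 4 * N) * N = (X + Y) ^ 2 := by
        rw [← neg_sq, ← e3]; ring
      rw [this]
      nlinarith [sq_nonneg (X - Y), mul_nonneg (mul_nonneg hA0 hc1.le) hN0,
        mul_nonneg (mul_nonneg hA1 hc0.le) hN0]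
    rcases hN0.eq_or_lt with h0 | h0
    · rw [← h0, mul_zero]; positivity
    · exact le_of_mul_le_mul_right e6 h0
  calc h ^ 2 * ∫ x in K, d x ^ 2 ≤ h ^ 2 * ∫ x in Metric.closedBall c h, d x ^ 2 := by
        refine mul_le_mul_of_nonneg_left ?_ (by positivity)
        exact setIntegral_mono_set (memLp_polyFun hd Metric.isBounded_closedBall).integrable_sq
          (ae_of_all _ fun x => sq_nonneg _) hKb.eventuallyLE
    _ = h ^ 4 * ∫ y in Metric.closedBall 0 1, d (c + h • y) ^ 2 := by
        rw [setIntegral_closedBall _ c hh]; ring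
    _ ≤ h ^ 4 * (C₀ * N) := mul_le_mul_of_nonneg_left (H₀ dh) (by positivity)
    _ = C₀ * (h ^ 4 * N) := by ring
    _ ≤ C₀ * _ := mul_le_mul_of_nonneg_left e5 hC₀.le
    _ = _ := by ring

theorem polyFun_ae_eq_zero {k : ℕ} {f : Plane → ℝ} (hf : f ∈ polyFun k) {U : Set Plane}
    (hU : IsOpen U) (hne : U.Nonempty) (h : f =ᵐ[volume.restrict U] 0) : f = 0 := by
  refine polyFun_eq_zero hf hU hne ?_
  exact Measure.eqOn_open_of_ae_eq h hU (contDiff_of_mem_polyFun hf).continuous.continuousOn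
    continuousOn_const

/-- The element lies between concentric discs of radii `η h` and `h`, so it suffices to compare two
norms of a polynomial on the reference discs of radii `η` and `1`. -/
theorem inverse_grad (k : ℕ) {η : ℝ} (hη : 0 < η) : ∃ C > 0, ∀ (K : Set Plane) (c : Plane) (h : ℝ),
    0 < h → MeasurableSet K → Metric.ball c (η * h) ⊆ K → K ⊆ Metric.closedBall c h →
    ∀ d ∈ polyFun k, ∀ j, h ^ 2 * ∫ x in K, pd j d x ^ 2 ≤ C * ∫ x in K, d x ^ 2 := by
  have H (j : Fin 2) := exists_integral_sq_le (μ := volume.restrict (Metric.ball 0 η))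
    (ν := volume.restrict (Metric.closedBall 0 1)) (polyFun k).subtype
    (pdMulLin k j (fun _ => 1) contDiff_const)
    (fun v => memLp_polyFun v.2 Metric.isBounded_ball)
    (fun v => by
      refine memLp_polyFun (k := k) ?_ Metric.isBounded_closedBall
      have := pd_mem_polyFun v.2 j
      simpa [pdMulLin] using this)
    (fun q hq => Subtype.ext
      (polyFun_ae_eq_zero q.2 Metric.isOpen_ball ⟨0, Metric.mem_ball_self hη⟩ hq))
  choose C hC H using H
  refine ⟨C 0 + C 1, by have := hC 0; have := hC 1; positivity, ?_⟩
  intro K c h hh hK hball hKb d hd j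
  have hdh : (fun y => d (c + h • y)) ∈ polyFun k := comp_mem_polyFun (affine_mem_polyFun c h) hd
  have hbd : Bornology.IsBounded K := Metric.isBounded_closedBall.subset hKb
  have hCj : C j ≤ C 0 + C 1 := by
    have := hC 0; have := hC 1
    fin_cases j <;> simp <;> linarith
  calc h ^ 2 * ∫ x in K, pd j d x ^ 2 ≤ h ^ 2 * ∫ x in Metric.closedBall c h, pd j d x ^ 2 := by
        refine mul_le_mul_of_nonneg_left ?_ (by positivity)
        exact setIntegral_mono_set
          (memLp_polyFun (pd_mem_polyFun hd j) Metric.isBounded_closedBall).integrable_sq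
          (ae_of_all _ fun x => sq_nonneg _) hKb.eventuallyLE
    _ = h ^ 2 * ∫ y in Metric.closedBall 0 1, pdMulLin k j (fun _ => 1) contDiff_const ⟨_, hdh⟩ y ^ 2 := by
        rw [setIntegral_closedBall _ c hh, ← integral_const_mul]
        congr 2
        ext y
        rw [← mul_pow, ← pd_scale (contDiff_of_mem_polyFun hd)]
        simp [pdMulLin]
    _ ≤ h ^ 2 * (C j * ∫ y in Metric.ball 0 η, d (c + h • y) ^ 2) :=
        mul_le_mul_of_nonneg_left (H j ⟨_, hdh⟩) (by positivity)
    _ = C j * ∫ x in Metric.ball c (η * h), d x ^ 2 := by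
        rw [setIntegral_ball _ c η hh]; ring
    _ ≤ C j * ∫ x in K, d x ^ 2 := by
        refine mul_le_mul_of_nonneg_left ?_ (hC j).le
        exact setIntegral_mono_set (memLp_polyFun hd hbd).integrable_sq
          (ae_of_all _ fun x => sq_nonneg _) hball.eventuallyLE
    _ ≤ _ := mul_le_mul_of_nonneg_right hCj (integral_nonneg fun x => sq_nonneg _)

/-- A linear right inverse of `∂₀` is fixed once on reference polynomials; finite dimension bounds
it, and undoing the scaling produces the factor `h`. -/
theorem exists_antideriv (k : ℕ) {η : ℝ} (hη : 0 < η) :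
    ∃ C > 0, ∀ (K : Set Plane) (c : Plane) (h : ℝ),
    0 < h → MeasurableSet K → Metric.ball c (η * h) ⊆ K → K ⊆ Metric.closedBall c h →
    ∀ q ∈ polyFun k, ∃ p ∈ polyFun (k + 1), pd 0 p = q ∧
      ∫ x in K, p x ^ 2 ≤ C * (h ^ 2 * ∫ x in K, q x ^ 2) := by
  obtain ⟨R, hR⟩ : ∃ R : polyFun k →ₗ[ℝ] polyFun (k + 1),
      ∀ q, pd 0 (R q : Plane → ℝ) = (q : Plane → ℝ) := by
    -- Polynomials of degree at most `k + 1` whose first derivative has degree at most `k`: on them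
    -- `∂₀` restricts to a surjection onto `polyFun k`, which can be split linearly.
    let P : Submodule ℝ (polyFun (k + 1)) :=
      (polyFun k).comap (pdMulLin (k + 1) 0 (fun _ => 1) contDiff_const)
    let D : P →ₗ[ℝ] polyFun k := LinearMap.restrict
      (pdMulLin (k + 1) 0 (fun _ => 1) contDiff_const) (p := P) (q := polyFun k)
      (fun x hx => hx)
    have hD (x : P) : (D x : Plane → ℝ) = pd 0 ((x : polyFun (k + 1)) : Plane → ℝ) := by
      simp [D, pdMulLin]
    obtain ⟨S, hS⟩ := D.exists_rightInverse_of_surjective (LinearMap.range_eq_top.2 fun q => by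
      obtain ⟨p, hp, hpq⟩ := exists_pd_eq q.2
      refine ⟨⟨⟨p, hp⟩, ?_⟩, Subtype.ext ?_⟩
      · simp [P, pdMulLin, hpq]
      · rw [hD]; exact hpq)
    refine ⟨P.subtype ∘ₗ S, fun q => ?_⟩
    have := congrArg Subtype.val (LinearMap.congr_fun hS q)
    rw [LinearMap.comp_apply, hD] at this
    exact this
  obtain ⟨C, hC, H⟩ := exists_integral_sq_le (μ := volume.restrict (Metric.ball 0 η))
    (ν := volume.restrict (Metric.closedBall 0 1)) (polyFun k).subtype
    ((polyFun (k + 1)).subtype ∘ₗ R)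
    (fun v => memLp_polyFun v.2 Metric.isBounded_ball)
    (fun v => memLp_polyFun (R v).2 Metric.isBounded_closedBall)
    (fun q hq => Subtype.ext
      (polyFun_ae_eq_zero q.2 Metric.isOpen_ball ⟨0, Metric.mem_ball_self hη⟩ hq))
  refine ⟨C, hC, ?_⟩
  intro K c h hh hK hball hKb q hq
  have hqh : (fun y => q (c + h • y)) ∈ polyFun k := comp_mem_polyFun (affine_mem_polyFun c h) hq
  have hbd : Bornology.IsBounded K := Metric.isBounded_closedBall.subset hKb
  set ph := R ⟨_, hqh⟩ with hph
  have hback (y : Plane) : -(h⁻¹ • c) + h⁻¹ • (c + h • y) = y := by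
    rw [smul_add, smul_smul, inv_mul_cancel₀ hh.ne', one_smul]; abel
  have hback' (x : Plane) : c + h • (-(h⁻¹ • c) + h⁻¹ • x) = x := by
    rw [smul_add, smul_neg, smul_smul, smul_smul, mul_inv_cancel₀ hh.ne', one_smul, one_smul]; abel
  have hmem0 : (fun x => (ph : Plane → ℝ) (-(h⁻¹ • c) + h⁻¹ • x)) ∈ polyFun (k + 1) :=
    comp_mem_polyFun (affine_mem_polyFun (-(h⁻¹ • c)) h⁻¹) ph.2
  have hmem : (h • fun x => (ph : Plane → ℝ) (-(h⁻¹ • c) + h⁻¹ • x)) ∈ polyFun (k + 1) :=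
    Submodule.smul_mem _ h hmem0
  refine ⟨_, hmem, ?_, ?_⟩
  · ext x
    rw [pd_smul 0 h (diffAt_of_contDiff (contDiff_of_mem_polyFun hmem0) x),
      pd_scale (contDiff_of_mem_polyFun ph.2), hR]
    change h * (h⁻¹ * q (c + h • (-(h⁻¹ • c) + h⁻¹ • x))) = q x
    rw [hback', ← mul_assoc, mul_inv_cancel₀ hh.ne', one_mul]
  calc ∫ x in K, (h • fun x => (ph : Plane → ℝ) (-(h⁻¹ • c) + h⁻¹ • x)) x ^ 2
      ≤ ∫ x in Metric.closedBall c h,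
        (h • fun x => (ph : Plane → ℝ) (-(h⁻¹ • c) + h⁻¹ • x)) x ^ 2 :=
        setIntegral_mono_set (memLp_polyFun hmem Metric.isBounded_closedBall).integrable_sq
          (ae_of_all _ fun x => sq_nonneg _) hKb.eventuallyLE
    _ = h ^ 4 * ∫ y in Metric.closedBall 0 1, (ph : Plane → ℝ) y ^ 2 := by
        rw [setIntegral_closedBall _ c hh, ← integral_const_mul, ← integral_const_mul]
        congr 1
        ext y
        simp only [Pi.smul_apply, hback, smul_eq_mul]
        ring
    _ ≤ h ^ 4 * (C * ∫ y in Metric.ball 0 η, q (c + h • y) ^ 2) :=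
        mul_le_mul_of_nonneg_left (H ⟨_, hqh⟩) (by positivity)
    _ = C * (h ^ 2 * ∫ x in Metric.ball c (η * h), q x ^ 2) := by
        rw [setIntegral_ball _ c η hh]; ring
    _ ≤ _ := by
        refine mul_le_mul_of_nonneg_left (mul_le_mul_of_nonneg_left ?_ (by positivity)) hC.le
        exact setIntegral_mono_set (memLp_polyFun hq hbd).integrable_sq
          (ae_of_all _ fun x => sq_nonneg _) hball.eventuallyLE

/-! ### Star-shaped polygons -/

/-- The cross product of plane vectors. -/
def cross (u v : Plane) : ℝ := u 0 * v 1 - u 1 * v 0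

theorem cross_add_left (u v w : Plane) : cross (u + v) w = cross u w + cross v w := by
  simp [cross]; ring

theorem cross_add_right (u v w : Plane) : cross u (v + w) = cross u v + cross u w := by
  simp [cross]; ring

theorem cross_smul_left (r : ℝ) (u v : Plane) : cross (r • u) v = r * cross u v := by
  simp [cross]; ring

theorem cross_smul_right (r : ℝ) (u v : Plane) : cross u (r • v) = r * cross u v := by
  simp [cross]; ring

theorem cross_self (u : Plane) : cross u u = 0 := by
  simp [cross]; ring

theorem cross_swap (u v : Plane) : cross u v = - cross v u := by
  simp [cross]; ring

/-- Cramer's rule; it identifies `la` and `lb` as coordinates in the basis given by an edge's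
endpoints seen from `c`. -/
theorem cross_comb {u v : Plane} (h : cross u v ≠ 0) (w : Plane) :
    (cross w v / cross u v) • u + (cross u w / cross u v) • v = w := by
  ext i
  simp only [PiLp.add_apply, PiLp.smul_apply, smul_eq_mul]
  rw [div_mul_eq_mul_div, div_mul_eq_mul_div, ← add_div, div_eq_iff h]
  fin_cases i <;> simp [cross] <;> ring

theorem volume_line (c u : Plane) : volume {x : Plane | ∃ r : ℝ, x = c + r • u} = 0 := by
  have h1 : (Submodule.span ℝ {u} : Submodule ℝ Plane) ≠ ⊤ := fun h => by
    have h2 := finrank_span_le_card (R := ℝ) ({u} : Set Plane)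
    rw [h, finrank_top, finrank_euclideanSpace] at h2
    simp at h2
  have h2 := Measure.addHaar_submodule (volume : Measure Plane) _ h1
  rw [← measure_preimage_add _ (-c)] at h2
  refine measure_mono_null ?_ h2
  rintro x ⟨r, rfl⟩
  simpa using Submodule.smul_mem _ r (Submodule.mem_span_singleton_self u)

theorem mem_segment_iff' {a b x : Plane} :
    x ∈ segment ℝ a b ↔ ∃ s : ℝ, 0 ≤ s ∧ s ≤ 1 ∧ x = a + s • (b - a) := by
  rw [segment_eq_image']
  constructor
  · rintro ⟨s, hs, rfl⟩; exact ⟨s, hs.1, hs.2, rfl⟩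
  · rintro ⟨s, h0, h1, rfl⟩; exact ⟨s, ⟨h0, h1⟩, rfl⟩

theorem mem_openSegment_iff' {a b x : Plane} :
    x ∈ openSegment ℝ a b ↔ ∃ s : ℝ, 0 < s ∧ s < 1 ∧ x = a + s • (b - a) := by
  rw [openSegment_eq_image']
  constructor
  · rintro ⟨s, hs, rfl⟩; exact ⟨s, hs.1, hs.2, rfl⟩
  · rintro ⟨s, h0, h1, rfl⟩; exact ⟨s, ⟨h0, h1⟩, rfl⟩

theorem volume_segment (a b : Plane) : volume (segment ℝ a b) = 0 := by
  refine measure_mono_null (fun x hx => ?_) (volume_line a (b - a))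
  obtain ⟨s, -, -, rfl⟩ := mem_segment_iff'.1 hx
  exact ⟨s, rfl⟩

namespace Polygon

theorem volume_frontier (K : Polygon) : volume (frontier K.carrier) = 0 := by
  rw [K.frontier_eq, measure_iUnion_null_iff]
  exact fun i => volume_segment _ _

theorem segment_subset (K : Polygon) (e : Fin (K.m + 3)) :
    segment ℝ (K.vert e) (K.vert (e + 1)) ⊆ frontier K.carrier := by
  rw [K.frontier_eq]
  exact Set.subset_iUnion (fun e => segment ℝ (K.vert e) (K.vert (e + 1))) e

theorem vert_mem (K : Polygon) (e : Fin (K.m + 3)) : K.vert e ∈ frontier K.carrier :=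
  K.segment_subset e (left_mem_segment _ _ _)

theorem notMem_of_frontier (K : Polygon) {x : Plane} (h : x ∈ frontier K.carrier) :
    x ∉ K.carrier := by
  rw [K.isOpen.frontier_eq] at h
  exact h.2

theorem nonempty (K : Polygon) : K.carrier.Nonempty := by
  by_contra h
  have := K.vert_mem 0
  rw [Set.not_nonempty_iff_eq_empty.1 h, frontier_empty] at this
  exact this

theorem succ_ne (K : Polygon) (e : Fin (K.m + 3)) : e ≠ e + 1 := by
  intro h
  have : (1 : Fin (K.m + 3)) = 0 := by simpa using h.symm
  simp at this

theorem edgeLength_pos (K : Polygon) (e : Fin (K.m + 3)) : 0 < K.edgeLength e :=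
  dist_pos.2 fun h => K.succ_ne e (K.vert_injective h)

/-- `K` is star-shaped with respect to the ball with centre `c` and radius `ρ`. -/
structure Star (K : Polygon) (c : Plane) (ρ : ℝ) : Prop where
  pos : 0 < ρ
  star : ∀ y ∈ Metric.ball c ρ, StarConvex ℝ y K.carrier

/-- Twice the signed area of the triangle spanned by `c` and an edge. -/
def crs (K : Polygon) (c : Plane) (e : Fin (K.m + 3)) : ℝ :=
  cross (K.vert e - c) (K.vert (e + 1) - c)

/-- Barycentric coordinate, in the triangle spanned by `c` and an edge, of the first vertex. -/
def la (K : Polygon) (c : Plane) (e : Fin (K.m + 3)) (x : Plane) : ℝ :=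
  cross (x - c) (K.vert (e + 1) - c) / K.crs c e

/-- Barycentric coordinate, in the triangle spanned by `c` and an edge, of the second vertex. -/
def lb (K : Polygon) (c : Plane) (e : Fin (K.m + 3)) (x : Plane) : ℝ :=
  cross (K.vert e - c) (x - c) / K.crs c e

/-- The open cone with apex `c` over an edge. -/
def cone (K : Polygon) (c : Plane) (e : Fin (K.m + 3)) : Set Plane :=
  {x | 0 < K.la c e x ∧ 0 < K.lb c e x}

/-- The open triangle spanned by `c` and an edge. -/
def tri (K : Polygon) (c : Plane) (e : Fin (K.m + 3)) : Set Plane :=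
  {x | 0 < K.la c e x ∧ 0 < K.lb c e x ∧ K.la c e x + K.lb c e x < 1}

theorem la_scale (K : Polygon) (c : Plane) (e : Fin (K.m + 3)) (s : ℝ) (x : Plane) :
    K.la c e (c + s • (x - c)) = s * K.la c e x := by
  rw [la, la, add_sub_cancel_left, cross_smul_left, mul_div_assoc]

theorem lb_scale (K : Polygon) (c : Plane) (e : Fin (K.m + 3)) (s : ℝ) (x : Plane) :
    K.lb c e (c + s • (x - c)) = s * K.lb c e x := by
  rw [lb, lb, add_sub_cancel_left, cross_smul_right, mul_div_assoc]

theorem cone_scale {K : Polygon} {c : Plane} {e : Fin (K.m + 3)} {s : ℝ} (hs : 0 < s) {x : Plane} :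
    c + s • (x - c) ∈ K.cone c e ↔ x ∈ K.cone c e := by
  simp only [cone, Set.mem_ofPred_eq, la_scale, lb_scale, mul_pos_iff_of_pos_left hs]

@[fun_prop]
theorem continuous_la (K : Polygon) (c : Plane) (e : Fin (K.m + 3)) : Continuous (K.la c e) := by
  unfold la cross
  simp only [PiLp.sub_apply]
  fun_prop

@[fun_prop]
theorem continuous_lb (K : Polygon) (c : Plane) (e : Fin (K.m + 3)) : Continuous (K.lb c e) := by
  unfold lb cross
  simp only [PiLp.sub_apply]
  fun_prop

theorem isOpen_tri (K : Polygon) (c : Plane) (e : Fin (K.m + 3)) : IsOpen (K.tri c e) := by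
  have h1 := isOpen_lt (continuous_const (y := (0 : ℝ))) (K.continuous_la c e)
  have h2 := isOpen_lt (continuous_const (y := (0 : ℝ))) (K.continuous_lb c e)
  have h3 := isOpen_lt ((K.continuous_la c e).add (K.continuous_lb c e)) (continuous_const (y := (1 : ℝ)))
  exact h1.inter (h2.inter h3)

namespace Star
variable {K : Polygon} {c : Plane} {ρ : ℝ}

theorem ball_subset (hS : K.Star c ρ) : Metric.ball c ρ ⊆ K.carrier :=
  fun y hy => (hS.star y hy).mem K.nonempty

theorem center_mem (hS : K.Star c ρ) : c ∈ K.carrier :=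
  hS.ball_subset (Metric.mem_ball_self hS.pos)

/-- A point `x` of the closure is replaced by a nearby `x'` in `K`, and the error is absorbed by
moving the centre `z` within the open ball, so the combination itself is unchanged. Here `t < 1`
gives the centre positive weight. -/
theorem mem_of_closure (hS : K.Star c ρ) {x z : Plane} (hx : x ∈ closure K.carrier)
    (hz : z ∈ Metric.ball c ρ) {t : ℝ} (h0 : 0 ≤ t) (h1 : t < 1) :
    z + t • (x - z) ∈ K.carrier := by
  have ht : 0 < 1 - t := by linarith
  obtain ⟨ε, hε, hball⟩ := Metric.isOpen_iff.1 Metric.isOpen_ball z hz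
  obtain ⟨x', hx', hd⟩ := Metric.mem_closure_iff.1 hx (ε * (1 - t)) (by positivity)
  have hz' : z + (t / (1 - t)) • (x - x') ∈ Metric.ball c ρ := by
    apply hball
    rw [Metric.mem_ball, dist_self_add_left, norm_smul, Real.norm_of_nonneg (by positivity),
      ← dist_eq_norm, div_mul_eq_mul_div, div_lt_iff₀ ht]
    have : 0 ≤ dist x x' := dist_nonneg
    nlinarith
  have := (hS.star _ hz') hx' ht.le h0 (by ring)
  convert this using 1
  rw [smul_add, smul_smul, mul_div_cancel₀ _ ht.ne']
  module

/-- If the line through an edge met the ball outside the edge, the nearer vertex would lie strictly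
between a centre and the other vertex, hence in the open set `K`, although vertices are boundary
points. On the edge itself the contradiction is immediate. -/
theorem line_disjoint (hS : K.Star c ρ) (e : Fin (K.m + 3)) (s : ℝ) :
    K.vert e + s • (K.vert (e + 1) - K.vert e) ∉ Metric.ball c ρ := by
  intro hz
  have hzK := hS.ball_subset hz
  rcases lt_or_ge s 0 with h0 | h0
  · have hs : 0 < 1 - s := by linarith
    refine K.notMem_of_frontier (K.vert_mem e) ?_
    have := hS.mem_of_closure (frontier_subset_closure (K.vert_mem (e + 1))) hz
      (t := -s / (1 - s)) (div_nonneg (by linarith) hs.le) (by rw [div_lt_one hs]; linarith)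
    convert this using 1
    rw [show K.vert (e + 1) - (K.vert e + s • (K.vert (e + 1) - K.vert e)) =
      (1 - s) • (K.vert (e + 1) - K.vert e) by module, smul_smul, div_mul_cancel₀ _ hs.ne']
    module
  rcases le_or_gt s 1 with h1 | h1
  · exact K.notMem_of_frontier (K.segment_subset e (mem_segment_iff'.2 ⟨s, h0, h1, rfl⟩)) hzK
  · have hs : 0 < s := by linarith
    refine K.notMem_of_frontier (K.vert_mem (e + 1)) ?_
    have := hS.mem_of_closure (frontier_subset_closure (K.vert_mem e)) hz
      (t := (s - 1) / s) (div_nonneg (by linarith) hs.le) (by rw [div_lt_one hs]; linarith)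
    convert this using 1
    rw [show K.vert e - (K.vert e + s • (K.vert (e + 1) - K.vert e)) =
      s • (K.vert e - K.vert (e + 1)) by module, smul_smul, div_mul_cancel₀ _ hs.ne']
    module

/-- The quotient of `|crs|` by the edge length is the distance from `c` to the line carrying the
edge, and that line avoids the ball. -/
theorem le_abs_crs (hS : K.Star c ρ) (e : Fin (K.m + 3)) :
    ρ * K.edgeLength e ≤ |K.crs c e| := by
  by_contra! hlt
  have hL := K.edgeLength_pos e
  have hL2 : K.edgeLength e ^ 2 =
      (K.vert (e + 1) 0 - K.vert e 0) ^ 2 + (K.vert (e + 1) 1 - K.vert e 1) ^ 2 := by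
    rw [edgeLength, EuclideanSpace.dist_eq, Real.sq_sqrt (Finset.sum_nonneg fun _ _ => sq_nonneg _),
      Fin.sum_univ_two, Real.dist_eq, Real.dist_eq, sq_abs, sq_abs]
    ring
  have hcr : K.crs c e ^ 2 < (ρ * K.edgeLength e) ^ 2 :=
    sq_lt_sq.2 (hlt.trans_eq (abs_of_pos (mul_pos hS.pos hL)).symm)
  set L := K.edgeLength e with hLdef
  -- Parameter of the foot of the perpendicular from `c` to the line.
  let s : ℝ := -((K.vert e 0 - c 0) * (K.vert (e + 1) 0 - K.vert e 0) +
    (K.vert e 1 - c 1) * (K.vert (e + 1) 1 - K.vert e 1)) / L ^ 2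
  refine hS.line_disjoint e s ?_
  rw [Metric.mem_ball, EuclideanSpace.dist_eq, Real.sqrt_lt' hS.pos, Fin.sum_univ_two,
    Real.dist_eq, Real.dist_eq, sq_abs, sq_abs]
  simp only [PiLp.add_apply, PiLp.smul_apply, PiLp.sub_apply, smul_eq_mul]
  have hs : s * L ^ 2 = -((K.vert e 0 - c 0) * (K.vert (e + 1) 0 - K.vert e 0) +
    (K.vert e 1 - c 1) * (K.vert (e + 1) 1 - K.vert e 1)) := div_mul_cancel₀ _ (by positivity)
  have hcrs : K.crs c e = (K.vert e 0 - c 0) * (K.vert (e + 1) 1 - K.vert e 1) -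
      (K.vert e 1 - c 1) * (K.vert (e + 1) 0 - K.vert e 0) := by
    simp only [crs, cross, PiLp.sub_apply]; ring
  rw [hcrs] at hcr
  generalize K.vert (e + 1) 0 = b0 at *
  generalize K.vert (e + 1) 1 = b1 at *
  generalize K.vert e 0 = a0 at *
  generalize K.vert e 1 = a1 at *
  generalize c 0 = c0 at *
  generalize c 1 = c1 at *
  have key : ((a0 + s * (b0 - a0) - c0) ^ 2 + (a1 + s * (b1 - a1) - c1) ^ 2) * L ^ 2 =
      ((a0 - c0) * (b1 - a1) - (a1 - c1) * (b0 - a0)) ^ 2 := by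
    have : ((a0 + s * (b0 - a0) - c0) ^ 2 + (a1 + s * (b1 - a1) - c1) ^ 2) * L ^ 2 =
        ((a0 - c0) ^ 2 + (a1 - c1) ^ 2) * L ^ 2 +
        2 * (s * L ^ 2) * ((a0 - c0) * (b0 - a0) + (a1 - c1) * (b1 - a1)) +
        (s * L ^ 2) * s * ((b0 - a0) ^ 2 + (b1 - a1) ^ 2) := by ring
    rw [this, ← hL2, mul_assoc (s * L ^ 2), hs, hL2]
    ring
  have hL2p : 0 < L ^ 2 := by positivity
  rw [← key, mul_pow] at hcr
  exact lt_of_mul_lt_mul_right hcr hL2p.le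

theorem crs_ne (hS : K.Star c ρ) (e : Fin (K.m + 3)) : K.crs c e ≠ 0 := fun h => by
  have := hS.le_abs_crs e
  rw [h, abs_zero] at this
  exact absurd this (not_le.2 (mul_pos hS.pos (K.edgeLength_pos e)))

theorem comb (hS : K.Star c ρ) (e : Fin (K.m + 3)) (x : Plane) :
    x = c + (K.la c e x • (K.vert e - c) + K.lb c e x • (K.vert (e + 1) - c)) := by
  rw [la, lb, crs, cross_comb (hS.crs_ne e)]
  abel

theorem la_comb (hS : K.Star c ρ) (e : Fin (K.m + 3)) (α β : ℝ) :
    K.la c e (c + (α • (K.vert e - c) + β • (K.vert (e + 1) - c))) = α := by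
  rw [la, add_sub_cancel_left, cross_add_left, cross_smul_left, cross_smul_left, cross_self,
    mul_zero, add_zero, ← crs, mul_div_cancel_right₀ _ (hS.crs_ne e)]

theorem lb_comb (hS : K.Star c ρ) (e : Fin (K.m + 3)) (α β : ℝ) :
    K.lb c e (c + (α • (K.vert e - c) + β • (K.vert (e + 1) - c))) = β := by
  rw [lb, add_sub_cancel_left, cross_add_right, cross_smul_right, cross_smul_right, cross_self,
    mul_zero, zero_add, ← crs, mul_div_cancel_right₀ _ (hS.crs_ne e)]

theorem edge_eq (e : Fin (K.m + 3)) (s : ℝ) : K.vert e + s • (K.vert (e + 1) - K.vert e) =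
    c + ((1 - s) • (K.vert e - c) + s • (K.vert (e + 1) - c)) := by
  module

theorem mem_openSegment (hS : K.Star c ρ) {e : Fin (K.m + 3)} {x : Plane} (h : x ∈ K.cone c e)
    (h1 : K.la c e x + K.lb c e x = 1) : x ∈ openSegment ℝ (K.vert e) (K.vert (e + 1)) := by
  refine mem_openSegment_iff'.2 ⟨K.lb c e x, h.2, by linarith [h.1], ?_⟩
  rw [edge_eq (c := c), show 1 - K.lb c e x = K.la c e x by linarith]
  exact hS.comb e x

theorem openSegment_cone (hS : K.Star c ρ) {e : Fin (K.m + 3)} {x : Plane}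
    (h : x ∈ openSegment ℝ (K.vert e) (K.vert (e + 1))) : x ∈ K.cone c e := by
  obtain ⟨s, h0, h1, rfl⟩ := mem_openSegment_iff'.1 h
  rw [edge_eq (c := c)]
  exact ⟨by rw [hS.la_comb]; linarith, by rw [hS.lb_comb]; linarith⟩

/-- Radial projection of the cone over an edge to the edge. -/
theorem radial (hS : K.Star c ρ) {e : Fin (K.m + 3)} {x : Plane} (h : x ∈ K.cone c e) :
    c + (K.la c e x + K.lb c e x)⁻¹ • (x - c) ∈ openSegment ℝ (K.vert e) (K.vert (e + 1)) := by
  have hs : 0 < K.la c e x + K.lb c e x := add_pos h.1 h.2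
  refine hS.mem_openSegment ((cone_scale (inv_pos.2 hs)).2 h) ?_
  rw [la_scale, lb_scale, ← mul_add, inv_mul_cancel₀ hs.ne']

theorem openSegment_frontier (e : Fin (K.m + 3)) :
    openSegment ℝ (K.vert e) (K.vert (e + 1)) ⊆ frontier K.carrier :=
  (openSegment_subset_segment _ _ _).trans (K.segment_subset e)

/-- A ray from `c` inside the cone crosses the edge where `la + lb = 1`, at a boundary point. A
point of `K` at or beyond it would force that boundary point into `K`; points strictly before it are
in `K` by `mem_of_closure`. -/
theorem carrier_inter_cone (hS : K.Star c ρ) (e : Fin (K.m + 3)) :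
    K.carrier ∩ K.cone c e = K.tri c e := by
  ext x
  constructor
  · rintro ⟨hx, hc⟩
    refine ⟨hc.1, hc.2, ?_⟩
    by_contra! hge
    have hr := openSegment_frontier e (hS.radial hc)
    refine K.notMem_of_frontier hr ?_
    have hs : 0 < K.la c e x + K.lb c e x := add_pos hc.1 hc.2
    have hi : (K.la c e x + K.lb c e x)⁻¹ ≤ 1 := inv_le_one_of_one_le₀ hge
    have := (hS.star c (Metric.mem_ball_self hS.pos)) hx (sub_nonneg.2 hi) (inv_pos.2 hs).le
      (by ring)
    convert this using 1
    module
  · rintro ⟨h1, h2, h3⟩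
    have hc : x ∈ K.cone c e := ⟨h1, h2⟩
    refine ⟨?_, hc⟩
    have hs : 0 < K.la c e x + K.lb c e x := add_pos h1 h2
    have := hS.mem_of_closure (frontier_subset_closure (openSegment_frontier e (hS.radial hc)))
      (Metric.mem_ball_self hS.pos) hs.le h3
    rw [add_sub_cancel_left, smul_smul, mul_inv_cancel₀ hs.ne', one_smul, add_sub_cancel] at this
    exact this

theorem tri_subset (hS : K.Star c ρ) (e : Fin (K.m + 3)) : K.tri c e ⊆ K.carrier := by
  rw [← hS.carrier_inter_cone e]; exact Set.inter_subset_left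

/-- Trichotomy on `la + lb`: below one the point is interior, and above one it would make the radial
projection interior. -/
theorem frontier_inter_cone (hS : K.Star c ρ) {e : Fin (K.m + 3)} {x : Plane}
    (hx : x ∈ frontier K.carrier) (hc : x ∈ K.cone c e) :
    x ∈ openSegment ℝ (K.vert e) (K.vert (e + 1)) := by
  have hr := openSegment_frontier e (hS.radial hc)
  have hs : 0 < K.la c e x + K.lb c e x := add_pos hc.1 hc.2
  rcases lt_trichotomy (K.la c e x + K.lb c e x) 1 with h | h | h
  · have : x ∈ K.tri c e := ⟨hc.1, hc.2, h⟩
    exact absurd (hS.tri_subset e this) (K.notMem_of_frontier hx)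
  · exact hS.mem_openSegment hc h
  · refine absurd ?_ (K.notMem_of_frontier hr)
    exact hS.mem_of_closure (frontier_subset_closure hx) (Metric.mem_ball_self hS.pos)
      (inv_pos.2 hs).le (inv_lt_one_of_one_lt₀ h)

/-- The radial projection of a common point lies on the first open edge and still in the second
cone, hence on both open edges, which are disjoint. -/
theorem cone_disjoint (hS : K.Star c ρ) {e e' : Fin (K.m + 3)} (h : e ≠ e') :
    Disjoint (K.cone c e) (K.cone c e') := by
  rw [Set.disjoint_left]
  intro x hx hx'
  have hs : 0 < K.la c e x + K.lb c e x := add_pos hx.1 hx.2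
  have hr := hS.radial hx
  exact Set.disjoint_left.1 (K.edges_disjoint e e' h) hr
    (hS.frontier_inter_cone (openSegment_frontier e hr) ((cone_scale (inv_pos.2 hs)).2 hx'))

theorem edgePoint_notMem_cone (hS : K.Star c ρ) {e e' : Fin (K.m + 3)} (h : e ≠ e') {x : Plane}
    (hx : x ∈ segment ℝ (K.vert e') (K.vert (e' + 1))) : x ∉ K.cone c e := by
  intro hc
  have h1 := hS.frontier_inter_cone (K.segment_subset e' hx) hc
  rw [← insert_endpoints_openSegment] at hx
  rcases hx with rfl | rfl | hx
  · exact K.vert_notMem e _ h1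
  · exact K.vert_notMem e _ h1
  · exact Set.disjoint_left.1 (K.edges_disjoint e e' h) h1 hx

/-- The ray from `c` through `x` starts in the bounded set `K`, so it meets the boundary, either
inside an edge or at a vertex. -/
theorem exists_cone_or_vert (hS : K.Star c ρ) {x : Plane} (hx : x ≠ c) :
    (∃ e, x ∈ K.cone c e) ∨ ∃ e, ∃ r : ℝ, x = c + r • (K.vert e - c) := by
  obtain ⟨t, ht, hf⟩ : ∃ t : ℝ, 0 < t ∧ c + t • (x - c) ∈ frontier K.carrier := by
    let R : Set Plane := (fun t : ℝ => c + t • (x - c)) '' Set.Ici 0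
    have hR : IsPreconnected R := isPreconnected_Ici.image _ (by fun_prop)
    have h1 : (R ∩ K.carrier).Nonempty := ⟨c, ⟨0, by simp, by simp⟩, hS.center_mem⟩
    have h2 : (R \ K.carrier).Nonempty := by
      obtain ⟨M, hM⟩ := Metric.isBounded_iff_subset_closedBall c |>.1 K.bounded
      have hn : 0 < ‖x - c‖ := norm_pos_iff.2 (sub_ne_zero.2 hx)
      have hM0 : 0 ≤ M := by
        have := hM hS.center_mem
        simpa using this
      refine ⟨_, ⟨(M + 1) / ‖x - c‖, ?_, rfl⟩, fun h => ?_⟩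
      · exact Set.mem_Ici.2 (by positivity)
      · have := hM h
        rw [Metric.mem_closedBall, dist_self_add_left, norm_smul,
          Real.norm_of_nonneg (by positivity), div_mul_cancel₀ _ hn.ne'] at this
        linarith
    obtain ⟨y, ⟨t, ht, rfl⟩, hy⟩ : (R ∩ frontier K.carrier).Nonempty := by
      by_contra hno
      rw [Set.not_nonempty_iff_eq_empty, K.isOpen.frontier_eq] at hno
      have hout (y : Plane) (hy : y ∈ R) (hyK : y ∉ K.carrier) : y ∉ closure K.carrier :=
        fun h => (hno.subset ⟨hy, h, hyK⟩ : y ∈ (∅ : Set Plane))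
      obtain ⟨y, hy, hyK⟩ := h2
      -- If the ray avoided the boundary, `K` and the complement of its closure would separate a
      -- connected set.
      obtain ⟨z, -, hz1, hz2⟩ := hR K.carrier (closure K.carrier)ᶜ K.isOpen isClosed_closure.isOpen_compl
        (fun y hy => (em (y ∈ K.carrier)).imp id (hout y hy)) h1 ⟨y, hy, hout y hy hyK⟩
      exact hz2 (subset_closure hz1)
    refine ⟨t, lt_of_le_of_ne ht ?_, hy⟩
    rintro rfl
    simp only [zero_smul, add_zero] at hy
    exact K.notMem_of_frontier hy hS.center_mem
  have hvert (e) (h : c + t • (x - c) = K.vert e) : ∃ e, ∃ r : ℝ, x = c + r • (K.vert e - c) :=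
    ⟨e, t⁻¹, by rw [← h, add_sub_cancel_left, smul_smul, inv_mul_cancel₀ ht.ne', one_smul]; abel⟩
  have hf' := hf
  rw [K.frontier_eq, Set.mem_iUnion] at hf'
  obtain ⟨e, he⟩ := hf'
  rw [← insert_endpoints_openSegment] at he
  rcases he with h | h | h
  · exact Or.inr (hvert _ h)
  · exact Or.inr (hvert _ h)
  · exact Or.inl ⟨e, (cone_scale ht).1 (hS.openSegment_cone h)⟩

theorem ae_mem_cone (hS : K.Star c ρ) : ∀ᵐ x : Plane, ∃ e, x ∈ K.cone c e := by
  have h1 : ∀ᵐ x : Plane, ∀ e : Fin (K.m + 3), ¬ ∃ r : ℝ, x = c + r • (K.vert e - c) :=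
    ae_all_iff.2 fun e => by
      rw [ae_iff]; simpa using volume_line c (K.vert e - c)
  filter_upwards [h1] with x hx
  rcases hS.exists_cone_or_vert (x := x) (fun h => hx 0 ⟨0, by simp [h]⟩) with h | ⟨e, h⟩
  · exact h
  · exact absurd h (hx e)

theorem tri_disjoint (hS : K.Star c ρ) : Pairwise (Function.onFun Disjoint (K.tri c)) := by
  intro e e' h
  refine (hS.cone_disjoint h).mono ?_ ?_ <;> rintro x ⟨h1, h2, -⟩ <;> exact ⟨h1, h2⟩

theorem carrier_ae_eq (hS : K.Star c ρ) : K.carrier =ᵐ[volume] ⋃ e, K.tri c e := by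
  filter_upwards [hS.ae_mem_cone] with x hx
  obtain ⟨e, he⟩ := hx
  refine propext ⟨fun h => ?_, fun h => ?_⟩
  · exact Set.mem_iUnion.2 ⟨e, by rw [← hS.carrier_inter_cone]; exact ⟨h, he⟩⟩
  · obtain ⟨e, h⟩ := Set.mem_iUnion.1 h
    exact hS.tri_subset e h

theorem integral_eq_sum (hS : K.Star c ρ) {f : Plane → ℝ} (hf : IntegrableOn f K.carrier) :
    ∫ x in K.carrier, f x = ∑ e, ∫ x in K.tri c e, f x := by
  rw [setIntegral_congr_set hS.carrier_ae_eq]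
  exact integral_iUnion_fintype (fun e => (K.isOpen_tri c e).measurableSet) hS.tri_disjoint
    fun e => hf.mono_set (hS.tri_subset e)

/-- If the orientation flipped at a vertex, the two adjacent cones would overlap just beside the ray
through that vertex, contradicting their disjointness. A constant orientation is what makes the
spoke terms cancel in `green`. -/
theorem sign_crs (hS : K.Star c ρ) (e : Fin (K.m + 3)) :
    SignType.sign (K.crs c (e + 1)) = SignType.sign (K.crs c e) := by
  by_contra hne
  set p := K.vert e - c with hp
  set q := K.vert (e + 1) - c with hq
  set r := K.vert (e + 1 + 1) - c with hr
  have h1 : K.crs c e = cross p q := rfl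
  have h2 : K.crs c (e + 1) = cross q r := rfl
  have n1 := hS.crs_ne e
  have n2 := hS.crs_ne (e + 1)
  have hopp : cross r q / cross p q > 0 := by
    rw [cross_swap r q, ← h1, ← h2]
    rcases n1.lt_or_gt with a | a <;> rcases n2.lt_or_gt with b | b
    · exact absurd (by rw [sign_neg a, sign_neg b]) hne
    · exact div_pos_of_neg_of_neg (by linarith) a
    · exact div_pos (by linarith) a
    · exact absurd (by rw [sign_pos a, sign_pos b]) hne
  -- Small enough that `q + ε r`, expanded in the basis `p`, `q`, keeps a coefficient of at least `1
  -- / 2` along `q`.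
  set ε : ℝ := |cross p q| / (2 * (|cross p r| + 1)) with hε
  have hpq : 0 < |cross p q| := abs_pos.2 n1
  have hε0 : 0 < ε := by positivity
  have hsmall : |ε * (cross p r / cross p q)| ≤ 1 / 2 := by
    rw [abs_mul, abs_of_pos hε0, abs_div, hε, div_mul_div_comm, div_le_div_iff₀ (by positivity) two_pos]
    nlinarith [abs_nonneg (cross p r)]
  have hx1 : c + (q + ε • r) ∈ K.cone c e := by
    constructor
    · rw [la, add_sub_cancel_left, ← hq, cross_add_left, cross_self, cross_smul_left, zero_add, h1,
        mul_div_assoc]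
      exact mul_pos hε0 hopp
    · rw [lb, add_sub_cancel_left, ← hp, cross_add_right, cross_smul_right, h1, add_div,
        div_self (h1 ▸ n1), mul_div_assoc]
      have := neg_le_of_abs_le hsmall
      linarith
  have hx2 : c + (q + ε • r) ∈ K.cone c (e + 1) := by
    constructor
    · rw [la, add_sub_cancel_left, ← hr, cross_add_left, cross_smul_left, cross_self, mul_zero,
        add_zero, h2, div_self (h2 ▸ n2)]
      exact one_pos
    · rw [lb, add_sub_cancel_left, ← hq, cross_add_right, cross_self, cross_smul_right, zero_add,
        h2, mul_div_assoc, div_self (h2 ▸ n2), mul_one]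
      exact hε0
  exact Set.disjoint_left.1 (hS.cone_disjoint (K.succ_ne e)) hx1 hx2

end Star
end Polygon

/-! ### Integrals over triangles and Green's formula -/

/-- The open reference triangle. -/
def refTri : Set Plane := {y | 0 < y 0 ∧ 0 < y 1 ∧ y 0 + y 1 < 1}

/-- The linear map sending the coordinate vectors to `A` and `B`. -/
def combMap (A B : Plane) : Plane →L[ℝ] Plane :=
  (EuclideanSpace.proj 0 : Plane →L[ℝ] ℝ).smulRight A +
    (EuclideanSpace.proj 1 : Plane →L[ℝ] ℝ).smulRight B

theorem combMap_apply (A B y : Plane) : combMap A B y = y 0 • A + y 1 • B := by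
  simp [combMap]

theorem det_combMap (A B : Plane) : (combMap A B).det = cross A B := by
  rw [ContinuousLinearMap.det,
    ← LinearMap.det_toMatrix (EuclideanSpace.basisFun (Fin 2) ℝ).toBasis, Matrix.det_fin_two]
  simp [LinearMap.toMatrix_apply, combMap_apply, cross]
  ring

/-- The pair of real numbers as a point of the plane. -/
def mkPt (z : ℝ × ℝ) : Plane := !₂[z.1, z.2]

theorem mkPt_zero (z : ℝ × ℝ) : mkPt z 0 = z.1 := rfl
theorem mkPt_one (z : ℝ × ℝ) : mkPt z 1 = z.2 := rfl

@[fun_prop]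
theorem continuous_mkPt : Continuous mkPt := by
  unfold mkPt
  refine (PiLp.continuous_toLp 2 _).comp (continuous_pi fun i => ?_)
  fin_cases i
  · exact continuous_fst
  · exact continuous_snd

theorem integral_plane (f : Plane → ℝ) : ∫ x, f x = ∫ z : ℝ × ℝ, f (mkPt z) := by
  have h1 := (EuclideanSpace.volume_preserving_symm_measurableEquiv_toLp (Fin 2)).symm
  have h2 := (volume_preserving_finTwoArrow ℝ).symm
  rw [← h1.integral_comp', ← h2.integral_comp']
  rfl

theorem setIntegral_refTri (f : Plane → ℝ) :
    ∫ y in refTri, f y =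
      ∫ z : ℝ × ℝ, {z : ℝ × ℝ | 0 < z.1 ∧ 0 < z.2 ∧ z.1 + z.2 < 1}.indicator (fun z => f (mkPt z)) z := by
  have hm : MeasurableSet refTri := by
    have h (i : Fin 2) : Measurable fun y : Plane => y i := by fun_prop
    exact (measurableSet_lt measurable_const (h 0)).inter
      ((measurableSet_lt measurable_const (h 1)).inter (measurableSet_lt ((h 0).add (h 1)) measurable_const))
  rw [← integral_indicator hm, integral_plane]
  rfl

theorem integrable_indicator_tri {f : ℝ × ℝ → ℝ} (hf : Continuous f) :
    Integrable ({z : ℝ × ℝ | 0 < z.1 ∧ 0 < z.2 ∧ z.1 + z.2 < 1}.indicator f) := by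
  have hm : MeasurableSet {z : ℝ × ℝ | 0 < z.1 ∧ 0 < z.2 ∧ z.1 + z.2 < 1} :=
    (measurableSet_lt measurable_const measurable_fst).inter
      ((measurableSet_lt measurable_const measurable_snd).inter
        (measurableSet_lt (measurable_fst.add measurable_snd) measurable_const))
  rw [integrable_indicator_iff hm]
  refine (hf.continuousOn.integrableOn_compact (isCompact_Icc (a := ((0 : ℝ), (0 : ℝ)))
    (b := ((1 : ℝ), (1 : ℝ))))).mono_set ?_
  rintro ⟨a, b⟩ ⟨h1, h2, h3⟩
  simp only at h1 h2 h3
  exact ⟨⟨h1.le, h2.le⟩, ⟨by simp only; linarith, by simp only; linarith⟩⟩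

theorem inner_integral_tri (g : ℝ → ℝ → ℝ) (a : ℝ) :
    ∫ b, (if 0 < a ∧ 0 < b ∧ a + b < 1 then g a b else 0) =
      (Set.Ioc 0 1).indicator (fun a => ∫ b in (0 : ℝ)..(1 - a), g a b) a := by
  by_cases ha : a ∈ Set.Ioc (0 : ℝ) 1
  · rw [Set.indicator_of_mem ha, intervalIntegral.integral_of_le (by linarith [ha.2]),
      integral_Ioc_eq_integral_Ioo, ← integral_indicator measurableSet_Ioo]
    congr 1
    ext b
    simp only [Set.indicator_apply, Set.mem_Ioo]
    congr 1
    exact propext ⟨fun h => ⟨h.2.1, by linarith⟩, fun h => ⟨ha.1, h.1, by linarith⟩⟩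
  · rw [Set.indicator_of_notMem ha]
    have : (fun b => if 0 < a ∧ 0 < b ∧ a + b < 1 then g a b else 0) = fun _ => 0 := by
      ext b
      rw [if_neg]
      rintro ⟨h1, h2, h3⟩
      exact ha ⟨h1, by linarith⟩
    rw [this, integral_zero]

theorem integral_refTri {f : Plane → ℝ} (hf : Continuous f) :
    ∫ y in refTri, f y = ∫ a in (0 : ℝ)..1, ∫ b in (0 : ℝ)..(1 - a), f (mkPt (a, b)) := by
  rw [setIntegral_refTri, Measure.volume_eq_prod,
    integral_prod _ (integrable_indicator_tri (f := fun z => f (mkPt z)) (hf.comp continuous_mkPt)),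
    intervalIntegral.integral_of_le zero_le_one, ← integral_indicator measurableSet_Ioc]
  congr 1
  ext a
  rw [← inner_integral_tri fun a b => f (mkPt (a, b))]
  congr 1
  ext b
  simp only [Set.indicator_apply, Set.mem_ofPred_eq]

/-- Both orders of integration are needed, so that a derivative along either edge vector can be
integrated innermost. -/
theorem integral_refTri' {f : Plane → ℝ} (hf : Continuous f) :
    ∫ y in refTri, f y = ∫ b in (0 : ℝ)..1, ∫ a in (0 : ℝ)..(1 - b), f (mkPt (a, b)) := by
  rw [setIntegral_refTri, Measure.volume_eq_prod,
    integral_prod_symm _ (integrable_indicator_tri (f := fun z => f (mkPt z)) (hf.comp continuous_mkPt)),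
    intervalIntegral.integral_of_le zero_le_one, ← integral_indicator measurableSet_Ioc]
  congr 1
  ext b
  rw [← inner_integral_tri fun b a => f (mkPt (a, b))]
  congr 1
  ext a
  simp only [Set.indicator_apply, Set.mem_ofPred_eq]
  congr 1
  exact propext ⟨fun h => ⟨h.2.1, h.1, by linarith⟩, fun h => ⟨h.2.1, h.1, by linarith⟩⟩

namespace Polygon

/-- The affine map from the reference triangle to the triangle spanned by `c` and an edge. -/
def chart (K : Polygon) (c : Plane) (e : Fin (K.m + 3)) (y : Plane) : Plane :=
  c + (y 0 • (K.vert e - c) + y 1 • (K.vert (e + 1) - c))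

namespace Star
variable {K : Polygon} {c : Plane} {ρ : ℝ}

theorem hasFDerivAt_chart (e : Fin (K.m + 3)) (y : Plane) :
    HasFDerivAt (K.chart c e) (combMap (K.vert e - c) (K.vert (e + 1) - c)) y := by
  have : K.chart c e = fun y => c + combMap (K.vert e - c) (K.vert (e + 1) - c) y := by
    ext1 y; rw [chart, combMap_apply]
  rw [this]
  exact (ContinuousLinearMap.hasFDerivAt _).const_add c

theorem la_chart (hS : K.Star c ρ) (e : Fin (K.m + 3)) (y : Plane) :
    K.la c e (K.chart c e y) = y 0 := hS.la_comb e _ _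

theorem lb_chart (hS : K.Star c ρ) (e : Fin (K.m + 3)) (y : Plane) :
    K.lb c e (K.chart c e y) = y 1 := hS.lb_comb e _ _

theorem image_chart (hS : K.Star c ρ) (e : Fin (K.m + 3)) :
    K.chart c e '' refTri = K.tri c e := by
  ext x
  constructor
  · rintro ⟨y, hy, rfl⟩
    simpa only [tri, refTri, Set.mem_ofPred_eq, hS.la_chart, hS.lb_chart] using hy
  · intro hx
    exact ⟨mkPt (K.la c e x, K.lb c e x), hx, (hS.comb e x).symm⟩

theorem integral_tri (hS : K.Star c ρ) (e : Fin (K.m + 3)) (f : Plane → ℝ) :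
    ∫ x in K.tri c e, f x = |K.crs c e| * ∫ y in refTri, f (K.chart c e y) := by
  have hm : MeasurableSet refTri := by
    have h (i : Fin 2) : Measurable fun y : Plane => y i := by fun_prop
    exact (measurableSet_lt measurable_const (h 0)).inter
      ((measurableSet_lt measurable_const (h 1)).inter (measurableSet_lt ((h 0).add (h 1)) measurable_const))
  rw [← hS.image_chart e, integral_image_eq_integral_abs_det_fderiv_smul volume hm
    (fun y _ => (hasFDerivAt_chart e y).hasFDerivWithinAt)
    (fun y _ z _ h => ?_)]
  · simp only [det_combMap, smul_eq_mul]
    rw [integral_const_mul]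
    rfl
  · have h0 := congrArg (K.la c e) h
    have h1 := congrArg (K.lb c e) h
    rw [hS.la_chart, hS.la_chart] at h0
    rw [hS.lb_chart, hS.lb_chart] at h1
    ext i
    fin_cases i
    · exact h0
    · exact h1

end Star
end Polygon

theorem pd_linear {u v : Plane → ℝ} (hu : ContDiff ℝ ∞ u) (hv : ContDiff ℝ ∞ v) (a b : ℝ)
    (j : Fin 2) (x : Plane) : pd j (a • u + b • v) x = a * pd j u x + b * pd j v x := by
  have hu' := diffAt_of_contDiff hu x
  have hv' := diffAt_of_contDiff hv x
  rw [pd_add j (hu'.const_smul a) (hv'.const_smul b), pd_smul _ _ hu', pd_smul _ _ hv']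

theorem fderiv_eq_pd {f : Plane → ℝ} (x v : Plane) :
    fderiv ℝ f x v = v 0 * pd 0 f x + v 1 * pd 1 f x := by
  have : v = v 0 • EuclideanSpace.single 0 1 + v 1 • EuclideanSpace.single 1 (1 : ℝ) := by
    ext i; fin_cases i <;> simp
  conv_lhs => rw [this]
  simp [pd]

theorem hasDerivAt_comp_line {f : Plane → ℝ} (hf : ContDiff ℝ ∞ f) (p v : Plane) (s : ℝ) :
    HasDerivAt (fun s : ℝ => f (p + s • v))
      (v 0 * pd 0 f (p + s • v) + v 1 * pd 1 f (p + s • v)) s := by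
  have h1 : HasDerivAt (fun s : ℝ => p + s • v) ((1 : ℝ) • v) s :=
    ((hasDerivAt_id s).smul_const v).const_add p
  have := (diffAt_of_contDiff hf (p + s • v)).hasFDerivAt.comp_hasDerivAt s h1
  rw [one_smul, fderiv_eq_pd] at this
  exact this

theorem continuous_pd_of_contDiff {f : Plane → ℝ} (hf : ContDiff ℝ ∞ f) (j : Fin 2) :
    Continuous (pd j f) := (contDiff_pd hf j).continuous

theorem integral_line {f : Plane → ℝ} (hf : ContDiff ℝ ∞ f) (p v : Plane) (a b : ℝ) :
    ∫ s in a..b, (v 0 * pd 0 f (p + s • v) + v 1 * pd 1 f (p + s • v)) =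
      f (p + b • v) - f (p + a • v) := by
  refine intervalIntegral.integral_eq_sub_of_hasDerivAt
    (fun s _ => hasDerivAt_comp_line hf p v s) (Continuous.intervalIntegrable ?_ _ _)
  have := continuous_pd_of_contDiff hf
  fun_prop

namespace Polygon
namespace Star
variable {K : Polygon} {c : Plane} {ρ : ℝ}

/-- Integral, over the reference triangle, of the derivative of `f` in the direction of the first
edge vector. -/
theorem integral_ref_first (e : Fin (K.m + 3)) {f : Plane → ℝ} (hf : ContDiff ℝ ∞ f) (A B : Plane)
    (hA : A = K.vert e - c) (hB : B = K.vert (e + 1) - c) :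
    ∫ y in refTri, (A 0 * pd 0 f (K.chart c e y) + A 1 * pd 1 f (K.chart c e y)) =
      (∫ s in (0 : ℝ)..1, f (K.vert e + s • (K.vert (e + 1) - K.vert e))) -
        ∫ s in (0 : ℝ)..1, f (c + s • B) := by
  subst hA hB
  have hpd := continuous_pd_of_contDiff hf
  have hch : Continuous (K.chart c e) := by unfold chart; fun_prop
  have hfc := hf.continuous
  rw [integral_refTri' (by fun_prop), ← intervalIntegral.integral_sub
    (Continuous.intervalIntegrable (by fun_prop) _ _)
    (Continuous.intervalIntegrable (by fun_prop) _ _)]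
  refine intervalIntegral.integral_congr fun b _ => ?_
  have h1 := integral_line hf (c + b • (K.vert (e + 1) - c)) (K.vert e - c) 0 (1 - b)
  have h2 (a : ℝ) : K.chart c e (mkPt (a, b)) =
      c + b • (K.vert (e + 1) - c) + a • (K.vert e - c) := by
    rw [chart, mkPt_zero, mkPt_one]; module
  simp only [h2]
  rw [h1, zero_smul, add_zero]
  congr 2
  module

/-- The counterpart of `integral_ref_first` for the other edge vector. Here the inner integral ends
at edge parameter `1 - a`, which is why the edge integral is first reversed. -/
theorem integral_ref_second (e : Fin (K.m + 3)) {f : Plane → ℝ} (hf : ContDiff ℝ ∞ f)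
    (A B : Plane) (hA : A = K.vert e - c) (hB : B = K.vert (e + 1) - c) :
    ∫ y in refTri, (B 0 * pd 0 f (K.chart c e y) + B 1 * pd 1 f (K.chart c e y)) =
      (∫ s in (0 : ℝ)..1, f (K.vert e + s • (K.vert (e + 1) - K.vert e))) -
        ∫ s in (0 : ℝ)..1, f (c + s • A) := by
  subst hA hB
  have hpd := continuous_pd_of_contDiff hf
  have hch : Continuous (K.chart c e) := by unfold chart; fun_prop
  have hfc := hf.continuous
  have hflip : (∫ s in (0 : ℝ)..1, f (K.vert e + s • (K.vert (e + 1) - K.vert e))) =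
      ∫ s in (0 : ℝ)..1, f (K.vert e + (1 - s) • (K.vert (e + 1) - K.vert e)) := by
    rw [intervalIntegral.integral_comp_sub_left
      (fun s => f (K.vert e + s • (K.vert (e + 1) - K.vert e))) 1]
    simp
  rw [hflip, integral_refTri (by fun_prop), ← intervalIntegral.integral_sub
    (Continuous.intervalIntegrable (by fun_prop) _ _)
    (Continuous.intervalIntegrable (by fun_prop) _ _)]
  refine intervalIntegral.integral_congr fun a _ => ?_
  have h1 := integral_line hf (c + a • (K.vert e - c)) (K.vert (e + 1) - c) 0 (1 - a)
  have h2 (b : ℝ) : K.chart c e (mkPt (a, b)) =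
      c + a • (K.vert e - c) + b • (K.vert (e + 1) - c) := by
    rw [chart, mkPt_zero, mkPt_one]; module
  simp only [h2]
  rw [h1, zero_smul, add_zero]
  congr 2
  module

theorem integral_edge (e : Fin (K.m + 3)) (f : Plane → ℝ) :
    ∫ s in (-1 / 2 : ℝ)..(1 / 2), f (K.edgePoint e s) =
      ∫ s in (0 : ℝ)..1, f (K.vert e + s • (K.vert (e + 1) - K.vert e)) := by
  have h1 : (fun s : ℝ => f (K.edgePoint e s)) =
      fun s : ℝ => (fun s => f (K.vert e + s • (K.vert (e + 1) - K.vert e))) (s + 1 / 2) := by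
    ext s
    simp only [edgePoint]
    congr 1
    rw [midpoint_eq_smul_add]
    simp only [invOf_eq_inv]
    module
  rw [h1, intervalIntegral.integral_comp_add_right
    (fun s => f (K.vert e + s • (K.vert (e + 1) - K.vert e)))]
  norm_num

/-- Sign of the orientation of an edge as seen from `c`. -/
def sgn (K : Polygon) (c : Plane) (e : Fin (K.m + 3)) : ℝ := SignType.sign (K.crs c e)

theorem sgn_mul_crs (e : Fin (K.m + 3)) : sgn K c e * K.crs c e = |K.crs c e| := by
  rw [sgn, sign_mul_self]

/-- The value `J e` is the flux through the spoke from `c` to the vertex `e`. With edge vectors `A`,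
`B` and fluxes `f = u B₁ - v B₀`, `g = A₀ v - A₁ u`, Cramer's rule gives `crs * (∂₀ u + ∂₁ v) = A ·
∇f + B · ∇g`. Each term integrates exactly in one reference variable, leaving the edge and the two
spokes. -/
theorem green_tri (hS : K.Star c ρ) (e : Fin (K.m + 3)) {u v : Plane → ℝ} (hu : ContDiff ℝ ∞ u)
    (hv : ContDiff ℝ ∞ v) (J : Fin (K.m + 3) → ℝ)
    (hJ : ∀ e, J e = ∫ s in (0 : ℝ)..1, (u (c + s • (K.vert e - c)) * (K.vert e - c) 1 -
      v (c + s • (K.vert e - c)) * (K.vert e - c) 0)) :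
    ∫ x in K.tri c e, (pd 0 u x + pd 1 v x) = sgn K c e * (
      (∫ s in (-1 / 2 : ℝ)..(1 / 2), (u (K.edgePoint e s) * (K.vert (e + 1) - K.vert e) 1 -
        v (K.edgePoint e s) * (K.vert (e + 1) - K.vert e) 0)) - J (e + 1) + J e) := by
  set A := K.vert e - c with hA
  set B := K.vert (e + 1) - c with hB
  let f : Plane → ℝ := fun x => u x * B 1 - v x * B 0
  let g : Plane → ℝ := fun x => A 0 * v x - A 1 * u x
  have hf : ContDiff ℝ ∞ f := by fun_prop
  have hg : ContDiff ℝ ∞ g := by fun_prop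
  have hpf (j : Fin 2) (x : Plane) : pd j f x = pd j u x * B 1 - pd j v x * B 0 := by
    have : f = (B 1) • u + (-(B 0)) • v := by ext x; simp [f]; ring
    rw [this, pd_linear hu hv]
    ring
  have hpg (j : Fin 2) (x : Plane) : pd j g x = A 0 * pd j v x - A 1 * pd j u x := by
    have : g = (A 0) • v + (-(A 1)) • u := by ext x; simp [g]; ring
    rw [this, pd_linear hv hu]
    ring
  have h1 := integral_ref_first (c := c) e hf A B hA hB
  have h2 := integral_ref_second (c := c) e hg A B hA hB
  have hpu := continuous_pd_of_contDiff hu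
  have hpv := continuous_pd_of_contDiff hv
  have hpf' := continuous_pd_of_contDiff hf
  have hpg' := continuous_pd_of_contDiff hg
  have hch : Continuous (K.chart c e) := by unfold chart; fun_prop
  have hbd : Bornology.IsBounded refTri := by
    refine Metric.isBounded_closedBall (x := (0 : Plane)) (r := 2) |>.subset fun y hy => ?_
    rw [Metric.mem_closedBall, dist_zero_right, EuclideanSpace.norm_eq, Real.sqrt_le_left (by norm_num),
      Fin.sum_univ_two, Real.norm_eq_abs, Real.norm_eq_abs, sq_abs, sq_abs]
    obtain ⟨h1, h2, h3⟩ := hy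
    nlinarith
  have hfin : IsFiniteMeasure ((volume : Measure Plane).restrict refTri) :=
    ⟨by simpa using hbd.measure_lt_top⟩
  have hint {w : Plane → ℝ} (hw : Continuous w) : IntegrableOn w refTri :=
    (memLp_of_continuous hw hbd).integrable (by norm_num)
  have h3 : (K.crs c e) * ∫ y in refTri, (pd 0 u (K.chart c e y) + pd 1 v (K.chart c e y)) =
      (∫ y in refTri, (A 0 * pd 0 f (K.chart c e y) + A 1 * pd 1 f (K.chart c e y))) +
      ∫ y in refTri, (B 0 * pd 0 g (K.chart c e y) + B 1 * pd 1 g (K.chart c e y)) := by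
    rw [← integral_add (hint (by fun_prop)) (hint (by fun_prop)), ← integral_const_mul]
    congr 1
    ext y
    rw [hpf, hpf, hpg, hpg, crs, cross, ← hA, ← hB]
    ring
  have huc := hu.continuous
  have hvc := hv.continuous
  have hep : Continuous (K.edgePoint e) := by unfold edgePoint; fun_prop
  have h4 : (∫ s in (0 : ℝ)..1, f (K.vert e + s • (K.vert (e + 1) - K.vert e))) +
      (∫ s in (0 : ℝ)..1, g (K.vert e + s • (K.vert (e + 1) - K.vert e))) =
      ∫ s in (-1 / 2 : ℝ)..(1 / 2), (u (K.edgePoint e s) * (K.vert (e + 1) - K.vert e) 1 -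
        v (K.edgePoint e s) * (K.vert (e + 1) - K.vert e) 0) := by
    rw [← integral_edge e f, ← integral_edge e g, ← intervalIntegral.integral_add
      (Continuous.intervalIntegrable (by fun_prop) _ _)
      (Continuous.intervalIntegrable (by fun_prop) _ _)]
    congr 1
    ext s
    simp only [f, g, hA, hB, PiLp.sub_apply]
    ring
  have h5 : J (e + 1) = ∫ s in (0 : ℝ)..1, f (c + s • B) := hJ (e + 1)
  have h6 : J e = - ∫ s in (0 : ℝ)..1, g (c + s • A) := by
    rw [hJ e, ← intervalIntegral.integral_neg]
    congr 1
    ext s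
    simp only [g]
    ring
  rw [hS.integral_tri, ← sgn_mul_crs, mul_assoc, h3, h1, h2, ← h4, h5, h6]
  ring

/-- Summing `green_tri` over the edges, every spoke is counted twice with opposite signs, because
all triangles have the same orientation. -/
theorem green (hS : K.Star c ρ) {u v : Plane → ℝ} (hu : ContDiff ℝ ∞ u) (hv : ContDiff ℝ ∞ v) :
    ∫ x in K.carrier, (pd 0 u x + pd 1 v x) = ∑ e, sgn K c e *
      ∫ s in (-1 / 2 : ℝ)..(1 / 2), (u (K.edgePoint e s) * (K.vert (e + 1) - K.vert e) 1 -
        v (K.edgePoint e s) * (K.vert (e + 1) - K.vert e) 0) := by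
  rw [hS.integral_eq_sum (f := fun x => pd 0 u x + pd 1 v x) (integrableOn_of_continuous
    ((continuous_pd_of_contDiff hu 0).add (continuous_pd_of_contDiff hv 1)) K.bounded)]
  let J : Fin (K.m + 3) → ℝ := fun e =>
    ∫ s in (0 : ℝ)..1, (u (c + s • (K.vert e - c)) * (K.vert e - c) 1 -
      v (c + s • (K.vert e - c)) * (K.vert e - c) 0)
  simp_rw [fun e => hS.green_tri e hu hv J fun _ => rfl]
  have h1 : ∑ e, sgn K c e * J e = ∑ e, sgn K c e * J (e + 1) := by
    rw [← Equiv.sum_comp (Equiv.addRight (1 : Fin (K.m + 3))) fun e => sgn K c e * J e]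
    refine Finset.sum_congr rfl fun e _ => ?_
    simp [sgn, hS.sign_crs e]
  simp_rw [mul_add, mul_sub, Finset.sum_add_distrib, Finset.sum_sub_distrib, h1]
  ring

end Star
end Polygon

/-! ### Bound of the normal trace in `H(div)` -/

/-- The lift `γ² g` of a polynomial on an edge to the plane. -/
def edgeLift (γ : Plane → ℝ) (g : Polynomial ℝ) (y : Plane) : ℝ :=
  γ y * γ y * g.eval ((y 1 - y 0) / 2)

theorem contDiff_eval (g : Polynomial ℝ) : ContDiff ℝ ∞ fun s : ℝ => g.eval s := by
  simpa using g.contDiff_aeval (𝕜 := ℝ) ∞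

theorem contDiff_edgeLift {γ : Plane → ℝ} (hγ : ContDiff ℝ ∞ γ) (g : Polynomial ℝ) :
    ContDiff ℝ ∞ (edgeLift γ g) := by
  have := contDiff_eval g
  unfold edgeLift
  fun_prop

theorem isTest_edgeLift {γ : Plane → ℝ} (hγ : IsTest γ) (g : Polynomial ℝ) :
    IsTest (edgeLift γ g) :=
  ⟨contDiff_edgeLift hγ.1 g, (hγ.2.mul_right (f' := γ)).mul_right⟩

theorem edgeLift_add (γ : Plane → ℝ) (g g' : Polynomial ℝ) :
    edgeLift γ (g + g') = edgeLift γ g + edgeLift γ g' := by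
  ext y; simp [edgeLift]; ring

theorem edgeLift_smul (γ : Plane → ℝ) (a : ℝ) (g : Polynomial ℝ) :
    edgeLift γ (a • g) = a • edgeLift γ g := by
  ext y; simp [edgeLift]; ring

theorem memLp_Ioc {f : ℝ → ℝ} (hf : Continuous f) (a b : ℝ) :
    MemLp f 2 (volume.restrict (Set.Ioc a b)) := by
  obtain ⟨C, hC⟩ := isCompact_Icc.exists_bound_of_continuousOn (hf.continuousOn (s := Set.Icc a b))
  exact MemLp.of_bound hf.aestronglyMeasurable C
    ((ae_restrict_iff' measurableSet_Ioc).2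
      (ae_of_all _ fun x hx => hC x (Set.Ioc_subset_Icc_self hx)))

theorem polynomial_eq_zero_of_eqOn {g : Polynomial ℝ} {a b : ℝ} (hab : a < b)
    (h : ∀ s ∈ Set.Ioo a b, g.eval s = 0) : g = 0 :=
  g.eq_zero_of_infinite_isRoot ((Set.Ioo_infinite hab).mono h)

/-- The reference lift for the trace estimate. The bump `γ` sits at the midpoint of the hypotenuse
with support in the open quadrant, so after transplantation the lift lives in the cone over a single
edge. On the hypotenuse `(y₁ - y₀) / 2` recovers the edge parameter, and the factor `γ²` turns the
boundary pairing into a weighted square of `g`. -/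
theorem exists_edgeLift_bound (k : ℕ) : ∃ γ : Plane → ℝ, IsTest γ ∧
    tsupport γ ⊆ {y | 0 < y 0 ∧ 0 < y 1} ∧ ∃ C > 0, ∀ g : Polynomial ℝ, g.natDegree ≤ k →
      ∀ N, N = ∫ s in (-1 / 2 : ℝ)..(1 / 2), (γ (mkPt (1 / 2 - s, 1 / 2 + s)) * g.eval s) ^ 2 →
      ∫ s in (-1 / 2 : ℝ)..(1 / 2), g.eval s ^ 2 ≤ C * N ∧
      ∫ y, edgeLift γ g y ^ 2 ≤ C * N ∧ ∀ j, ∫ y, pd j (edgeLift γ g) y ^ 2 ≤ C * N := by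
  obtain ⟨γ, hγ, hγs, hγ1⟩ := exists_bump (η := 1 / 2) (by norm_num) (mkPt (1 / 2, 1 / 2))
  have hdist (y : Plane) (r : ℝ) (hr : 0 < r) : y ∈ Metric.ball (mkPt (1 / 2, 1 / 2)) r ↔
      (y 0 - 1 / 2) ^ 2 + (y 1 - 1 / 2) ^ 2 < r ^ 2 := by
    rw [Metric.mem_ball, EuclideanSpace.dist_eq, Fin.sum_univ_two, Real.sqrt_lt' hr, Real.dist_eq,
      Real.dist_eq, sq_abs, sq_abs, mkPt_zero, mkPt_one]
  refine ⟨γ, hγ, fun y hy => ?_, ?_⟩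
  · have := (hdist y _ (by norm_num)).1 (hγs hy)
    constructor <;> nlinarith [sq_nonneg (y 0 - 1 / 2), sq_nonneg (y 1 - 1 / 2)]
  let V := Polynomial.degreeLT ℝ (k + 1)
  have hpt : Continuous fun s : ℝ => γ (mkPt (1 / 2 - s, 1 / 2 + s)) := by
    have := hγ.1.continuous; fun_prop
  let T : V →ₗ[ℝ] (ℝ → ℝ) :=
    { toFun := fun g s => γ (mkPt (1 / 2 - s, 1 / 2 + s)) * (g : Polynomial ℝ).eval s
      map_add' := fun g g' => by ext s; simp [mul_add]
      map_smul' := fun a g => by ext s; simp; ring }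
  let S₀ : V →ₗ[ℝ] (ℝ → ℝ) :=
    { toFun := fun g s => (g : Polynomial ℝ).eval s
      map_add' := fun g g' => by ext s; simp
      map_smul' := fun a g => by ext s; simp }
  let S₁ : V →ₗ[ℝ] (Plane → ℝ) :=
    { toFun := fun g => edgeLift γ g
      map_add' := fun g g' => edgeLift_add γ g g'
      map_smul' := fun a g => edgeLift_smul γ a g }
  let S₂ (j : Fin 2) : V →ₗ[ℝ] (Plane → ℝ) :=
    { toFun := fun g => pd j (edgeLift γ g)
      map_add' := fun g g' => by
        ext x
        rw [Submodule.coe_add, edgeLift_add]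
        exact pd_add j (diffAt_of_contDiff (contDiff_edgeLift hγ.1 _) x)
          (diffAt_of_contDiff (contDiff_edgeLift hγ.1 _) x)
      map_smul' := fun a g => by
        ext x
        rw [Submodule.coe_smul, edgeLift_smul]
        exact pd_smul j a (diffAt_of_contDiff (contDiff_edgeLift hγ.1 _) x) }
  have hT (g : V) : MemLp (T g) 2 (volume.restrict (Set.Ioc (-1 / 2 : ℝ) (1 / 2))) :=
    memLp_Ioc (hpt.mul (contDiff_eval g).continuous) _ _
  have hinj (g : V) (h : T g =ᵐ[volume.restrict (Set.Ioc (-1 / 2 : ℝ) (1 / 2))] 0) : g = 0 := by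
    -- For `|s| < 1 / 16` the hypotenuse point is within `1 / 8` of the midpoint, where `γ` is one;
    -- vanishing there already determines the polynomial.
    have h1 : T g =ᵐ[volume.restrict (Set.Ioo (-1 / 16 : ℝ) (1 / 16))] 0 :=
      ae_restrict_of_ae_restrict_of_subset 
        (fun s (hs : s ∈ Set.Ioo (-1 / 16 : ℝ) (1 / 16)) =>
          (⟨by linarith [hs.1], by linarith [hs.2]⟩ : s ∈ Set.Ioc (-1 / 2 : ℝ) (1 / 2))) h
    have h2 := Measure.eqOn_open_of_ae_eq h1 isOpen_Ioo
      (hpt.mul (contDiff_eval g).continuous).continuousOn continuousOn_const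
    refine Subtype.ext (polynomial_eq_zero_of_eqOn (a := -1 / 16) (b := 1 / 16) (by norm_num)
      fun s hs => ?_)
    have h3 : γ (mkPt (1 / 2 - s, 1 / 2 + s)) * (g : Polynomial ℝ).eval s = 0 := h2 hs
    rwa [hγ1, one_mul] at h3
    rw [hdist _ _ (by norm_num), mkPt_zero, mkPt_one]
    nlinarith [hs.1, hs.2]
  obtain ⟨C₀, hC₀, H₀⟩ := exists_integral_sq_le T S₀ hT
    (fun g => memLp_Ioc (contDiff_eval g).continuous (-1 / 2) (1 / 2)) hinj
  obtain ⟨C₁, hC₁, H₁⟩ := exists_integral_sq_le (ν := volume) T S₁ hT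
    (fun g => (isTest_edgeLift hγ g).memLp) hinj
  have H₂ (j : Fin 2) := exists_integral_sq_le (ν := volume) T (S₂ j) hT
    (fun g => (isTest_edgeLift hγ g).memLp_pd j) hinj
  choose C₂ hC₂ H₂ using H₂
  have p0 := hC₂ 0
  have p1 := hC₂ 1
  refine ⟨C₀ + C₁ + C₂ 0 + C₂ 1, by positivity, fun g hg N hN => ?_⟩
  have hN0 : 0 ≤ N := by
    rw [hN]; exact intervalIntegral.integral_nonneg (by norm_num) fun s _ => sq_nonneg _
  have hgV : g ∈ V := by
    rw [Polynomial.mem_degreeLT]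
    exact (Polynomial.degree_le_of_natDegree_le hg).trans_lt (by exact_mod_cast Nat.lt_succ_self k)
  have hNT : N = ∫ s in Set.Ioc (-1 / 2 : ℝ) (1 / 2), T ⟨g, hgV⟩ s ^ 2 := by
    rw [hN, intervalIntegral.integral_of_le (by norm_num)]; rfl
  have a0 := H₀ ⟨g, hgV⟩
  have a1 := H₁ ⟨g, hgV⟩
  have a2 (j) := H₂ j ⟨g, hgV⟩
  rw [← hNT] at a0 a1
  simp_rw [← hNT] at a2
  refine ⟨?_, a1.trans ?_, fun j => (a2 j).trans ?_⟩
  · rw [intervalIntegral.integral_of_le (by norm_num)]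
    exact a0.trans (mul_le_mul_of_nonneg_right (by linarith) hN0)
  · exact mul_le_mul_of_nonneg_right (by linarith) hN0
  · refine mul_le_mul_of_nonneg_right ?_ hN0
    fin_cases j <;> simp <;> linarith

namespace Polygon

/-- `K` is star-shaped with respect to a large ball with centre `c` and has long edges. -/
structure Shape (K : Polygon) (c : Plane) (ρ η₁ η₂ : ℝ) : Prop extends K.Star c ρ where
  ball_lt : η₁ * K.diam < ρ
  edge_le : ∀ e, η₂ * K.diam ≤ K.edgeLength e

/-- Green's formula for a row of a tensor field, with normal trace `g`. -/
def RowGreen (K : Polygon) (t : Fin 2 → Plane → ℝ) (d : Plane → ℝ)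
    (g : Fin (K.m + 3) → Polynomial ℝ) : Prop :=
  ∀ φ : Plane → ℝ, IsTest φ → ∫ x in K.carrier, ((∑ j, t j x * pd j φ x) + d x * φ x) =
    ∑ e, K.edgeLength e * ∫ s in (-1 / 2 : ℝ)..(1 / 2), (g e).eval s * φ (K.edgePoint e s)

theorem diam_pos (K : Polygon) : 0 < K.diam := by
  have h := K.edgeLength_pos 0
  refine h.trans_le ?_
  rw [diam, ← Metric.diam_closure]
  exact Metric.dist_le_diam_of_mem K.bounded.closure (frontier_subset_closure (K.vert_mem _))
    (frontier_subset_closure (K.vert_mem _))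

theorem dist_le_diam (K : Polygon) {x y : Plane} (hx : x ∈ closure K.carrier)
    (hy : y ∈ closure K.carrier) : dist x y ≤ K.diam := by
  rw [diam, ← Metric.diam_closure]
  exact Metric.dist_le_diam_of_mem K.bounded.closure hx hy

namespace Star
variable {K : Polygon} {c : Plane} {ρ : ℝ}

theorem subset_closedBall (hS : K.Star c ρ) : K.carrier ⊆ Metric.closedBall c K.diam :=
  fun _ hx => K.dist_le_diam (subset_closure hx) (subset_closure hS.center_mem)

theorem abs_vert_le (hS : K.Star c ρ) (e : Fin (K.m + 3)) (j : Fin 2) :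
    |(K.vert e - c) j| ≤ K.diam := by
  refine (PiLp.norm_apply_le (K.vert e - c) j).trans ?_
  rw [← dist_eq_norm]
  exact K.dist_le_diam (frontier_subset_closure (K.vert_mem e)) (subset_closure hS.center_mem)

theorem abs_crs_le (hS : K.Star c ρ) (e : Fin (K.m + 3)) : |K.crs c e| ≤ 2 * K.diam ^ 2 := by
  have h (e e' : Fin (K.m + 3)) (i j : Fin 2) :
      |(K.vert e - c) i * (K.vert e' - c) j| ≤ K.diam ^ 2 := by
    rw [abs_mul, sq]
    exact mul_le_mul (hS.abs_vert_le e i) (hS.abs_vert_le e' j) (abs_nonneg _) K.diam_pos.le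
  rw [crs, cross]
  refine (abs_sub _ _).trans ?_
  linarith [h e (e + 1) 0 1, h e (e + 1) 1 0]

theorem edgePoint_eq_chart (e : Fin (K.m + 3)) (s : ℝ) :
    K.edgePoint e s = K.chart c e (mkPt (1 / 2 - s, 1 / 2 + s)) := by
  rw [chart, mkPt_zero, mkPt_one, edgePoint, midpoint_eq_smul_add]
  simp only [invOf_eq_inv]
  module

theorem edgePoint_mem_segment (e : Fin (K.m + 3)) {s : ℝ} (hs : s ∈ Set.Icc (-1 / 2 : ℝ) (1 / 2)) :
    K.edgePoint e s ∈ segment ℝ (K.vert e) (K.vert (e + 1)) := by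
  refine mem_segment_iff'.2 ⟨s + 1 / 2, by linarith [hs.1], by linarith [hs.2], ?_⟩
  rw [edgePoint, midpoint_eq_smul_add]
  simp only [invOf_eq_inv]
  module

/-- Barycentric coordinates. -/
def bary (K : Polygon) (c : Plane) (e : Fin (K.m + 3)) (x : Plane) : Plane :=
  mkPt (K.la c e x, K.lb c e x)

theorem chart_bary (hS : K.Star c ρ) (e : Fin (K.m + 3)) (x : Plane) :
    K.chart c e (bary K c e x) = x := (hS.comb e x).symm

theorem bary_chart (hS : K.Star c ρ) (e : Fin (K.m + 3)) (y : Plane) :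
    bary K c e (K.chart c e y) = y := by
  ext i
  fin_cases i
  · exact hS.la_chart e y
  · exact hS.lb_chart e y

/-- Derivative of the barycentric coordinates in a direction. -/
def baryDir (K : Polygon) (c : Plane) (e : Fin (K.m + 3)) (v : Plane) : Plane :=
  mkPt (cross v (K.vert (e + 1) - c) / K.crs c e, cross (K.vert e - c) v / K.crs c e)

theorem bary_add (e : Fin (K.m + 3)) (x v : Plane) (s : ℝ) :
    bary K c e (x + s • v) = bary K c e x + s • baryDir K c e v := by
  ext i
  fin_cases i <;>
  simp [bary, mkPt, baryDir, la, lb, cross] <;> ring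

theorem contDiff_bary (e : Fin (K.m + 3)) : ContDiff ℝ ∞ (bary K c e) := by
  rw [contDiff_euclidean]
  intro i
  fin_cases i <;> simp [bary, mkPt, la, lb, cross] <;> fun_prop

theorem pd_comp_bary {ψ : Plane → ℝ} (hψ : ContDiff ℝ ∞ ψ) (e : Fin (K.m + 3)) (j : Fin 2)
    (x : Plane) : pd j (fun x => ψ (bary K c e x)) x =
      baryDir K c e (EuclideanSpace.single j 1) 0 * pd 0 ψ (bary K c e x) +
      baryDir K c e (EuclideanSpace.single j 1) 1 * pd 1 ψ (bary K c e x) := by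
  have hφ : ContDiff ℝ ∞ fun x => ψ (bary K c e x) := hψ.comp (contDiff_bary e)
  have h1 := hasDerivAt_comp_line hφ x (EuclideanSpace.single j 1) 0
  have h2 := hasDerivAt_comp_line hψ (bary K c e x)
    (baryDir K c e (EuclideanSpace.single j 1)) 0
  simp only [bary_add] at h1
  have h3 := h1.unique h2
  rw [← fderiv_eq_pd] at h3
  simpa [pd, zero_smul] using h3

theorem abs_baryDir_le (hS : K.Star c ρ) (e : Fin (K.m + 3)) (j i : Fin 2) :
    |baryDir K c e (EuclideanSpace.single j 1) i| ≤ K.diam / |K.crs c e| := by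
  have h1 := hS.abs_vert_le e
  have h2 := hS.abs_vert_le (e + 1)
  fin_cases i <;> fin_cases j <;>
  simp only [Fin.zero_eta, Fin.mk_one, baryDir, mkPt_zero, mkPt_one, abs_div] <;>
  refine div_le_div_of_nonneg_right ?_ (abs_nonneg _)
  · simpa [cross] using h2 1
  · simpa [cross, abs_sub_comm] using h2 0
  · simpa [cross, abs_sub_comm] using h1 1
  · simpa [cross] using h1 0

end Star

/-- Each triangle over an edge has height above `η₁ h` and base at least `η₂ h`, so it is
nondegenerate at the scale of the element. -/
theorem Shape.le_abs_crs {K : Polygon} {c : Plane} {ρ η₁ η₂ : ℝ} (hη₂ : 0 < η₂)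
    (hS : K.Shape c ρ η₁ η₂) (e : Fin (K.m + 3)) : η₁ * η₂ * K.diam ^ 2 ≤ |K.crs c e| := by
  refine le_trans ?_ (hS.toStar.le_abs_crs e)
  have := K.diam_pos
  calc η₁ * η₂ * K.diam ^ 2 = (η₁ * K.diam) * (η₂ * K.diam) := by ring
    _ ≤ ρ * K.edgeLength e := mul_le_mul hS.ball_lt.le (hS.edge_le e) (by positivity) hS.pos.le

/-- Green's formula is tested with the lift of `g e` transplanted by barycentric coordinates. It
vanishes on the other edges and, within the element, outside the triangle over `e`. The boundary
term is then a weighted square of `g e` and the volume term involves only that triangle. This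
locality later allows summation over edges without bounding their number. -/
theorem trace_le (k : ℕ) {η₁ η₂ : ℝ} (hη₁ : 0 < η₁) (hη₂ : 0 < η₂) :
    ∃ C > 0, ∀ (K : Polygon) (c : Plane) (ρ : ℝ), K.Shape c ρ η₁ η₂ →
    ∀ (t : Fin 2 → Plane → ℝ) (d : Plane → ℝ) (g : Fin (K.m + 3) → Polynomial ℝ),
    (∀ j, MemLp (t j) 2 (volume.restrict K.carrier)) → MemLp d 2 (volume.restrict K.carrier) →
    K.RowGreen t d g → ∀ e, (g e).natDegree ≤ k →
    K.diam ^ 2 * ∫ s in (-1 / 2 : ℝ)..(1 / 2), (g e).eval s ^ 2 ≤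
      C * ((∑ j, ∫ x in K.tri c e, t j x ^ 2) + K.diam ^ 2 * ∫ x in K.tri c e, d x ^ 2) := by
  obtain ⟨γ, hγ, hγs, C₀, hC₀, H⟩ := exists_edgeLift_bound k
  refine ⟨C₀ * (3 * (4 * C₀ / (η₁ * η₂) + 2 * C₀)) / η₂ ^ 2, by positivity, ?_⟩
  intro K c ρ hS t d g ht hd hG e he
  have hS' := hS.toStar
  set h := K.diam with hh
  have hpos : 0 < h := K.diam_pos
  set N := ∫ s in (-1 / 2 : ℝ)..(1 / 2), (γ (mkPt (1 / 2 - s, 1 / 2 + s)) * (g e).eval s) ^ 2 with hN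
  have hN0 : 0 ≤ N := intervalIntegral.integral_nonneg (by norm_num) fun s _ => sq_nonneg _
  obtain ⟨H1, H2, H3⟩ := H (g e) he N hN
  set ψ := edgeLift γ (g e) with hψ
  have hψt : IsTest ψ := isTest_edgeLift hγ _
  have hψ0 (y : Plane) (hy : y ∉ tsupport γ) : ψ y = 0 := by
    simp [hψ, edgeLift, image_eq_zero_of_notMem_tsupport hy]
  have hψs : tsupport ψ ⊆ tsupport γ :=
    closure_minimal (fun y hy => by by_contra h; exact hy (hψ0 y h)) (isClosed_tsupport γ)
  have hψ1 (j : Fin 2) (y : Plane) (hy : y ∉ tsupport γ) : pd j ψ y = 0 := by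
    have : fderiv ℝ ψ y = 0 := by
      by_contra h
      exact hy (hψs (support_fderiv_subset ℝ h))
    simp [pd, this]
  set φ : Plane → ℝ := fun x => ψ (Star.bary K c e x) with hφ
  have hφt : IsTest φ := by
    refine ⟨hψt.1.comp (Star.contDiff_bary e), HasCompactSupport.intro (K := K.chart c e '' tsupport γ)
      (hγ.2.isCompact.image (by unfold chart; fun_prop)) fun x hx => hψ0 _ fun h => hx ?_⟩
    exact ⟨_, h, hS'.chart_bary e x⟩
  have hcone (x : Plane) (hx : x ∉ K.cone c e) : Star.bary K c e x ∉ tsupport γ := fun h =>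
    hx (hγs h)
  have hout (x : Plane) (hx : x ∈ K.carrier \ K.tri c e) : x ∉ K.cone c e := fun h =>
    hx.2 (by rw [← hS'.carrier_inter_cone]; exact ⟨hx.1, h⟩)
  -- both sides of the Green formula
  have hL : ∫ x in K.carrier, ((∑ j, t j x * pd j φ x) + d x * φ x) =
      ∫ x in K.tri c e, ((∑ j, t j x * pd j φ x) + d x * φ x) := by
    refine setIntegral_eq_of_subset_of_forall_sdiff_eq_zero K.isOpen.measurableSet
      (hS'.tri_subset e) fun x hx => ?_
    have hb := hcone x (hout x hx)
    have hp (j : Fin 2) : pd j φ x = 0 := by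
      rw [hφ, Star.pd_comp_bary hψt.1, hψ1 0 _ hb, hψ1 1 _ hb]; ring
    have h0 : φ x = 0 := hψ0 _ hb
    simp [hp, h0]
  have hR : ∑ e', K.edgeLength e' *
      ∫ s in (-1 / 2 : ℝ)..(1 / 2), (g e').eval s * φ (K.edgePoint e' s) =
      K.edgeLength e * N := by
    rw [Finset.sum_eq_single e]
    · rw [hN]
      congr 1
      refine intervalIntegral.integral_congr fun s _ => ?_
      simp only [hφ]
      rw [Star.edgePoint_eq_chart (c := c), hS'.bary_chart, hψ, edgeLift, mkPt_zero, mkPt_one,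
        show (1 / 2 + s - (1 / 2 - s)) / 2 = s by ring]
      ring
    · intro e' _ hne
      have : ∫ s in (-1 / 2 : ℝ)..(1 / 2), (g e').eval s * φ (K.edgePoint e' s) =
          ∫ s in (-1 / 2 : ℝ)..(1 / 2), 0 := by
        refine intervalIntegral.integral_congr fun s hs => ?_
        rw [Set.uIcc_of_le (by norm_num)] at hs
        simp only [hφ]
        rw [hψ0 _ (hcone _ (hS'.edgePoint_notMem_cone hne.symm (Star.edgePoint_mem_segment e' hs))),
          mul_zero]
      rw [this]; simp
    · simp
  have hGφ := hG φ hφt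
  rw [hL, hR] at hGφ
  -- bounds of the test function
  set D := |K.crs c e| with hD
  have hDpos : 0 < D := abs_pos.2 (hS'.crs_ne e)
  have hDge : η₁ * η₂ * h ^ 2 ≤ D := hS.le_abs_crs hη₂ e
  have hDle : D ≤ 2 * h ^ 2 := hS'.abs_crs_le e
  have hQ : ∫ x in K.tri c e, φ x ^ 2 ≤ 2 * C₀ * h ^ 2 * N := by
    rw [hS'.integral_tri]
    simp only [hφ, hS'.bary_chart]
    have : ∫ y in refTri, ψ y ^ 2 ≤ C₀ * N :=
      (setIntegral_le_integral hψt.memLp.integrable_sq (ae_of_all _ fun _ => sq_nonneg _)).trans H2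
    calc D * ∫ y in refTri, ψ y ^ 2 ≤ (2 * h ^ 2) * (C₀ * N) :=
          mul_le_mul hDle this (integral_nonneg fun _ => sq_nonneg _) (by positivity)
      _ = _ := by ring
  -- In the plane the Dirichlet integral is scale invariant: the area factor `D` and the squared
  -- derivative `(h / D)²` of the barycentric map leave `h² / D ≤ 1 / (η₁ η₂)`.
  have hP (j : Fin 2) : ∫ x in K.tri c e, pd j φ x ^ 2 ≤ 4 * C₀ / (η₁ * η₂) * N := by
    rw [hS'.integral_tri]
    have hi (i : Fin 2) : Integrable (fun y => pd i ψ y ^ 2) (volume.restrict refTri) :=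
      ((hψt.memLp_pd i).restrict _).integrable_sq
    have hii (i : Fin 2) : ∫ y in refTri, pd i ψ y ^ 2 ≤ C₀ * N :=
      (setIntegral_le_integral (hψt.memLp_pd i).integrable_sq
        (ae_of_all _ fun _ => sq_nonneg _)).trans (H3 i)
    have hle : ∫ y in refTri, pd j φ (K.chart c e y) ^ 2 ≤
        ∫ y in refTri, 2 * (h / D) ^ 2 * (pd 0 ψ y ^ 2 + pd 1 ψ y ^ 2) := by
      refine integral_mono_of_nonneg (ae_of_all _ fun _ => sq_nonneg _)
        (((hi 0).add (hi 1)).const_mul _) (ae_of_all _ fun y => ?_)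
      simp only [hφ]
      rw [Star.pd_comp_bary hψt.1, hS'.bary_chart]
      have b0 := sq_le_sq' (neg_le_of_abs_le (hS'.abs_baryDir_le e j 0))
        (le_of_abs_le (hS'.abs_baryDir_le e j 0))
      have b1 := sq_le_sq' (neg_le_of_abs_le (hS'.abs_baryDir_le e j 1))
        (le_of_abs_le (hS'.abs_baryDir_le e j 1))
      rw [← hh, ← hD] at b0 b1
      have c0 := mul_le_mul_of_nonneg_right b0 (sq_nonneg (pd 0 ψ y))
      have c1 := mul_le_mul_of_nonneg_right b1 (sq_nonneg (pd 1 ψ y))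
      nlinarith [sq_nonneg (Star.baryDir K c e (EuclideanSpace.single j 1) 0 * pd 0 ψ y -
        Star.baryDir K c e (EuclideanSpace.single j 1) 1 * pd 1 ψ y)]
    rw [integral_const_mul, integral_add (hi 0) (hi 1)] at hle
    calc D * ∫ y in refTri, pd j φ (K.chart c e y) ^ 2
        ≤ D * (2 * (h / D) ^ 2 * (C₀ * N + C₀ * N)) := by
          refine mul_le_mul_of_nonneg_left (hle.trans ?_) hDpos.le
          exact mul_le_mul_of_nonneg_left (add_le_add (hii 0) (hii 1)) (by positivity)
      _ = (h ^ 2 / D) * (4 * C₀ * N) := by field_simp; ring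
      _ ≤ (1 / (η₁ * η₂)) * (4 * C₀ * N) := by
          refine mul_le_mul_of_nonneg_right ?_ (by positivity)
          rw [div_le_div_iff₀ hDpos (by positivity)]
          linarith
      _ = _ := by ring
  have ht' (j) : MemLp (t j) 2 (volume.restrict (K.tri c e)) :=
    (ht j).mono_measure (Measure.restrict_mono (hS'.tri_subset e) le_rfl)
  have hd' : MemLp d 2 (volume.restrict (K.tri c e)) :=
    hd.mono_measure (Measure.restrict_mono (hS'.tri_subset e) le_rfl)
  have hi (j : Fin 2) : Integrable (fun x => t j x * pd j φ x) (volume.restrict (K.tri c e)) :=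
    (ht' j).integrable_mul ((hφt.memLp_pd j).restrict _)
  have hi' : Integrable (fun x => d x * φ x) (volume.restrict (K.tri c e)) :=
    hd'.integrable_mul (hφt.memLp.restrict _)
  rw [integral_add (integrable_finsetSum _ fun j _ => hi j) hi',
    integral_finsetSum _ fun j _ => hi j, Fin.sum_univ_two] at hGφ
  have q (j : Fin 2) := (sq_integral_mul_le (ht' j) ((hφt.memLp_pd j).restrict (K.tri c e))).trans
    (mul_le_mul_of_nonneg_left (hP j) (integral_nonneg fun x => sq_nonneg (t j x)))
  have q' := (sq_integral_mul_le hd' (hφt.memLp.restrict (K.tri c e))).trans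
    (mul_le_mul_of_nonneg_left hQ (integral_nonneg fun x => sq_nonneg (d x)))
  have q0 := q 0
  have q1 := q 1
  have a0 : 0 ≤ ∫ x in K.tri c e, t 0 x ^ 2 := integral_nonneg fun _ => sq_nonneg _
  have a1 : 0 ≤ ∫ x in K.tri c e, t 1 x ^ 2 := integral_nonneg fun _ => sq_nonneg _
  have a2 : 0 ≤ ∫ x in K.tri c e, d x ^ 2 := integral_nonneg fun _ => sq_nonneg _
  have hLe := hS.edge_le e
  rw [Fin.sum_univ_two]
  generalize (∫ x in K.tri c e, t 0 x * pd 0 φ x) = X at *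
  generalize (∫ x in K.tri c e, t 1 x * pd 1 φ x) = Y at *
  generalize (∫ x in K.tri c e, d x * φ x) = Z at *
  generalize (∫ x in K.tri c e, t 0 x ^ 2) = A at *
  generalize (∫ x in K.tri c e, t 1 x ^ 2) = B at *
  generalize (∫ x in K.tri c e, d x ^ 2) = E at *
  generalize hLdef : K.edgeLength e = Le at *
  set R := 3 * (4 * C₀ / (η₁ * η₂) + 2 * C₀) with hRdef
  have hR0 : 0 < R := by positivity
  -- Three-term Cauchy–Schwarz applied to Green's formula, with one factor `N` to be cancelled.
  have hLN : (Le ^ 2 * N) * N ≤ (R * (A + B + h ^ 2 * E)) * N := by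
    have e1 : (Le ^ 2 * N) * N = (X + Y + Z) ^ 2 := by rw [hGφ]; ring
    have e2 : (X + Y + Z) ^ 2 ≤ 3 * (X ^ 2 + Y ^ 2 + Z ^ 2) := by
      nlinarith [sq_nonneg (X - Y), sq_nonneg (Y - Z), sq_nonneg (X - Z)]
    have e3 : X ^ 2 + Y ^ 2 + Z ^ 2 ≤
        (4 * C₀ / (η₁ * η₂) + 2 * C₀) * (A + B + h ^ 2 * E) * N := by
      have f1 : 0 ≤ 4 * C₀ / (η₁ * η₂) * (h ^ 2 * E) * N := by positivity
      have f2 : 0 ≤ 2 * C₀ * (A + B) * N := by positivity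
      linarith
    rw [e1, hRdef]
    linarith
  have hLN' : Le ^ 2 * N ≤ R * (A + B + h ^ 2 * E) := by
    rcases hN0.eq_or_lt with h0 | h0
    · rw [← h0, mul_zero]; positivity
    · exact le_of_mul_le_mul_right hLN h0
  have hfin : η₂ ^ 2 * h ^ 2 * N ≤ R * (A + B + h ^ 2 * E) := by
    refine le_trans ?_ hLN'
    rw [← mul_pow]
    exact mul_le_mul_of_nonneg_right (pow_le_pow_left₀ (by positivity) hLe 2) hN0
  calc h ^ 2 * ∫ s in (-1 / 2 : ℝ)..(1 / 2), (g e).eval s ^ 2 ≤ h ^ 2 * (C₀ * N) :=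
        mul_le_mul_of_nonneg_left H1 (by positivity)
    _ = C₀ / η₂ ^ 2 * (η₂ ^ 2 * h ^ 2 * N) := by field_simp
    _ ≤ C₀ / η₂ ^ 2 * (R * (A + B + h ^ 2 * E)) := mul_le_mul_of_nonneg_left hfin (by positivity)
    _ = _ := by ring

end Polygon

/-! ### Trace and Poincaré inequalities for smooth functions -/

theorem sq_norm_eq (v : Plane) : ‖v‖ ^ 2 = v 0 ^ 2 + v 1 ^ 2 := by
  rw [EuclideanSpace.norm_sq_eq, Fin.sum_univ_two, Real.norm_eq_abs, Real.norm_eq_abs, sq_abs,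
    sq_abs]

theorem sq_dot_le (v : Plane) (a b h : ℝ) (hv : ‖v‖ ≤ h) :
    (v 0 * a + v 1 * b) ^ 2 ≤ h ^ 2 * (a ^ 2 + b ^ 2) := by
  have h1 : v 0 ^ 2 + v 1 ^ 2 ≤ h ^ 2 := by
    rw [← sq_norm_eq]; exact pow_le_pow_left₀ (norm_nonneg _) hv 2
  calc (v 0 * a + v 1 * b) ^ 2 ≤ (v 0 ^ 2 + v 1 ^ 2) * (a ^ 2 + b ^ 2) := by
        nlinarith [sq_nonneg (v 0 * b - v 1 * a)]
    _ ≤ _ := mul_le_mul_of_nonneg_right h1 (by positivity)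

/-- The divergence theorem for the field `(x - c) φ²`. Its flux through an edge is `|crs|` times the
mean of `φ²` on the edge, and star-shapedness bounds `|crs|` below by `ρ` times the edge length. -/
theorem Polygon.Star.trace_smooth {K : Polygon} {c : Plane} {ρ : ℝ} (hS : K.Star c ρ)
    {φ : Plane → ℝ} (hφ : ContDiff ℝ ∞ φ) :
    ρ * ∑ e, K.edgeLength e * ∫ s in (-1 / 2 : ℝ)..(1 / 2), φ (K.edgePoint e s) ^ 2 ≤
      3 * (∫ x in K.carrier, φ x ^ 2) +
        K.diam ^ 2 * ∫ x in K.carrier, (pd 0 φ x ^ 2 + pd 1 φ x ^ 2) := by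
  have hco (j : Fin 2) : ContDiff ℝ ∞ fun x : Plane => x j - c j := by fun_prop
  have hu (j : Fin 2) : ContDiff ℝ ∞ fun x : Plane => (x j - c j) * φ x ^ 2 := by fun_prop
  have hpd (j : Fin 2) (x : Plane) :
      pd j (fun x : Plane => (x j - c j) * φ x ^ 2) x =
        φ x ^ 2 + 2 * φ x * ((x j - c j) * pd j φ x) := by
    have h0 : pd j (fun x : Plane => x j - c j) x = 1 := by
      have : (fun x : Plane => x j - c j) = (fun x : Plane => x j) + fun _ => - c j := by
        ext x; simp [sub_eq_add_neg]
      rw [this, pd_add j (by fun_prop) (by fun_prop), pd_coord, pd_const]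
      simp
    rw [pd_mul j (diffAt_of_contDiff (hco j) x) (diffAt_of_contDiff (hφ.pow 2) x),
      pd_pow j 2 (diffAt_of_contDiff hφ x), h0]
    simp
    ring
  have hG := hS.green (hu 0) (hu 1)
  have hep (e) : Continuous (K.edgePoint e) := by unfold Polygon.edgePoint; fun_prop
  have hφc := hφ.continuous
  -- The cross product of `x - c` with the edge vector is constant along the edge and equals `crs`.
  have hterm (e : Fin (K.m + 3)) : Polygon.Star.sgn K c e * ∫ s in (-1 / 2 : ℝ)..(1 / 2),
      (((K.edgePoint e s) 0 - c 0) * φ (K.edgePoint e s) ^ 2 * (K.vert (e + 1) - K.vert e) 1 -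
        ((K.edgePoint e s) 1 - c 1) * φ (K.edgePoint e s) ^ 2 * (K.vert (e + 1) - K.vert e) 0) =
      |K.crs c e| * ∫ s in (-1 / 2 : ℝ)..(1 / 2), φ (K.edgePoint e s) ^ 2 := by
    rw [← Polygon.Star.sgn_mul_crs, mul_assoc]
    congr 1
    rw [← intervalIntegral.integral_const_mul]
    refine intervalIntegral.integral_congr fun s _ => ?_
    simp only [Polygon.Star.edgePoint_eq_chart (c := c), Polygon.chart, mkPt_zero, mkPt_one,
      Polygon.crs, cross, PiLp.add_apply, PiLp.sub_apply, PiLp.smul_apply, smul_eq_mul]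
    ring
  simp only [hpd, hterm] at hG
  have hp0 := continuous_pd_of_contDiff hφ 0
  have hp1 := continuous_pd_of_contDiff hφ 1
  calc ρ * ∑ e, K.edgeLength e * ∫ s in (-1 / 2 : ℝ)..(1 / 2), φ (K.edgePoint e s) ^ 2
      ≤ ∑ e, |K.crs c e| * ∫ s in (-1 / 2 : ℝ)..(1 / 2), φ (K.edgePoint e s) ^ 2 := by
        rw [Finset.mul_sum]
        refine Finset.sum_le_sum fun e _ => ?_
        rw [← mul_assoc]
        exact mul_le_mul_of_nonneg_right (hS.le_abs_crs e)
          (intervalIntegral.integral_nonneg (by norm_num) fun _ _ => sq_nonneg _)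
    _ = _ := hG.symm
    _ ≤ ∫ x in K.carrier, (3 * φ x ^ 2 + K.diam ^ 2 * (pd 0 φ x ^ 2 + pd 1 φ x ^ 2)) := by
        refine setIntegral_mono_on (integrableOn_of_continuous (by fun_prop) K.bounded)
          (integrableOn_of_continuous (by fun_prop) K.bounded) K.isOpen.measurableSet fun x hx => ?_
        have h1 := sq_dot_le (x - c) (pd 0 φ x) (pd 1 φ x) K.diam (by
          rw [← dist_eq_norm]
          exact K.dist_le_diam (subset_closure hx) (subset_closure hS.center_mem))
        simp only [PiLp.sub_apply] at h1
        -- The divergence is `2 φ² + 2 φ q` with `q = (x - c) · ∇φ`, and `2 φ q ≤ φ² + q²`.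
        nlinarith [sq_nonneg (φ x - ((x 0 - c 0) * pd 0 φ x + (x 1 - c 1) * pd 1 φ x))]
    _ = _ := by
        rw [integral_add (integrableOn_of_continuous (by fun_prop) K.bounded)
          (integrableOn_of_continuous (by fun_prop) K.bounded), integral_const_mul,
          integral_const_mul]

/-- The Jacobian factor `s⁻²` is at most `4` as long as `s ≥ 1 / 2`. -/
theorem lintegral_comp_affine {F : Plane → ENNReal} (hF : Measurable F) (a : Plane) {s : ℝ}
    (hs : 1 / 2 ≤ s) : ∫⁻ x, F (a + s • x) ≤ 4 * ∫⁻ x, F x := by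
  have hs0 : s ≠ 0 := by linarith
  have h1 : ∫⁻ x, F (a + s • x) = ∫⁻ x, F (a + x) ∂(Measure.map (fun x : Plane => s • x) volume) := by
    rw [lintegral_map (f := fun x => F (a + x)) (hF.comp (measurable_const_add a))
      (measurable_const_smul s)]
  have h2 := Measure.map_addHaar_smul (volume : Measure Plane) hs0
  rw [h1]
  change ∫⁻ x, F (a + x) ∂(Measure.map (s • ·) volume) ≤ _
  rw [h2, lintegral_smul_measure, lintegral_add_left_eq_self, smul_eq_mul]
  refine mul_le_mul_left ?_ _
  rw [finrank_euclideanSpace, Fintype.card_fin, abs_of_nonneg (by positivity)]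
  refine ENNReal.ofReal_le_of_le_toReal ?_
  have : (s ^ 2)⁻¹ ≤ 4 := by
    rw [inv_le_comm₀ (by positivity) (by norm_num)]
    nlinarith
  simpa using this

theorem sq_sub_le_integral {φ : Plane → ℝ} (hφ : ContDiff ℝ ∞ φ) (x z : Plane) {h : ℝ}
    (hh : ‖x - z‖ ≤ h) : (φ x - φ z) ^ 2 ≤ h ^ 2 * ∫ s in Set.Ioc (0 : ℝ) 1,
      (pd 0 φ (z + s • (x - z)) ^ 2 + pd 1 φ (z + s • (x - z)) ^ 2) := by
  have hp (j) := continuous_pd_of_contDiff hφ j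
  have h1 := integral_line hφ z (x - z) 0 1
  rw [intervalIntegral.integral_of_le zero_le_one, one_smul, zero_smul, add_zero,
    add_sub_cancel] at h1
  have hc : Continuous fun s : ℝ => (x - z) 0 * pd 0 φ (z + s • (x - z)) +
    (x - z) 1 * pd 1 φ (z + s • (x - z)) := by fun_prop
  have h2 := sq_integral_mul_le (memLp_Ioc hc 0 1) (memLp_Ioc (continuous_const (y := (1 : ℝ))) 0 1)
  simp only [mul_one, one_pow, integral_const, measureReal_restrict_apply_univ,
    Real.volume_real_Ioc_of_le (zero_le_one' ℝ), sub_zero, smul_eq_mul] at h2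
  rw [h1] at h2
  refine h2.trans ?_
  rw [← integral_const_mul]
  have hint {f : ℝ → ℝ} (hf : Continuous f) : IntegrableOn f (Set.Ioc 0 1) :=
    (memLp_Ioc hf 0 1).integrable (by norm_num)
  exact integral_mono (hint (by fun_prop)) (hint (by fun_prop)) fun s => sq_dot_le _ _ _ _ hh

/-- Poincaré inequality on a domain which is star-shaped with respect to a ball. -/
theorem poincare {K : Set Plane} (hK : MeasurableSet K) {c : Plane} {ρ h : ℝ} (hρ : 0 < ρ)
    (hstar : ∀ y ∈ Metric.ball c ρ, StarConvex ℝ y K) (hball : Metric.ball c ρ ⊆ K)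
    (hdiam : ∀ x ∈ K, ∀ y ∈ K, dist x y ≤ h) (hb : Bornology.IsBounded K)
    {φ : Plane → ℝ} (hφ : ContDiff ℝ ∞ φ) :
    ∃ z, ∫ x in K, (φ x - φ z) ^ 2 ≤
      4 * (1 + volume.real K / volume.real (Metric.ball c ρ)) *
        (h ^ 2 * ∫ x in K, (pd 0 φ x ^ 2 + pd 1 φ x ^ 2)) := by
  set B := Metric.ball c ρ with hB
  have hp (j) := continuous_pd_of_contDiff hφ j
  have hφc := hφ.continuous
  let G : Plane → ℝ := fun x => pd 0 φ x ^ 2 + pd 1 φ x ^ 2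
  have hGc : Continuous G := by fun_prop
  have hG0 (x) : 0 ≤ G x := by positivity
  -- Extending the squared gradient by zero, with values in `ENNReal`, lets the orders of
  -- integration be swapped and the affine changes of variable be made on the whole plane.
  let F : Plane → ENNReal := K.indicator fun x => ENNReal.ofReal (G x)
  have hF : Measurable F := (hGc.measurable.ennreal_ofReal).indicator hK
  set I := ∫⁻ x, F x with hI
  have hII : I = ENNReal.ofReal (∫ x in K, G x) := by
    rw [hI, lintegral_indicator hK, ofReal_integral_eq_lintegral_ofReal
      (integrableOn_of_continuous hGc hb) (ae_of_all _ hG0)]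
  have hBfin : volume B ≠ ⊤ := Metric.isBounded_ball.measure_lt_top.ne
  have hKfin : volume K ≠ ⊤ := hb.measure_lt_top.ne
  have hBpos : volume B ≠ 0 := (Metric.measure_ball_pos volume c hρ).ne'
  have hmeas3 : Measurable fun p : (Plane × Plane) × ℝ => F (p.1.1 + p.2 • (p.1.2 - p.1.1)) :=
    hF.comp (by fun_prop)
  -- pointwise bound
  have hpt (z : Plane) (hz : z ∈ B) (x : Plane) (hx : x ∈ K) :
      ENNReal.ofReal ((φ x - φ z) ^ 2) ≤
        ENNReal.ofReal (h ^ 2) * ∫⁻ s in Set.Ioc (0 : ℝ) 1, F (z + s • (x - z)) := by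
    have h1 := sq_sub_le_integral hφ x z (h := h)
      (by rw [← dist_eq_norm]; exact hdiam x hx z (hball hz))
    refine (ENNReal.ofReal_le_ofReal h1).trans ?_
    rw [ENNReal.ofReal_mul (sq_nonneg h)]
    refine mul_le_mul_right ?_ _
    rw [ofReal_integral_eq_lintegral_ofReal]
    · refine setLIntegral_mono_ae' measurableSet_Ioc (ae_of_all _ fun s hs => ?_)
      have : z + s • (x - z) ∈ K := by
        have := hstar z hz hx (sub_nonneg.2 hs.2) hs.1.le (by ring)
        convert this using 1
        module
      simp only [F, Set.indicator_of_mem this]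
      exact le_rfl
    · exact (memLp_Ioc (by fun_prop) 0 1).integrable (by norm_num)
    · exact ae_of_all _ fun s => hG0 _
  -- the two halves
  have half1 (z : Plane) : ∫⁻ x in K, ∫⁻ s in Set.Ioc (1 / 2 : ℝ) 1, F (z + s • (x - z)) ≤
      4 * I := by
    rw [lintegral_lintegral_swap (by
      refine (hF.comp ?_).aemeasurable
      change Measurable fun p : Plane × ℝ => z + p.2 • (p.1 - z)
      fun_prop)]
    calc ∫⁻ s in Set.Ioc (1 / 2 : ℝ) 1, ∫⁻ x in K, F (z + s • (x - z))
        ≤ ∫⁻ s in Set.Ioc (1 / 2 : ℝ) 1, 4 * I := by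
          refine setLIntegral_mono_ae' measurableSet_Ioc (ae_of_all _ fun s hs => ?_)
          refine (setLIntegral_le_lintegral _ _).trans ?_
          -- For `s ≥ 1 / 2` the moving point on the segment depends well on the endpoint `x`, so
          -- the substitution is made in `x`.
          have h1 := lintegral_comp_affine hF (z - s • z) hs.1.le
          refine le_trans (le_of_eq ?_) h1
          congr 1; ext x; congr 1; module
      _ ≤ 4 * I := by
          rw [setLIntegral_const, Real.volume_Ioc]
          refine mul_le_of_le_one_right' ?_
          exact ENNReal.ofReal_le_one.2 (by norm_num)
  have half2 (x : Plane) : ∫⁻ z in B, ∫⁻ s in Set.Ioc (0 : ℝ) (1 / 2), F (z + s • (x - z)) ≤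
      4 * I := by
    rw [lintegral_lintegral_swap (by
      refine (hF.comp ?_).aemeasurable
      change Measurable fun p : Plane × ℝ => p.1 + p.2 • (x - p.1)
      fun_prop)]
    calc ∫⁻ s in Set.Ioc (0 : ℝ) (1 / 2), ∫⁻ z in B, F (z + s • (x - z))
        ≤ ∫⁻ s in Set.Ioc (0 : ℝ) (1 / 2), 4 * I := by
          refine setLIntegral_mono_ae' measurableSet_Ioc (ae_of_all _ fun s hs => ?_)
          refine (setLIntegral_le_lintegral _ _).trans ?_
          -- For `s ≤ 1 / 2` it depends well on the other endpoint `z` instead, with factor `1 - s ≥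
          -- 1 / 2`.
          have h1 := lintegral_comp_affine hF (s • x) (s := 1 - s) (by linarith [hs.2])
          refine le_trans (le_of_eq ?_) h1
          congr 1; ext z; congr 1; module
      _ ≤ 4 * I := by
          rw [setLIntegral_const, Real.volume_Ioc]
          refine mul_le_of_le_one_right' ?_
          exact ENNReal.ofReal_le_one.2 (by norm_num)
  have hm1 : Measurable fun p : Plane × Plane =>
      ∫⁻ s in Set.Ioc (1 / 2 : ℝ) 1, F (p.1 + s • (p.2 - p.1)) := hmeas3.lintegral_prod_right'
  have hm2 : Measurable fun p : Plane × Plane =>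
      ∫⁻ s in Set.Ioc (0 : ℝ) (1 / 2), F (p.1 + s • (p.2 - p.1)) := hmeas3.lintegral_prod_right'
  have hsplit (z x : Plane) : ∫⁻ s in Set.Ioc (0 : ℝ) 1, F (z + s • (x - z)) =
      (∫⁻ s in Set.Ioc (0 : ℝ) (1 / 2), F (z + s • (x - z))) +
      ∫⁻ s in Set.Ioc (1 / 2 : ℝ) 1, F (z + s • (x - z)) := by
    rw [← lintegral_union measurableSet_Ioc (Set.Ioc_disjoint_Ioc_of_le le_rfl),
      Set.Ioc_union_Ioc_eq_Ioc (by norm_num) (by norm_num)]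
  have htotal : ∫⁻ z in B, ∫⁻ x in K, ∫⁻ s in Set.Ioc (0 : ℝ) 1, F (z + s • (x - z)) ≤
      4 * I * volume K + 4 * I * volume B := by
    simp_rw [hsplit]
    have e1 (z : Plane) : ∫⁻ x in K, ((∫⁻ s in Set.Ioc (0 : ℝ) (1 / 2), F (z + s • (x - z))) +
        ∫⁻ s in Set.Ioc (1 / 2 : ℝ) 1, F (z + s • (x - z))) =
        (∫⁻ x in K, ∫⁻ s in Set.Ioc (0 : ℝ) (1 / 2), F (z + s • (x - z))) +
        ∫⁻ x in K, ∫⁻ s in Set.Ioc (1 / 2 : ℝ) 1, F (z + s • (x - z)) :=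
      lintegral_add_left (hm2.comp (measurable_const.prodMk measurable_id)) _
    simp_rw [e1]
    rw [lintegral_add_left hm2.lintegral_prod_right']
    refine add_le_add ?_ ?_
    · rw [lintegral_lintegral_swap hm2.aemeasurable, ← setLIntegral_const]
      exact lintegral_mono fun x => half2 x
    · rw [← setLIntegral_const]
      exact lintegral_mono fun z => half1 z
  -- choice of the point
  have hmB : AEMeasurable (fun z => ∫⁻ x in K, ENNReal.ofReal ((φ x - φ z) ^ 2))
      (volume.restrict B) := by
    refine Measurable.aemeasurable ?_
    have : Measurable fun p : Plane × Plane => ENNReal.ofReal ((φ p.2 - φ p.1) ^ 2) := by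
      fun_prop
    exact this.lintegral_prod_right'
  -- Some `z` in the ball does no worse than the average over the ball, so a point value replaces
  -- the mean of `φ`.
  obtain ⟨z, hz, hzle⟩ := exists_le_setLAverage hBpos hBfin hmB
  refine ⟨z, ?_⟩
  have hall : ∫⁻ x in K, ENNReal.ofReal ((φ x - φ z) ^ 2) ≤
      (volume B)⁻¹ * (ENNReal.ofReal (h ^ 2) * (4 * I * volume K + 4 * I * volume B)) := by
    refine hzle.trans ?_
    rw [setLAverage_eq, ENNReal.div_eq_inv_mul]
    refine mul_le_mul_right ?_ _
    calc ∫⁻ z in B, ∫⁻ x in K, ENNReal.ofReal ((φ x - φ z) ^ 2)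
        ≤ ∫⁻ z in B, ∫⁻ x in K,
          ENNReal.ofReal (h ^ 2) * ∫⁻ s in Set.Ioc (0 : ℝ) 1, F (z + s • (x - z)) := by
          refine setLIntegral_mono_ae' measurableSet_ball (ae_of_all _ fun z hz => ?_)
          exact setLIntegral_mono_ae' hK (ae_of_all _ fun x hx => hpt z hz x hx)
      _ = ENNReal.ofReal (h ^ 2) *
          ∫⁻ z in B, ∫⁻ x in K, ∫⁻ s in Set.Ioc (0 : ℝ) 1, F (z + s • (x - z)) := by
          rw [← lintegral_const_mul' _ _ ENNReal.ofReal_ne_top]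
          congr 1; ext z
          rw [← lintegral_const_mul' _ _ ENNReal.ofReal_ne_top]
      _ ≤ _ := mul_le_mul_right htotal _
  have hreal : ENNReal.ofReal (∫ x in K, (φ x - φ z) ^ 2) ≤
      ENNReal.ofReal ((volume.real B)⁻¹ * (h ^ 2 * (4 * (∫ x in K, G x) * volume.real K +
        4 * (∫ x in K, G x) * volume.real B))) := by
    rw [ofReal_integral_eq_lintegral_ofReal
      (integrableOn_of_continuous (by fun_prop) hb) (ae_of_all _ fun _ => sq_nonneg _)]
    refine hall.trans (le_of_eq ?_)
    have hGi : 0 ≤ ∫ x in K, G x := integral_nonneg hG0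
    have hBp : 0 < volume.real B := ENNReal.toReal_pos hBpos hBfin
    rw [ENNReal.ofReal_mul (by positivity), ENNReal.ofReal_inv_of_pos hBp, ofReal_measureReal hBfin,
      ENNReal.ofReal_mul (by positivity), ENNReal.ofReal_add (by positivity) (by positivity),
      ENNReal.ofReal_mul (by positivity), ENNReal.ofReal_mul (by positivity),
      ENNReal.ofReal_mul (by positivity), ofReal_measureReal hBfin, ofReal_measureReal hKfin, hII]
    simp
  have hBp : 0 < volume.real B := ENNReal.toReal_pos hBpos hBfin
  have hGi : 0 ≤ ∫ x in K, G x := integral_nonneg hG0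
  have := (ENNReal.ofReal_le_ofReal_iff (by positivity)).1 hreal
  refine this.trans (le_of_eq ?_)
  change _ = 4 * (1 + volume.real K / volume.real B) * (h ^ 2 * ∫ x in K, G x)
  field_simp
  ring

theorem volume_real_closedBall (c : Plane) {h : ℝ} (hh : 0 < h) :
    volume.real (Metric.closedBall c h) = h ^ 2 * volume.real (Metric.closedBall (0 : Plane) 1) := by
  have := setIntegral_closedBall (fun _ => 1) c hh
  simpa using this

theorem volume_real_ball (c : Plane) (r : ℝ) {h : ℝ} (hh : 0 < h) :
    volume.real (Metric.ball c (r * h)) = h ^ 2 * volume.real (Metric.ball (0 : Plane) r) := by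
  have := setIntegral_ball (fun _ => 1) c r hh
  simpa using this

namespace Polygon

theorem Shape.ball_subset' {K : Polygon} {c : Plane} {ρ η₁ η₂ : ℝ} (hS : K.Shape c ρ η₁ η₂) :
    Metric.ball c (η₁ * K.diam) ⊆ K.carrier :=
  (Metric.ball_subset_ball hS.ball_lt.le).trans hS.toStar.ball_subset

theorem Star.area_le {K : Polygon} {c : Plane} {ρ : ℝ} (hS : K.Star c ρ) :
    K.area ≤ K.diam ^ 2 * volume.real (Metric.closedBall (0 : Plane) 1) := by
  rw [← volume_real_closedBall c K.diam_pos]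
  exact measureReal_mono hS.subset_closedBall Metric.isBounded_closedBall.measure_lt_top.ne

theorem Shape.le_area {K : Polygon} {c : Plane} {ρ η₁ η₂ : ℝ} (hS : K.Shape c ρ η₁ η₂) :
    K.diam ^ 2 * volume.real (Metric.ball (0 : Plane) η₁) ≤ K.area := by
  rw [← volume_real_ball c η₁ K.diam_pos]
  exact measureReal_mono hS.ball_subset' K.bounded.measure_lt_top.ne

theorem volume_real_ball_pos {η : ℝ} (hη : 0 < η) : 0 < volume.real (Metric.ball (0 : Plane) η) :=
  ENNReal.toReal_pos (Metric.measure_ball_pos volume 0 hη).ne' Metric.isBounded_ball.measure_lt_top.ne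

/-- Uniform Poincaré inequality on shape regular polygons. -/
theorem exists_poincare {η₁ : ℝ} (hη₁ : 0 < η₁) : ∃ C > 0, ∀ (η₂ : ℝ) (K : Polygon) (c : Plane) (ρ : ℝ),
    K.Shape c ρ η₁ η₂ → ∀ φ : Plane → ℝ, ContDiff ℝ ∞ φ → ∃ z, ∫ x in K.carrier, (φ x - φ z) ^ 2 ≤
      C * (K.diam ^ 2 * ∫ x in K.carrier, (pd 0 φ x ^ 2 + pd 1 φ x ^ 2)) := by
  have hb := volume_real_ball_pos hη₁
  refine ⟨4 * (1 + volume.real (Metric.closedBall (0 : Plane) 1) /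
    volume.real (Metric.ball (0 : Plane) η₁)), by positivity, ?_⟩
  intro η₂ K c ρ hS φ hφ
  have hS' := hS.toStar
  have hd := K.diam_pos
  obtain ⟨z, hz⟩ := poincare K.isOpen.measurableSet hS.pos hS.star hS'.ball_subset
    (h := K.diam) (fun x hx y hy => K.dist_le_diam (subset_closure hx) (subset_closure hy))
    K.bounded hφ
  refine ⟨z, hz.trans (mul_le_mul_of_nonneg_right ?_ (mul_nonneg (by positivity)
    (integral_nonneg fun _ => by positivity)))⟩
  have h1 := hS'.area_le
  have h2 : K.diam ^ 2 * volume.real (Metric.ball (0 : Plane) η₁) ≤ volume.real (Metric.ball c ρ) := by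
    rw [← volume_real_ball c η₁ K.diam_pos]
    exact measureReal_mono (Metric.ball_subset_ball hS.ball_lt.le)
      Metric.isBounded_ball.measure_lt_top.ne
  have h3 : volume.real K.carrier / volume.real (Metric.ball c ρ) ≤
      volume.real (Metric.closedBall (0 : Plane) 1) / volume.real (Metric.ball (0 : Plane) η₁) := by
    refine (div_le_div₀ (by positivity) h1 (by positivity) h2).trans (le_of_eq ?_)
    field_simp
  linarith

end Polygon

/-! ### Approximation of curl-free fields by gradients of test functions -/

/-- The potential is the line integral from the star centre. Smoothness of its derivative, which is
the given form, makes it smooth. -/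
theorem star_potential {v₀ v₁ : Plane → ℝ} (h₀ : ContDiff ℝ ∞ v₀) (h₁ : ContDiff ℝ ∞ v₁)
    {U : Set Plane} (hU : IsOpen U) {c : Plane} (hc : StarConvex ℝ c U)
    (hcurl : ∀ x ∈ U, pd 0 v₁ x = pd 1 v₀ x) :
    ∃ ψ : Plane → ℝ, ContDiffOn ℝ ∞ ψ U ∧ ∀ x ∈ U, pd 0 ψ x = v₀ x ∧ pd 1 ψ x = v₁ x := by
  let p₀ : Plane →L[ℝ] ℝ := EuclideanSpace.proj 0
  let p₁ : Plane →L[ℝ] ℝ := EuclideanSpace.proj 1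
  let om : Plane → Plane →L[ℝ] ℝ := fun x => v₀ x • p₀ + v₁ x • p₁
  have hom : ContDiff ℝ ∞ om := (h₀.smul contDiff_const).add (h₁.smul contDiff_const)
  have hdom (a : Plane) : HasFDerivAt om
      ((fderiv ℝ v₀ a).smulRight p₀ + (fderiv ℝ v₁ a).smulRight p₁) a :=
    ((diffAt_of_contDiff h₀ a).hasFDerivAt.smul_const p₀).add
      ((diffAt_of_contDiff h₁ a).hasFDerivAt.smul_const p₁)
  let ψ : Plane → ℝ := fun b => curveIntegral om (Path.segment c b)
  have hψ (b : Plane) (hb : b ∈ U) : HasFDerivAt ψ (om b) b := by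
    obtain ⟨r, hr, hrU⟩ := Metric.isOpen_iff.1 hU b hb
    -- Near `b` only the hull of `c` and a small ball matters; it stays in `U` by star-shapedness,
    -- and the Poincaré lemma for convex sets applies on it.
    have hsub : convexHull ℝ (insert c (Metric.ball b r)) ⊆ U := by
      rw [convexHull_insert ⟨b, Metric.mem_ball_self hr⟩, (convex_ball b r).convexHull_eq,
        convexJoin_singleton_left]
      exact Set.iUnion₂_subset fun z hz => starConvex_iff_segment_subset.1 hc (hrU hz)
    have hbs : Metric.ball b r ⊆ convexHull ℝ (insert c (Metric.ball b r)) :=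
      (Set.subset_insert _ _).trans (subset_convexHull ℝ _)
    have := (convex_convexHull ℝ (insert c
      (Metric.ball b r))).hasFDerivWithinAt_curveIntegral_segment_of_hasFDerivWithinAt_symmetric
      (fun x _ => (hdom x).hasFDerivWithinAt) (fun a ha x _ y _ => by
        have h := hcurl a (hsub ha)
        have e₀ (z : Plane) : p₀ z = z 0 := rfl
        have e₁ (z : Plane) : p₁ z = z 1 := rfl
        simp only [add_apply, ContinuousLinearMap.smulRight_apply,
          smul_apply, smul_eq_mul, fderiv_eq_pd, e₀, e₁, h]
        ring) (subset_convexHull ℝ _ (Set.mem_insert _ _)) (hbs (Metric.mem_ball_self hr))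
    exact this.hasFDerivAt (Filter.mem_of_superset (Metric.ball_mem_nhds b hr) hbs)
  refine ⟨ψ, (contDiffOn_infty_iff_fderiv_of_isOpen hU).2
    ⟨fun x hx => (hψ x hx).differentiableAt.differentiableWithinAt, ?_⟩, fun x hx => ?_⟩
  · exact hom.contDiffOn.congr fun x hx => (hψ x hx).fderiv
  · rw [pd, pd, (hψ x hx).fderiv]
    simp [om, p₀, p₁]

/-- Mollification of `f` by a normed bump function. -/
def moll (b : ContDiffBump (0 : Plane)) (f : Plane → ℝ) : Plane → ℝ :=
  convolution (b.normed volume) f (ContinuousLinearMap.lsmul ℝ ℝ) volume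

theorem moll_apply (b : ContDiffBump (0 : Plane)) (f : Plane → ℝ) (y : Plane) :
    moll b f y = ∫ u, b.normed volume u * f (y - u) := rfl

theorem contDiff_moll (b : ContDiffBump (0 : Plane)) {f : Plane → ℝ} (hf : LocallyIntegrable f) :
    ContDiff ℝ ∞ (moll b f) :=
  b.hasCompactSupport_normed.contDiff_convolution_left _ b.contDiff_normed hf

theorem isTest_normed (b : ContDiffBump (0 : Plane)) : IsTest (b.normed volume) :=
  ⟨b.contDiff_normed, b.hasCompactSupport_normed⟩

theorem memLp_comp_sub {f : Plane → ℝ} (hf : MemLp f 2 volume) (y : Plane) :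
    MemLp (fun u => f (y - u)) 2 volume :=
  hf.comp_measurePreserving (Measure.measurePreserving_sub_left volume y)

/-- Jensen's inequality for the probability density `m`, obtained from Cauchy–Schwarz by splitting
`m f = √m (√m f)`. -/
theorem moll_sq_le (b : ContDiffBump (0 : Plane)) {f : Plane → ℝ} (hf : MemLp f 2 volume)
    (y : Plane) : moll b f y ^ 2 ≤ moll b (fun x => f x ^ 2) y := by
  set m := b.normed volume with hm
  have hm0 (u) : 0 ≤ m u := b.nonneg_normed u
  have hmc : Continuous m := (isTest_normed b).1.continuous
  have hsc : Continuous fun u => √(m u) := by fun_prop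
  have hss : HasCompactSupport fun u => √(m u) :=
    (isTest_normed b).2.comp_left (g := Real.sqrt) Real.sqrt_zero
  have h1 : MemLp (fun u => √(m u)) 2 volume := hsc.memLp_of_hasCompactSupport hss
  have h2 : MemLp (fun u => √(m u) * f (y - u)) 2 volume :=
    (memLp_comp_sub hf y).mul (hsc.memLp_of_hasCompactSupport (p := ⊤) hss)
  have h3 := sq_integral_mul_le h1 h2
  have e1 : ∫ u, √(m u) * (√(m u) * f (y - u)) = moll b f y := by
    rw [moll_apply]
    congr 1; ext u
    rw [← mul_assoc, Real.mul_self_sqrt (hm0 u)]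
  have e2 : ∫ u, √(m u) ^ 2 = 1 := by
    simp_rw [fun u => Real.sq_sqrt (hm0 u)]
    exact b.integral_normed
  have e3 : ∫ u, (√(m u) * f (y - u)) ^ 2 = moll b (fun x => f x ^ 2) y := by
    rw [moll_apply]
    congr 1; ext u
    rw [mul_pow, Real.sq_sqrt (hm0 u)]
  rwa [e1, e2, e3, one_mul] at h3

theorem integrable_moll_sq (b : ContDiffBump (0 : Plane)) {f : Plane → ℝ} (hf : MemLp f 2 volume) :
    Integrable (fun y => moll b f y ^ 2) ∧ ∫ y, moll b f y ^ 2 ≤ ∫ x, f x ^ 2 := by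
  have hb : Integrable (b.normed volume) volume :=
    (isTest_normed b).1.continuous.integrable_of_hasCompactSupport (isTest_normed b).2
  have h1 : Integrable (moll b fun x => f x ^ 2) :=
    hb.integrable_convolution _ hf.integrable_sq
  have h2 : ∫ y, moll b (fun x => f x ^ 2) y = ∫ x, f x ^ 2 := by
    have := integral_convolution (ContinuousLinearMap.lsmul ℝ ℝ : ℝ →L[ℝ] ℝ →L[ℝ] ℝ)
      hb hf.integrable_sq
    rw [b.integral_normed] at this
    simpa [moll] using this
  have hc := (contDiff_moll b (hf.locallyIntegrable (by norm_num))).continuous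
  have h3 : Integrable fun y => moll b f y ^ 2 :=
    h1.mono' (hc.pow 2).aestronglyMeasurable (ae_of_all _ fun y => by
      rw [Real.norm_of_nonneg (sq_nonneg _)]; exact moll_sq_le b hf y)
  exact ⟨h3, (integral_mono h3 h1 fun y => moll_sq_le b hf y).trans_eq h2⟩

theorem moll_sub (b : ContDiffBump (0 : Plane)) {f g : Plane → ℝ} (hf : MemLp f 2 volume)
    (hg : MemLp g 2 volume) (y : Plane) :
    moll b (fun x => f x - g x) y = moll b f y - moll b g y := by
  have hm := (isTest_normed b).memLp
  have h1 : Integrable fun u => b.normed volume u * f (y - u) :=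
    hm.integrable_mul (memLp_comp_sub hf y)
  have h2 : Integrable fun u => b.normed volume u * g (y - u) :=
    hm.integrable_mul (memLp_comp_sub hg y)
  rw [moll_apply, moll_apply, moll_apply, ← integral_sub h1 h2]
  simp_rw [mul_sub]

/-- Contracting towards `c` and mollifying is bounded in `L²` uniformly in small `δ`, so `W` may be
exchanged for a continuous compactly supported `g`. For `g`, uniform continuity handles both the
contraction and the mollification. -/
theorem exists_moll_approx {K : Set Plane} (hK : MeasurableSet K) {c : Plane} {R ρ : ℝ}
    (hKR : K ⊆ Metric.closedBall c R) (hρ : 0 < ρ) (hR : 0 < R)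
    {W : Plane → ℝ} (hW : MemLp W 2 volume) {ε : ℝ} (hε : 0 < ε) :
    ∃ δ₀ > 0, ∀ δ, 0 < δ → δ ≤ δ₀ → ∀ b : ContDiffBump (0 : Plane), b.rOut ≤ δ * ρ →
      ∫ x in K, (moll b W (δ • c + (1 - δ) • x) - W x) ^ 2 ≤ ε := by
  have hKb : Bornology.IsBounded K := Metric.isBounded_closedBall.subset hKR
  -- The budget is `12/30 + 15/30 + 3/30` of `ε`: a factor `3` from splitting into three terms, a
  -- factor `4` from the contraction with `δ ≤ 1 / 2`, and the middle share from the choice of `η`.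
  obtain ⟨g, hgs, hgε, hgc, hgm⟩ := MemLp.exists_hasCompactSupport_integral_rpow_sub_le
    (p := 2) two_pos (by simpa using hW) (show 0 < ε / 30 by positivity)
  have hgm' : MemLp g 2 volume := hgc.memLp_of_hasCompactSupport hgs
  have hA : ∫ x, (W x - g x) ^ 2 ≤ ε / 30 := by
    simpa using hgε
  have hd : MemLp (fun x => W x - g x) 2 volume := hW.sub hgm'
  set V := volume.real K with hV
  have hV0 : 0 ≤ V := measureReal_nonneg
  set η := √(ε / (24 * (V + 1))) with hη
  have hηpos : 0 < η := Real.sqrt_pos.2 (by positivity)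
  have hη2 : η ^ 2 = ε / (24 * (V + 1)) := Real.sq_sqrt (by positivity)
  obtain ⟨κ, hκ, hκg⟩ := Metric.uniformContinuous_iff.1
    (hgs.uniformContinuous_of_continuous hgc) η hηpos
  refine ⟨min (1 / 2) (min (κ / (2 * ρ)) (κ / (2 * R))), by positivity, fun δ hδ hδ' b hb => ?_⟩
  have hδ1 : δ ≤ 1 / 2 := hδ'.trans (min_le_left _ _)
  have hδρ : δ * ρ < κ := by
    have : δ ≤ κ / (2 * ρ) := hδ'.trans ((min_le_right _ _).trans (min_le_left _ _))
    rw [le_div_iff₀ (by positivity)] at this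
    nlinarith
  have hδR : δ * R < κ := by
    have : δ ≤ κ / (2 * R) := hδ'.trans ((min_le_right _ _).trans (min_le_right _ _))
    rw [le_div_iff₀ (by positivity)] at this
    nlinarith
  let q : Plane → Plane := fun x => δ • c + (1 - δ) • x
  obtain ⟨hi1, hle1⟩ := integrable_moll_sq b hd
  have hδ2 : 0 < 1 - δ := by linarith
  have hmc := (contDiff_moll b (hd.locallyIntegrable (by norm_num))).continuous
  have hI1 : Integrable fun x => moll b (fun x => W x - g x) (q x) ^ 2 := by
    have h1 : Integrable fun x => (fun y => moll b (fun x => W x - g x) (δ • c + y) ^ 2) x :=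
      hi1.comp_add_left (δ • c)
    exact (integrable_comp_smul_iff volume _ hδ2.ne').2 h1
  have hT1 : ∫ x in K, moll b (fun x => W x - g x) (q x) ^ 2 ≤ 4 * (ε / 30) := by
    refine (setIntegral_le_integral hI1 (ae_of_all _ fun _ => sq_nonneg _)).trans ?_
    have h1 := integral_scale (fun y => moll b (fun x => W x - g x) y ^ 2) (δ • c) hδ2
    have h2 : (1 - δ) ^ 2 * ∫ x, moll b (fun x => W x - g x) (q x) ^ 2 ≤ ε / 30 :=
      h1.symm.le.trans (hle1.trans hA)
    have h3 : (1 : ℝ) / 4 ≤ (1 - δ) ^ 2 := by nlinarith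
    have h4 : 0 ≤ ∫ x, moll b (fun x => W x - g x) (q x) ^ 2 := integral_nonneg fun _ => sq_nonneg _
    nlinarith
  have hT3 : ∫ x in K, (W x - g x) ^ 2 ≤ ε / 30 :=
    (setIntegral_le_integral hd.integrable_sq (ae_of_all _ fun _ => sq_nonneg _)).trans hA
  have hpt (x : Plane) (hx : x ∈ K) : (moll b g (q x) - g x) ^ 2 ≤ 4 * η ^ 2 := by
    have h1 : dist (moll b g (q x)) (g (q x)) ≤ η :=
      b.dist_normed_convolution_le hgc.aestronglyMeasurable fun y hy =>
        (hκg (lt_trans (lt_of_lt_of_le hy hb) hδρ)).le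
    have h2 : dist (g (q x)) (g x) ≤ η := by
      refine (hκg (lt_of_le_of_lt ?_ hδR)).le
      rw [dist_eq_norm, show q x - x = δ • (c - x) by simp only [q]; module, norm_smul,
        Real.norm_of_nonneg hδ.le, ← dist_eq_norm, dist_comm]
      exact mul_le_mul_of_nonneg_left (hKR hx) hδ.le
    have h3 := (dist_triangle _ _ _).trans (add_le_add h1 h2)
    rw [Real.dist_eq] at h3
    calc (moll b g (q x) - g x) ^ 2 = |moll b g (q x) - g x| ^ 2 := (sq_abs _).symm
      _ ≤ (η + η) ^ 2 := pow_le_pow_left₀ (abs_nonneg _) h3 2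
      _ = 4 * η ^ 2 := by ring
  have hKfin : IsFiniteMeasure ((volume : Measure Plane).restrict K) :=
    ⟨by simpa using hKb.measure_lt_top⟩
  calc ∫ x in K, (moll b W (q x) - W x) ^ 2
      ≤ ∫ x in K, (3 * moll b (fun x => W x - g x) (q x) ^ 2 + 3 * (4 * η ^ 2) +
          3 * (W x - g x) ^ 2) := by
        refine integral_mono_of_nonneg (ae_of_all _ fun _ => sq_nonneg _)
          (((hI1.integrableOn.const_mul 3).add (integrable_const _)).add
            (hd.integrable_sq.integrableOn.const_mul 3)) ?_
        filter_upwards [ae_restrict_mem hK] with x hx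
        have h1 := hpt x hx
        rw [moll_sub b hW hgm']
        nlinarith [sq_nonneg ((moll b W (q x) - moll b g (q x)) - (moll b g (q x) - g x)),
          sq_nonneg ((moll b W (q x) - moll b g (q x)) + (W x - g x)),
          sq_nonneg ((moll b g (q x) - g x) + (W x - g x))]
    _ = 3 * (∫ x in K, moll b (fun x => W x - g x) (q x) ^ 2) + 3 * (4 * η ^ 2) * V +
          3 * ∫ x in K, (W x - g x) ^ 2 := by
        have i1 : Integrable (fun x => 3 * moll b (fun x => W x - g x) (q x) ^ 2)
          (volume.restrict K) := hI1.integrableOn.const_mul 3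
        have i2 : Integrable (fun x => 3 * moll b (fun x => W x - g x) (q x) ^ 2 +
          3 * (4 * η ^ 2)) (volume.restrict K) := i1.add (integrable_const _)
        have i3 : Integrable (fun x => 3 * (W x - g x) ^ 2) (volume.restrict K) :=
          hd.integrable_sq.integrableOn.const_mul 3
        rw [integral_add i2 i3, integral_add i1 (integrable_const _), integral_const,
          integral_const_mul, integral_const_mul]
        simp only [hV, measureReal_restrict_apply_univ, smul_eq_mul]
        ring
    _ ≤ 3 * (4 * (ε / 30)) + ε / 2 + 3 * (ε / 30) := by
        have h5 : 3 * (4 * η ^ 2) * V ≤ ε / 2 := by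
          rw [hη2]
          have : 3 * (4 * (ε / (24 * (V + 1)))) * V = ε / 2 * (V / (V + 1)) := by
            field_simp; ring
          rw [this]
          exact mul_le_of_le_one_right (by positivity) (by rw [div_le_one (by positivity)]; linarith)
        linarith
    _ ≤ ε := by linarith

theorem pd_comp_sub_left {m : Plane → ℝ} (hm : ContDiff ℝ ∞ m) (j : Fin 2) (y x : Plane) :
    pd j (fun x => m (y - x)) x = - pd j m (y - x) := by
  have h1 : HasFDerivAt (fun x : Plane => y - x) (-ContinuousLinearMap.id ℝ Plane) x := by
    simpa using (hasFDerivAt_id x).const_sub y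
  have h2 := (diffAt_of_contDiff hm (y - x)).hasFDerivAt.comp x h1
  rw [pd, show (fun x => m (y - x)) = m ∘ fun x => y - x from rfl, h2.fderiv]
  simp [pd]

/-- The derivative is moved onto the translated kernel, so that a weak curl condition can be applied
with that kernel as test function. -/
theorem pd_moll (b : ContDiffBump (0 : Plane)) {f : Plane → ℝ} (hf : LocallyIntegrable f)
    (j : Fin 2) (y : Plane) :
    pd j (moll b f) y = - ∫ x, f x * pd j (fun x => b.normed volume (y - x)) x := by
  have hm := isTest_normed b
  have h1 := b.hasCompactSupport_normed.hasFDerivAt_convolution_left (μ := volume)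
    (ContinuousLinearMap.lsmul ℝ ℝ) (hm.1.of_le (by simp)) hf y
  have h2 : ConvolutionExistsAt (fderiv ℝ (b.normed volume)) f y
      (ContinuousLinearMap.precompL Plane (ContinuousLinearMap.lsmul ℝ ℝ)) volume :=
    (b.hasCompactSupport_normed.fderiv ℝ).convolutionExists_left _
      (hm.1.continuous_fderiv (by simp)) hf y
  rw [pd, moll, h1.fderiv, convolution,
    ← ContinuousLinearMap.apply_apply (EuclideanSpace.single j 1),
    ← ContinuousLinearMap.integral_comp_comm _ h2, ← integral_neg,
    ← integral_sub_left_eq_self (fun x => _) volume y]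
  simp_rw [pd_comp_sub_left hm.1]
  congr 1
  ext u
  simp [ContinuousLinearMap.precompL_apply, pd, mul_comm]

theorem isTest_comp_sub_left {m : Plane → ℝ} (hm : IsTest m) (y : Plane) :
    IsTest fun x => m (y - x) :=
  ⟨hm.1.comp (contDiff_const.sub contDiff_id),
    hm.2.comp_homeomorph (Homeomorph.subLeft y)⟩

theorem tsupport_comp_sub_left (b : ContDiffBump (0 : Plane)) (y : Plane) :
    tsupport (fun x => b.normed volume (y - x)) ⊆ Metric.closedBall y b.rOut := by
  refine closure_minimal (fun x hx => ?_) Metric.isClosed_closedBall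
  have h1 : y - x ∈ Function.support (b.normed volume) := hx
  rw [b.support_normed_eq, mem_ball_zero_iff] at h1
  rw [Metric.mem_closedBall, dist_comm, dist_eq_norm]
  exact h1.le

/-- Contraction towards the star centre before mollifying keeps the kernel inside `K` even for
points slightly outside `K`. The regularised field is therefore curl-free on a star-shaped
neighbourhood of `closure K`, has a potential there, and the potential can be cut off to a test
function. -/
theorem exists_test_approx {K : Set Plane} (hKo : IsOpen K) {c : Plane} {R ρ : ℝ}
    (hKR : K ⊆ Metric.closedBall c R) (hρ : 0 < ρ) (hR : 0 < R)
    (hstar : ∀ y ∈ Metric.ball c ρ, StarConvex ℝ y K)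
    {w : Fin 2 → Plane → ℝ} (hw : ∀ j, MemLp (w j) 2 (volume.restrict K))
    (hcurl : ∀ φ, IsTest φ → tsupport φ ⊆ K →
      ∫ x in K, (w 1 x * pd 0 φ x - w 0 x * pd 1 φ x) = 0) {ε : ℝ} (hε : 0 < ε) :
    ∃ φ, IsTest φ ∧ ∀ j, ∫ x in K, (pd j φ x - w j x) ^ 2 ≤ ε := by
  have hKm := hKo.measurableSet
  have hKb : Bornology.IsBounded K := Metric.isBounded_closedBall.subset hKR
  let W : Fin 2 → Plane → ℝ := fun j => K.indicator (w j)
  have hW (j) : MemLp (W j) 2 volume := (memLp_indicator_iff_restrict hKm).2 (hw j)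
  have hWl (j) : LocallyIntegrable (W j) := (hW j).locallyIntegrable (by norm_num)
  choose δ₀ hδ₀ hδ using fun j => exists_moll_approx hKm hKR hρ hR (hW j)
    hε
  obtain ⟨δ, hδp, hδa, hδb, hδ2⟩ : ∃ δ > 0, δ ≤ δ₀ 0 ∧ δ ≤ δ₀ 1 ∧ δ ≤ 1 / 2 :=
    ⟨min (min (δ₀ 0) (δ₀ 1)) (1 / 2), lt_min (lt_min (hδ₀ 0) (hδ₀ 1)) (by norm_num),
      (min_le_left _ _).trans (min_le_left _ _), (min_le_left _ _).trans (min_le_right _ _),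
      min_le_right _ _⟩
  let b : ContDiffBump (0 : Plane) := ⟨δ * ρ / 4, δ * ρ / 2, by positivity, by
    have : 0 < δ * ρ := by positivity
    linarith⟩
  have hbr : b.rOut = δ * ρ / 2 := rfl
  have hbρ : b.rOut ≤ δ * ρ := by
    have : 0 < δ * ρ := by positivity
    rw [hbr]; linarith
  let q : Plane → Plane := fun x => δ • c + (1 - δ) • x
  let v : Fin 2 → Plane → ℝ := fun j x => moll b (W j) (q x)
  have hmc (j) : ContDiff ℝ ∞ (moll b (W j)) := contDiff_moll b (hWl j)
  have hv (j) : ContDiff ℝ ∞ (v j) :=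
    (hmc j).comp (contDiff_const.add (contDiff_id.const_smul _))
  let U := Metric.thickening (δ * ρ / 4) K
  have hUq (x) (hx : x ∈ U) : Metric.closedBall (q x) (δ * ρ / 2) ⊆ K := by
    obtain ⟨z, hz, hxz⟩ := Metric.mem_thickening_iff.1 hx
    intro y hy
    rw [Metric.mem_closedBall, dist_eq_norm] at hy
    rw [dist_eq_norm] at hxz
    -- Writes `y` as `δ c' + (1 - δ) z`: the slack `δ ρ` in the choice of `c'` covers the
    -- mollification radius `δ ρ / 2` and the thickening `δ ρ / 4`.
    have hc' : c + δ⁻¹ • ((y - q x) + (1 - δ) • (x - z)) ∈ Metric.ball c ρ := by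
      rw [Metric.mem_ball, dist_eq_norm, add_sub_cancel_left, norm_smul, norm_inv,
        Real.norm_of_nonneg hδp.le, inv_mul_lt_iff₀ hδp]
      refine (norm_add_le _ _).trans_lt ?_
      rw [norm_smul, Real.norm_of_nonneg (by linarith)]
      have : (1 - δ) * ‖x - z‖ ≤ 1 * ‖x - z‖ :=
        mul_le_mul_of_nonneg_right (by linarith) (norm_nonneg _)
      have : 0 < δ * ρ := by positivity
      linarith
    have h := hstar _ hc' hz hδp.le (show 0 ≤ 1 - δ by linarith) (by ring)
    convert h using 1
    rw [smul_add, smul_smul, mul_inv_cancel₀ hδp.ne']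
    simp only [q]
    module
  have hUs : StarConvex ℝ c U := by
    intro x hx a s ha hs has
    obtain ⟨z, hz, hxz⟩ := Metric.mem_thickening_iff.1 hx
    refine Metric.mem_thickening_iff.2
      ⟨a • c + s • z, hstar c (Metric.mem_ball_self hρ) hz ha hs has, ?_⟩
    rw [dist_add_left, dist_smul₀, Real.norm_of_nonneg hs]
    exact (mul_le_of_le_one_left dist_nonneg (by linarith)).trans_lt hxz
  -- The translated kernel is supported in `K`, hence admissible in `hcurl`; the inner derivative `1
  -- - δ` is the same on both sides.
  have hUc (x) (hx : x ∈ U) : pd 0 (v 1) x = pd 1 (v 0) x := by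
    rw [pd_scale (hmc 1), pd_scale (hmc 0), pd_moll b (hWl 1), pd_moll b (hWl 0)]
    set y := δ • c + (1 - δ) • x with hy
    have ht := isTest_comp_sub_left (isTest_normed b) y
    have h := hcurl _ ht ((tsupport_comp_sub_left b y).trans (hUq x hx))
    have e (i j : Fin 2) : ∫ x, W i x * pd j (fun x => b.normed volume (y - x)) x =
        ∫ x in K, w i x * pd j (fun x => b.normed volume (y - x)) x := by
      rw [← integral_indicator hKm]
      congr 1; ext x
      by_cases hx : x ∈ K <;> simp [W, hx]
    have i1 : Integrable (fun x => w 1 x * pd 0 (fun x => b.normed volume (y - x)) x)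
        (volume.restrict K) := (hw 1).integrable_mul ((ht.memLp_pd 0).restrict K)
    have i2 : Integrable (fun x => w 0 x * pd 1 (fun x => b.normed volume (y - x)) x)
        (volume.restrict K) := (hw 0).integrable_mul ((ht.memLp_pd 1).restrict K)
    rw [integral_sub i1 i2] at h
    rw [e, e, sub_eq_zero.1 h]
  obtain ⟨ψ, hψ, hψd⟩ := star_potential (hv 0) (hv 1) Metric.isOpen_thickening hUs hUc
  obtain ⟨φ, hφ, hφψ⟩ := exists_isTest_eqOn hKb Metric.isOpen_thickening
    (Metric.closure_subset_thickening (show 0 < δ * ρ / 4 by positivity) K) hψ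
  refine ⟨φ, hφ, fun j => ?_⟩
  have hle : ∫ x in K, (v j x - W j x) ^ 2 ≤ ε := by
    fin_cases j
    · exact hδ 0 δ hδp hδa b hbρ
    · exact hδ 1 δ hδp hδb b hbρ
  refine le_trans (le_of_eq (setIntegral_congr_fun hKm fun x hx => ?_))
    hle
  have hxU : x ∈ U := Metric.self_subset_thickening (by positivity) K hx
  simp only [W, Set.indicator_of_mem hx]
  rw [pd_congr (hφψ x (subset_closure hx))]
  fin_cases j
  · simp [(hψd x hxU).1]
  · simp [(hψd x hxU).2]

/-! ### Coercivity on fields orthogonal to polynomials -/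

namespace Polygon

theorem edgePoint_mem_closure (K : Polygon) (e : Fin (K.m + 3)) {s : ℝ}
    (hs : s ∈ Set.Icc (-1 / 2 : ℝ) (1 / 2)) : K.edgePoint e s ∈ closure K.carrier :=
  frontier_subset_closure (K.segment_subset e (Star.edgePoint_mem_segment e hs))

theorem continuous_edgePoint (K : Polygon) (e : Fin (K.m + 3)) : Continuous (K.edgePoint e) := by
  unfold edgePoint
  fun_prop

theorem edgeLength_le_diam (K : Polygon) (e : Fin (K.m + 3)) : K.edgeLength e ≤ K.diam :=
  K.dist_le_diam (frontier_subset_closure (K.vert_mem _)) (frontier_subset_closure (K.vert_mem _))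

/-- Only values near the closure of the bounded element matter, so compact support can be dropped.
This admits polynomials and functions shifted by a constant. -/
theorem RowGreen.of_contDiff {K : Polygon} {t : Fin 2 → Plane → ℝ} {d : Plane → ℝ}
    {g : Fin (K.m + 3) → Polynomial ℝ} (hG : K.RowGreen t d g) {φ : Plane → ℝ}
    (hφ : ContDiff ℝ ∞ φ) :
    ∫ x in K.carrier, ((∑ j, t j x * pd j φ x) + d x * φ x) =
      ∑ e, K.edgeLength e *
        ∫ s in (-1 / 2 : ℝ)..(1 / 2), (g e).eval s * φ (K.edgePoint e s) := by
  obtain ⟨φ', hφ', heq⟩ := exists_isTest_eqOn K.bounded isOpen_univ (Set.subset_univ _)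
    hφ.contDiffOn
  have h := hG φ' hφ'
  have e1 : ∫ x in K.carrier, ((∑ j, t j x * pd j φ' x) + d x * φ' x) =
      ∫ x in K.carrier, ((∑ j, t j x * pd j φ x) + d x * φ x) :=
    setIntegral_congr_fun K.isOpen.measurableSet fun x hx => by
      have h1 := heq x (subset_closure hx)
      simp only [fun j => pd_congr h1 j, h1.eq_of_nhds]
  rw [← e1, h]
  refine Finset.sum_congr rfl fun e _ => ?_
  congr 1
  refine intervalIntegral.integral_congr fun s hs => ?_
  rw [Set.uIcc_of_le (by norm_num)] at hs
  simp only [(heq _ (K.edgePoint_mem_closure e hs)).eq_of_nhds]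

/-- Cauchy–Schwarz on the boundary of a polygon. -/
theorem sq_sum_edge_le (K : Polygon) {u w : Fin (K.m + 3) → ℝ → ℝ} (hu : ∀ e, Continuous (u e))
    (hw : ∀ e, Continuous (w e)) :
    (∑ e, K.edgeLength e * ∫ s in (-1 / 2 : ℝ)..(1 / 2), u e s * w e s) ^ 2 ≤
      (∑ e, K.edgeLength e * ∫ s in (-1 / 2 : ℝ)..(1 / 2), u e s ^ 2) *
        ∑ e, K.edgeLength e * ∫ s in (-1 / 2 : ℝ)..(1 / 2), w e s ^ 2 := by
  refine Finset.sum_sq_le_sum_mul_sum_of_sq_le_mul _ (fun e _ => ?_) (fun e _ => ?_) fun e _ => ?_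
  · exact mul_nonneg (K.edgeLength_pos e).le
      (intervalIntegral.integral_nonneg (by norm_num) fun _ _ => sq_nonneg _)
  · exact mul_nonneg (K.edgeLength_pos e).le
      (intervalIntegral.integral_nonneg (by norm_num) fun _ _ => sq_nonneg _)
  · have h := sq_integral_mul_le (memLp_Ioc (hu e) (-1 / 2) (1 / 2))
      (memLp_Ioc (hw e) (-1 / 2) (1 / 2))
    simp only [← intervalIntegral.integral_of_le (show (-1 / 2 : ℝ) ≤ 1 / 2 by norm_num)] at h
    calc _ = K.edgeLength e ^ 2 * (∫ s in (-1 / 2 : ℝ)..(1 / 2), u e s * w e s) ^ 2 := by ring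
      _ ≤ K.edgeLength e ^ 2 * _ := mul_le_mul_of_nonneg_left h (sq_nonneg _)
      _ = _ := by ring

end Polygon

theorem integral_mul_pd_eq_neg {p φ : Plane → ℝ} (hp : ContDiff ℝ ∞ p) (hφ : IsTest φ)
    (j : Fin 2) : ∫ x, p x * pd j φ x = - ∫ x, pd j p x * φ x := by
  have hc := hφ.1.continuous
  have hpc := hp.continuous
  have hpd := (contDiff_pd hp j).continuous
  refine integral_mul_fderiv_eq_neg_fderiv_mul_of_integrable ?_ ?_ ?_
    (fun x _ => diffAt_of_contDiff hp x) (fun x _ => diffAt_of_contDiff hφ.1 x)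
  · exact (hpd.mul hc).integrable_of_hasCompactSupport hφ.2.mul_left
  · exact (hpc.mul (hφ.continuous_pd j)).integrable_of_hasCompactSupport
      (hasCompactSupport_pd hφ.2 j).mul_left
  · exact (hpc.mul hc).integrable_of_hasCompactSupport hφ.2.mul_left

theorem pd_eq_zero_of_notMem_tsupport {φ : Plane → ℝ} {x : Plane} (hx : x ∉ tsupport φ)
    (j : Fin 2) : pd j φ x = 0 := by
  rw [pd_congr (g := fun _ => 0) (notMem_tsupport_iff_eventuallyEq.1 hx) j, pd_const]

theorem setIntegral_mul_pd_eq_neg {p φ : Plane → ℝ} (hp : ContDiff ℝ ∞ p) (hφ : IsTest φ)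
    {U : Set Plane} (hU : tsupport φ ⊆ U) (j : Fin 2) :
    ∫ x in U, p x * pd j φ x = - ∫ x in U, pd j p x * φ x := by
  rw [setIntegral_eq_integral_of_forall_compl_eq_zero fun x hx => by
      rw [pd_eq_zero_of_notMem_tsupport (fun h => hx (hU h)), mul_zero],
    setIntegral_eq_integral_of_forall_compl_eq_zero fun x hx => by
      rw [image_eq_zero_of_notMem_tsupport (fun h => hx (hU h)), mul_zero],
    integral_mul_pd_eq_neg hp hφ j]

theorem integral_sum_mul {t q : Fin 2 → Plane → ℝ} {μ : Measure Plane}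
    (ht : ∀ j, MemLp (t j) 2 μ) (hq : ∀ j, MemLp (q j) 2 μ) :
    Integrable (fun x => ∑ j, t j x * q j x) μ ∧
      ∫ x, ∑ j, t j x * q j x ∂μ = ∑ j, ∫ x, t j x * q j x ∂μ := by
  have h (j) : Integrable (fun x => t j x * q j x) μ := (ht j).integrable_mul (hq j)
  exact ⟨integrable_finsetSum _ fun j _ => h j, integral_finsetSum _ fun j _ => h j⟩

theorem sq_sum_integral_mul_le {t q : Fin 2 → Plane → ℝ} {μ : Measure Plane}
    (ht : ∀ j, MemLp (t j) 2 μ) (hq : ∀ j, MemLp (q j) 2 μ) :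
    (∑ j, ∫ x, t j x * q j x ∂μ) ^ 2 ≤ (∑ j, ∫ x, t j x ^ 2 ∂μ) * ∑ j, ∫ x, q j x ^ 2 ∂μ :=
  Finset.sum_sq_le_sum_mul_sum_of_sq_le_mul _
    (fun _ _ => integral_nonneg fun _ => sq_nonneg _)
    (fun _ _ => integral_nonneg fun _ => sq_nonneg _)
    fun j _ => sq_integral_mul_le (ht j) (hq j)

theorem integral_sq_sub_le {f g : Plane → ℝ} {μ : Measure Plane} (hf : MemLp f 2 μ)
    (hg : MemLp g 2 μ) :
    ∫ x, (f x - g x) ^ 2 ∂μ ≤ 2 * (∫ x, f x ^ 2 ∂μ) + 2 * ∫ x, g x ^ 2 ∂μ := by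
  rw [← integral_const_mul, ← integral_const_mul,
    ← integral_add (hf.integrable_sq.const_mul 2) (hg.integrable_sq.const_mul 2)]
  refine integral_mono (hf.sub hg).integrable_sq
    ((hf.integrable_sq.const_mul 2).add (hg.integrable_sq.const_mul 2)) fun x => ?_
  simp only
  nlinarith [sq_nonneg (f x + g x)]

namespace Polygon

/-- A field orthogonal to polynomials has a divergence controlled by its normal trace. -/
theorem div_le_trace (k : ℕ) {η₁ : ℝ} (hη₁ : 0 < η₁) :
    ∃ C > 0, ∀ (η₂ : ℝ) (K : Polygon) (c : Plane) (ρ : ℝ), K.Shape c ρ η₁ η₂ →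
    ∀ (t : Fin 2 → Plane → ℝ) (d : Plane → ℝ) (g : Fin (K.m + 3) → Polynomial ℝ),
    (∀ j, MemLp (t j) 2 (volume.restrict K.carrier)) → d ∈ polyFun k → K.RowGreen t d g →
    (∀ q ∈ polyFun k, ∀ j, ∫ x in K.carrier, t j x * q x = 0) →
    K.diam * ∫ x in K.carrier, d x ^ 2 ≤
      C * ∑ e, K.edgeLength e * ∫ s in (-1 / 2 : ℝ)..(1 / 2), (g e).eval s ^ 2 := by
  obtain ⟨C₁, hC₁, H₁⟩ := inverse_grad k hη₁
  refine ⟨(3 + 2 * C₁) / η₁, by positivity, fun η₂ K c ρ hS t d g ht hd hG hq => ?_⟩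
  have hdm := memLp_polyFun hd K.bounded
  have hpm (j) := memLp_polyFun (pd_mem_polyFun hd j) K.bounded
  set Dd := ∫ x in K.carrier, d x ^ 2 with hDd
  set G := ∑ e, K.edgeLength e * ∫ s in (-1 / 2 : ℝ)..(1 / 2), (g e).eval s ^ 2 with hGd
  have hD0 : 0 ≤ Dd := integral_nonneg fun _ => sq_nonneg _
  have hG0 : 0 ≤ G := Finset.sum_nonneg fun e _ => mul_nonneg (K.edgeLength_pos e).le
    (intervalIntegral.integral_nonneg (by norm_num) fun _ _ => sq_nonneg _)
  -- Green's formula with the divergence itself as test function: `t` is orthogonal to the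
  -- polynomial `∇d`, so `‖d‖²` equals a boundary pairing.
  have h1 := hG.of_contDiff (contDiff_of_mem_polyFun hd)
  obtain ⟨hi, he⟩ := integral_sum_mul ht hpm
  have hdd : Integrable (fun x => d x * d x) (volume.restrict K.carrier) := hdm.integrable_mul hdm
  rw [integral_add hi hdd, he, Finset.sum_eq_zero fun j _ => hq _ (pd_mem_polyFun hd j) j,
    zero_add] at h1
  have h2 := K.sq_sum_edge_le (u := fun e s => (g e).eval s)
    (w := fun e s => d (K.edgePoint e s)) (fun e => (g e).continuous)
    fun e => (contDiff_of_mem_polyFun hd).continuous.comp (K.continuous_edgePoint e)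
  rw [← h1] at h2
  simp only [← pow_two] at h2
  have h3 := hS.toStar.trace_smooth (contDiff_of_mem_polyFun hd)
  have hH (j) := H₁ K.carrier c K.diam K.diam_pos K.isOpen.measurableSet hS.ball_subset'
    hS.toStar.subset_closedBall d hd j
  rw [integral_add (hpm 0).integrable_sq (hpm 1).integrable_sq] at h3
  set Tr := ∑ e, K.edgeLength e * ∫ s in (-1 / 2 : ℝ)..(1 / 2), d (K.edgePoint e s) ^ 2
  have h0 := hH 0
  have h1' := hH 1
  -- The trace inequality for `d`, with its gradient removed by the inverse inequality.
  have h4 : ρ * Tr ≤ (3 + 2 * C₁) * Dd := by linarith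
  have h5 : ρ * Dd ^ 2 ≤ G * ((3 + 2 * C₁) * Dd) := by
    calc ρ * Dd ^ 2 ≤ ρ * (G * Tr) := mul_le_mul_of_nonneg_left h2 hS.pos.le
      _ = G * (ρ * Tr) := by ring
      _ ≤ _ := mul_le_mul_of_nonneg_left h4 hG0
  have h6 : ρ * Dd ≤ (3 + 2 * C₁) * G := by
    rcases hD0.eq_or_lt with h | h
    · rw [← h, mul_zero]; positivity
    · refine le_of_mul_le_mul_right ?_ h
      linarith
  rw [div_mul_eq_mul_div, le_div_iff₀ hη₁]
  have := mul_le_mul_of_nonneg_right hS.ball_lt.le hD0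
  linarith

/-- Testing a field orthogonal to polynomials with gradients. -/
theorem pairing_grad_le (k : ℕ) {η₁ : ℝ} (hη₁ : 0 < η₁) :
    ∃ C > 0, ∀ (η₂ : ℝ) (K : Polygon) (c : Plane) (ρ : ℝ), K.Shape c ρ η₁ η₂ →
    ∀ (t : Fin 2 → Plane → ℝ) (d : Plane → ℝ) (g : Fin (K.m + 3) → Polynomial ℝ),
    (∀ j, MemLp (t j) 2 (volume.restrict K.carrier)) → d ∈ polyFun k → K.RowGreen t d g →
    (∀ q ∈ polyFun k, ∀ j, ∫ x in K.carrier, t j x * q x = 0) →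
    ∀ φ, ContDiff ℝ ∞ φ → (∑ j, ∫ x in K.carrier, t j x * pd j φ x) ^ 2 ≤
      C * (K.diam * (∑ e, K.edgeLength e * ∫ s in (-1 / 2 : ℝ)..(1 / 2), (g e).eval s ^ 2)) *
        ∑ j, ∫ x in K.carrier, pd j φ x ^ 2 := by
  obtain ⟨C₁, hC₁, H₁⟩ := div_le_trace k hη₁
  obtain ⟨C₂, hC₂, H₂⟩ := exists_poincare hη₁
  refine ⟨2 * ((3 * C₂ + 1) / η₁ + C₁ * C₂), by positivity,
    fun η₂ K c ρ hS t d g ht hd hG hq φ hφ => ?_⟩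
  obtain ⟨z, hz⟩ := H₂ η₂ K c ρ hS φ hφ
  have hD := H₁ η₂ K c ρ hS t d g ht hd hG hq
  -- Subtracting the constant from the Poincaré inequality leaves the gradient unchanged and makes
  -- the function itself of size `h ‖∇φ‖`.
  have hφ₁ : ContDiff ℝ ∞ fun x => φ x - φ z := hφ.sub contDiff_const
  have hpd (j) (x) : pd j (fun x => φ x - φ z) x = pd j φ x := by
    simp [pd, fderiv_sub_const]
  have hpm (j) : MemLp (pd j φ) 2 (volume.restrict K.carrier) :=
    memLp_of_continuous (contDiff_pd hφ j).continuous K.bounded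
  have hφm : MemLp (fun x => φ x - φ z) 2 (volume.restrict K.carrier) :=
    memLp_of_continuous hφ₁.continuous K.bounded
  have hdm := memLp_polyFun hd K.bounded
  set G := ∑ e, K.edgeLength e * ∫ s in (-1 / 2 : ℝ)..(1 / 2), (g e).eval s ^ 2 with hGd
  have hG0 : 0 ≤ G := Finset.sum_nonneg fun e _ => mul_nonneg (K.edgeLength_pos e).le
    (intervalIntegral.integral_nonneg (by norm_num) fun _ _ => sq_nonneg _)
  set P := ∑ j, ∫ x in K.carrier, pd j φ x ^ 2 with hP
  have hP0 : 0 ≤ P := Finset.sum_nonneg fun _ _ => integral_nonneg fun _ => sq_nonneg _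
  have hPe : ∫ x in K.carrier, (pd 0 φ x ^ 2 + pd 1 φ x ^ 2) = P := by
    rw [integral_add (hpm 0).integrable_sq (hpm 1).integrable_sq, hP, Fin.sum_univ_two]
  rw [hPe] at hz
  have h1 := hG.of_contDiff hφ₁
  obtain ⟨hi, he⟩ := integral_sum_mul ht hpm
  have hdφ : Integrable (fun x => d x * (φ x - φ z)) (volume.restrict K.carrier) :=
    hdm.integrable_mul hφm
  simp only [hpd] at h1
  rw [integral_add hi hdφ, he] at h1
  have h2 := K.sq_sum_edge_le (u := fun e s => (g e).eval s)
    (w := fun e s => φ (K.edgePoint e s) - φ z) (fun e => (g e).continuous)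
    fun e => hφ₁.continuous.comp (K.continuous_edgePoint e)
  have h3 := hS.toStar.trace_smooth hφ₁
  simp only [hpd] at h3
  rw [hPe] at h3
  set Tr := ∑ e, K.edgeLength e * ∫ s in (-1 / 2 : ℝ)..(1 / 2), (φ (K.edgePoint e s) - φ z) ^ 2
  set Bt := ∑ e, K.edgeLength e * ∫ s in (-1 / 2 : ℝ)..(1 / 2),
    (g e).eval s * (φ (K.edgePoint e s) - φ z)
  have h4 := sq_integral_mul_le hdm hφm
  set X := ∫ x in K.carrier, d x * (φ x - φ z)
  set Φ := ∫ x in K.carrier, (φ x - φ z) ^ 2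
  set Dd := ∫ x in K.carrier, d x ^ 2
  have hh := K.diam_pos
  have hTr0 : 0 ≤ Tr := Finset.sum_nonneg fun e _ => mul_nonneg (K.edgeLength_pos e).le
    (intervalIntegral.integral_nonneg (by norm_num) fun _ _ => sq_nonneg _)
  have hD0 : 0 ≤ Dd := integral_nonneg fun _ => sq_nonneg _
  -- Trace inequality followed by Poincaré; one factor `h` cancels against `ρ > η₁ h`.
  have h5 : Tr ≤ (3 * C₂ + 1) / η₁ * (K.diam * P) := by
    rw [div_mul_eq_mul_div, le_div_iff₀ hη₁]
    refine le_of_mul_le_mul_right ?_ hh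
    have := mul_le_mul_of_nonneg_right hS.ball_lt.le hTr0
    nlinarith
  have h6 : Bt ^ 2 ≤ (3 * C₂ + 1) / η₁ * (K.diam * G) * P := by
    calc Bt ^ 2 ≤ G * Tr := h2
      _ ≤ G * ((3 * C₂ + 1) / η₁ * (K.diam * P)) := mul_le_mul_of_nonneg_left h5 hG0
      _ = _ := by ring
  have h7 : X ^ 2 ≤ C₁ * C₂ * (K.diam * G) * P := by
    calc X ^ 2 ≤ Dd * Φ := h4
      _ ≤ Dd * (C₂ * (K.diam ^ 2 * P)) := mul_le_mul_of_nonneg_left hz hD0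
      _ = (K.diam * Dd) * (C₂ * K.diam * P) := by ring
      _ ≤ (C₁ * G) * (C₂ * K.diam * P) := mul_le_mul_of_nonneg_right hD (by positivity)
      _ = _ := by ring
  have h8 : (∑ j, ∫ x in K.carrier, t j x * pd j φ x) = Bt - X := by linarith
  rw [h8]
  calc (Bt - X) ^ 2 ≤ 2 * Bt ^ 2 + 2 * X ^ 2 := by nlinarith [sq_nonneg (Bt + X)]
    _ ≤ _ := by nlinarith

/-- A polynomial correction of the second component makes the field curl-free without changing its
pairing with `t`, because `t` is orthogonal to polynomials. The corrected field `w` is approximated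
by gradients, and `pairing_grad_le` bounds their pairing with `t` by boundary data. -/
theorem coercive (k : ℕ) (hk : 1 ≤ k) {η₁ : ℝ} (hη₁ : 0 < η₁) :
    ∃ C > 0, ∀ (η₂ : ℝ) (K : Polygon) (c : Plane) (ρ : ℝ), K.Shape c ρ η₁ η₂ →
    ∀ (t : Fin 2 → Plane → ℝ) (d r : Plane → ℝ) (g : Fin (K.m + 3) → Polynomial ℝ),
    (∀ j, MemLp (t j) 2 (volume.restrict K.carrier)) → d ∈ polyFun k → K.RowGreen t d g →
    r ∈ polyFun (k - 1) →
    (∀ φ, IsTest φ → tsupport φ ⊆ K.carrier →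
      ∫ x in K.carrier, (t 1 x * pd 0 φ x - t 0 x * pd 1 φ x) = - ∫ x in K.carrier, r x * φ x) →
    (∀ q ∈ polyFun k, ∀ j, ∫ x in K.carrier, t j x * q x = 0) →
    ∑ j, ∫ x in K.carrier, t j x ^ 2 ≤
      C * (K.diam * ∑ e, K.edgeLength e * ∫ s in (-1 / 2 : ℝ)..(1 / 2), (g e).eval s ^ 2) := by
  obtain ⟨C₁, hC₁, H₁⟩ := pairing_grad_le k hη₁
  obtain ⟨C₂, hC₂, H₂⟩ := exists_antideriv (k - 1) hη₁
  obtain ⟨C₃, hC₃, H₃⟩ := inverse_div (k - 1) hη₁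
  refine ⟨4 * C₁ * (2 + 2 * (C₂ * C₃)), by positivity,
    fun η₂ K c ρ hS t d r g ht hd hG hr hcurl hq => ?_⟩
  have hKm := K.isOpen.measurableSet
  have hsub := hS.toStar.subset_closedBall
  obtain ⟨p, hp, hpr, hple⟩ := H₂ K.carrier c K.diam K.diam_pos hKm hS.ball_subset' hsub r hr
  -- The antiderivative of a curl of degree at most `k - 1` has degree at most `k`, exactly the
  -- range of the orthogonality.
  rw [Nat.sub_add_cancel hk] at hp
  have hpm := memLp_polyFun hp K.bounded
  have hpc := contDiff_of_mem_polyFun hp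
  -- The curl of `t` is the divergence of the rotated field `(t₁, -t₀)`, so the inverse estimate for
  -- divergences applies to it.
  have hrot := H₃ K.carrier c K.diam K.diam_pos hKm hS.ball_subset' hsub
    ![t 1, fun x => - t 0 x] r (fun j => by
      fin_cases j
      · exact ht 1
      · exact (ht 0).neg) hr (fun φ hφ hs => by
        rw [← hcurl φ hφ hs]
        simp [Fin.sum_univ_two, sub_eq_add_neg])
  simp only [Fin.sum_univ_two, Matrix.cons_val_zero, Matrix.cons_val_one, neg_sq] at hrot
  set G := K.diam * ∑ e, K.edgeLength e * ∫ s in (-1 / 2 : ℝ)..(1 / 2), (g e).eval s ^ 2 with hGd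
  have hG0 : 0 ≤ G := mul_nonneg K.diam_pos.le
    (Finset.sum_nonneg fun e _ => mul_nonneg (K.edgeLength_pos e).le
    (intervalIntegral.integral_nonneg (by norm_num) fun _ _ => sq_nonneg _))
  have hA0 (j) : 0 ≤ ∫ x in K.carrier, t j x ^ 2 := integral_nonneg fun _ => sq_nonneg _
  set A := ∑ j, ∫ x in K.carrier, t j x ^ 2 with hA
  have hA2 : A = (∫ x in K.carrier, t 0 x ^ 2) + ∫ x in K.carrier, t 1 x ^ 2 := by
    rw [hA, Fin.sum_univ_two]
  have hAn : 0 ≤ A := by rw [hA2]; exact add_nonneg (hA0 0) (hA0 1)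
  have hp2 : ∫ x in K.carrier, p x ^ 2 ≤ C₂ * C₃ * A := by
    calc _ ≤ _ := hple
      _ ≤ C₂ * (C₃ * ((∫ x in K.carrier, t 1 x ^ 2) + ∫ x in K.carrier, t 0 x ^ 2)) :=
        mul_le_mul_of_nonneg_left hrot hC₂.le
      _ = _ := by rw [hA2]; ring
  let w : Fin 2 → Plane → ℝ := ![t 0, fun x => t 1 x - p x]
  have hw (j) : MemLp (w j) 2 (volume.restrict K.carrier) := by
    fin_cases j
    · exact ht 0
    · exact (ht 1).sub hpm
  have hw2 : ∑ j, ∫ x in K.carrier, w j x ^ 2 ≤ (2 + 2 * (C₂ * C₃)) * A := by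
    rw [Fin.sum_univ_two]
    have h0 : ∫ x in K.carrier, w 1 x ^ 2 ≤ _ := integral_sq_sub_le (ht 1) hpm
    have h1 : ∫ x in K.carrier, w 0 x ^ 2 = ∫ x in K.carrier, t 0 x ^ 2 := rfl
    have := hA0 0
    rw [h1]
    linarith
  have hwc (φ) (hφ : IsTest φ) (hs : tsupport φ ⊆ K.carrier) :
      ∫ x in K.carrier, (w 1 x * pd 0 φ x - w 0 x * pd 1 φ x) = 0 := by
    have h1 := hcurl φ hφ hs
    have h2 := setIntegral_mul_pd_eq_neg hpc hφ hs 0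
    rw [hpr, ← h1] at h2
    have i1 : Integrable (fun x => t 1 x * pd 0 φ x - t 0 x * pd 1 φ x)
        (volume.restrict K.carrier) := ((ht 1).integrable_mul ((hφ.memLp_pd 0).restrict _)).sub
      ((ht 0).integrable_mul ((hφ.memLp_pd 1).restrict _))
    have i2 : Integrable (fun x => p x * pd 0 φ x) (volume.restrict K.carrier) :=
      hpm.integrable_mul ((hφ.memLp_pd 0).restrict _)
    rw [← sub_eq_zero.2 h2.symm, ← integral_sub i1 i2]
    congr 1; ext x
    simp [w]
    ring
  have htw : ∑ j, ∫ x in K.carrier, t j x * w j x = A := by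
    have h1 : ∫ x in K.carrier, t 1 x * w 1 x = ∫ x in K.carrier, t 1 x ^ 2 := by
      have h2 := hq p hp 1
      have i1 : Integrable (fun x => t 1 x * p x) (volume.restrict K.carrier) :=
        (ht 1).integrable_mul hpm
      rw [← sub_zero (∫ x in K.carrier, t 1 x ^ 2), ← h2,
        ← integral_sub (ht 1).integrable_sq i1]
      congr 1; ext x
      simp [w]
      ring
    have h2 : ∫ x in K.carrier, t 0 x * w 0 x = ∫ x in K.carrier, t 0 x ^ 2 := by
      congr 1; ext x; simp [w, pow_two]
    rw [Fin.sum_univ_two, h1, h2, hA2]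
  have key (ε : ℝ) (hε : 0 < ε) :
      A ^ 2 ≤ 4 * C₁ * (2 + 2 * (C₂ * C₃)) * G * A + (8 * C₁ * G + 4 * A) * ε := by
    obtain ⟨φ, hφ, hφw⟩ := exists_test_approx K.isOpen hsub hS.pos K.diam_pos hS.star hw hwc hε
    have hpm (j) : MemLp (pd j φ) 2 (volume.restrict K.carrier) := (hφ.memLp_pd j).restrict _
    have hdm (j) : MemLp (fun x => pd j φ x - w j x) 2 (volume.restrict K.carrier) :=
      (hpm j).sub (hw j)
    have h1 := H₁ η₂ K c ρ hS t d g ht hd hG hq φ hφ.1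
    have h2 := sq_sum_integral_mul_le ht hdm
    set Y := ∑ j, ∫ x in K.carrier, t j x * pd j φ x with hY
    have h3 : ∑ j, ∫ x in K.carrier, t j x * (pd j φ x - w j x) = Y - A := by
      rw [hY, ← htw, ← Finset.sum_sub_distrib]
      refine Finset.sum_congr rfl fun j _ => ?_
      have i1 : Integrable (fun x => t j x * pd j φ x) (volume.restrict K.carrier) :=
        (ht j).integrable_mul (hpm j)
      have i2 : Integrable (fun x => t j x * w j x) (volume.restrict K.carrier) :=
        (ht j).integrable_mul (hw j)
      rw [← integral_sub i1 i2]
      congr 1; ext x; ring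
    rw [h3] at h2
    have h4 : ∑ j, ∫ x in K.carrier, (pd j φ x - w j x) ^ 2 ≤ 2 * ε := by
      rw [Fin.sum_univ_two]; linarith [hφw 0, hφw 1]
    have h5 : (Y - A) ^ 2 ≤ A * (2 * ε) := h2.trans (mul_le_mul_of_nonneg_left h4 hAn)
    have h6 : ∑ j, ∫ x in K.carrier, pd j φ x ^ 2 ≤ 2 * ((2 + 2 * (C₂ * C₃)) * A) + 4 * ε := by
      have h7 (j) : ∫ x in K.carrier, pd j φ x ^ 2 ≤
          2 * (∫ x in K.carrier, (pd j φ x - w j x) ^ 2) + 2 * ∫ x in K.carrier, w j x ^ 2 := by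
        have := integral_sq_sub_le (hdm j) (hw j).neg
        simpa using this
      rw [Fin.sum_univ_two] at hw2 h4 ⊢
      linarith [h7 0, h7 1]
    have h8 : Y ^ 2 ≤ C₁ * G * (2 * ((2 + 2 * (C₂ * C₃)) * A) + 4 * ε) :=
      h1.trans (mul_le_mul_of_nonneg_left h6 (by positivity))
    -- The inequality used is `A² ≤ 2 Y² + 2 (Y - A)²`.
    nlinarith [sq_nonneg (2 * Y - A)]
  -- The approximation error is sent to zero; the coefficient of `ε` does not depend on `ε`.
  have hlim : A ^ 2 ≤ 4 * C₁ * (2 + 2 * (C₂ * C₃)) * G * A := by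
    refine le_of_forall_pos_le_add fun ε hε => ?_
    have hY0 : 0 ≤ 8 * C₁ * G + 4 * A := by positivity
    refine (key (ε / (8 * C₁ * G + 4 * A + 1)) (by positivity)).trans ?_
    gcongr
    rw [mul_div_assoc', div_le_iff₀ (by positivity)]
    nlinarith
  rcases hAn.eq_or_lt with h | h
  · rw [← h]; positivity
  · refine le_of_mul_le_mul_right ?_ h
    linarith

end Polygon

/-! ### Linearity and uniqueness of weak divergence, weak curl and normal trace -/

theorem memLp_apply {ι : Type} [Fintype ι] {μ : Measure Plane} {u : Plane → EuclideanSpace ℝ ι}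
    (hu : MemLp u 2 μ) (a : ι) : MemLp (fun x => u x a) 2 μ :=
  (EuclideanSpace.proj a : EuclideanSpace ℝ ι →L[ℝ] ℝ).comp_memLp' hu

theorem ae_eq_zero_of_test {U : Set Plane} (hU : IsOpen U) {f : Plane → ℝ}
    (hf : MemLp f 2 (volume.restrict U))
    (h : ∀ φ, IsTest φ → tsupport φ ⊆ U → ∫ x in U, f x * φ x = 0) :
    f =ᵐ[volume.restrict U] 0 := by
  have h1 := hU.ae_eq_zero_of_integral_contDiff_smul_eq_zero (f := f) (μ := volume)
    (locallyIntegrableOn_of_locallyIntegrable_restrict (hf.locallyIntegrable (by norm_num)))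
    fun g hg hgc hgs => by
      rw [← h g ⟨hg, hgc⟩ hgs, setIntegral_eq_integral_of_forall_compl_eq_zero fun x hx => by
        rw [image_eq_zero_of_notMem_tsupport (fun h => hx (hgs h)), mul_zero]]
      simp [mul_comm]
  exact (ae_restrict_iff' hU.measurableSet).2 h1

theorem HasWeakDiv.unique {U : Set Plane} (hU : IsOpen U) {τ : Plane → EuclideanSpace ℝ TIdx}
    {d d' : Plane → EuclideanSpace ℝ (Fin 2)} (hd : MemLp d 2 (volume.restrict U))
    (hd' : MemLp d' 2 (volume.restrict U)) (h : HasWeakDiv U τ d) (h' : HasWeakDiv U τ d') :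
    d =ᵐ[volume.restrict U] d' := by
  have h1 (i : Fin 2) : (fun x => d x i - d' x i) =ᵐ[volume.restrict U] 0 := by
    refine ae_eq_zero_of_test hU ((memLp_apply hd i).sub (memLp_apply hd' i)) fun φ hφ hs => ?_
    have i1 : Integrable (fun x => d x i * φ x) (volume.restrict U) :=
      (memLp_apply hd i).integrable_mul (hφ.memLp.restrict _)
    have i2 : Integrable (fun x => d' x i * φ x) (volume.restrict U) :=
      (memLp_apply hd' i).integrable_mul (hφ.memLp.restrict _)
    simp_rw [sub_mul]
    rw [integral_sub i1 i2]
    linarith [h i φ hφ hs, h' i φ hφ hs]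
  filter_upwards [h1 0, h1 1] with x h0 h1
  ext i
  fin_cases i
  · exact sub_eq_zero.1 h0
  · exact sub_eq_zero.1 h1

theorem HasWeakDiv.congr {U : Set Plane} {τ τ' : Plane → EuclideanSpace ℝ TIdx}
    {d d' : Plane → EuclideanSpace ℝ (Fin 2)} (h : HasWeakDiv U τ d)
    (hτ : τ =ᵐ[volume.restrict U] τ') (hd : d =ᵐ[volume.restrict U] d') : HasWeakDiv U τ' d' := by
  intro i φ hφ hs
  have h1 : ∫ x in U, ∑ j, τ x (i, j) * pd j φ x = ∫ x in U, ∑ j, τ' x (i, j) * pd j φ x :=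
    integral_congr_ae (hτ.mono fun x hx => by simp only [hx])
  have h2 : ∫ x in U, d x i * φ x = ∫ x in U, d' x i * φ x :=
    integral_congr_ae (hd.mono fun x hx => by simp only [hx])
  rw [← h1, ← h2, h i φ hφ hs]

theorem HasWeakCurl.congr {U : Set Plane} {τ τ' : Plane → EuclideanSpace ℝ TIdx}
    {d d' : Plane → EuclideanSpace ℝ (Fin 2)} (h : HasWeakCurl U τ d)
    (hτ : τ =ᵐ[volume.restrict U] τ') (hd : d =ᵐ[volume.restrict U] d') : HasWeakCurl U τ' d' := by
  intro i φ hφ hs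
  have h1 : ∫ x in U, (τ x (i, 1) * pd 0 φ x - τ x (i, 0) * pd 1 φ x) =
      ∫ x in U, (τ' x (i, 1) * pd 0 φ x - τ' x (i, 0) * pd 1 φ x) :=
    integral_congr_ae (hτ.mono fun x hx => by simp only [hx])
  have h2 : ∫ x in U, d x i * φ x = ∫ x in U, d' x i * φ x :=
    integral_congr_ae (hd.mono fun x hx => by simp only [hx])
  rw [← h1, ← h2, h i φ hφ hs]

section Linear

variable {U : Set Plane} {σ τ : Plane → EuclideanSpace ℝ TIdx}

theorem integral_smul_add {f g : Plane → ℝ} {μ : Measure Plane} (hf : Integrable f μ)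
    (hg : Integrable g μ) (a : ℝ) :
    ∫ x, (a * f x + g x) ∂μ = a * (∫ x, f x ∂μ) + ∫ x, g x ∂μ := by
  rw [integral_add (hf.const_mul a) hg, integral_const_mul]

theorem integrable_row (hσ : MemLp σ 2 (volume.restrict U)) (i : Fin 2) {φ : Plane → ℝ}
    (hφ : IsTest φ) : Integrable (fun x => ∑ j, σ x (i, j) * pd j φ x) (volume.restrict U) :=
  (integral_sum_mul (fun j => memLp_apply hσ (i, j)) fun j => (hφ.memLp_pd j).restrict _).1

theorem integrable_apply_mul {d : Plane → EuclideanSpace ℝ (Fin 2)}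
    (hd : MemLp d 2 (volume.restrict U)) (i : Fin 2) {φ : Plane → ℝ} (hφ : IsTest φ) :
    Integrable (fun x => d x i * φ x) (volume.restrict U) :=
  (memLp_apply hd i).integrable_mul (hφ.memLp.restrict _)

theorem HasWeakDiv.lincomb (hσ : MemLp σ 2 (volume.restrict U))
    (hτ : MemLp τ 2 (volume.restrict U)) {d d' : Plane → EuclideanSpace ℝ (Fin 2)}
    (hd : MemLp d 2 (volume.restrict U)) (hd' : MemLp d' 2 (volume.restrict U))
    (h : HasWeakDiv U σ d) (h' : HasWeakDiv U τ d') (a : ℝ) :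
    HasWeakDiv U (fun x => a • σ x + τ x) (fun x => a • d x + d' x) := by
  intro i φ hφ hs
  have h1 := integral_smul_add (integrable_row hσ i hφ) (integrable_row hτ i hφ) a
  have h2 := integral_smul_add (integrable_apply_mul hd i hφ) (integrable_apply_mul hd' i hφ) a
  have e1 : ∫ x in U, ∑ j, (a • σ x + τ x) (i, j) * pd j φ x =
      ∫ x in U, (a * (∑ j, σ x (i, j) * pd j φ x) + ∑ j, τ x (i, j) * pd j φ x) := by
    congr 1; ext x; simp [Fin.sum_univ_two]; ring
  have e2 : ∫ x in U, (a • d x + d' x) i * φ x =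
      ∫ x in U, (a * (d x i * φ x) + d' x i * φ x) := by
    congr 1; ext x; simp; ring
  rw [e1, e2, h1, h2, h i φ hφ hs, h' i φ hφ hs]
  ring

theorem HasWeakCurl.lincomb (hσ : MemLp σ 2 (volume.restrict U))
    (hτ : MemLp τ 2 (volume.restrict U)) {d d' : Plane → EuclideanSpace ℝ (Fin 2)}
    (hd : MemLp d 2 (volume.restrict U)) (hd' : MemLp d' 2 (volume.restrict U))
    (h : HasWeakCurl U σ d) (h' : HasWeakCurl U τ d') (a : ℝ) :
    HasWeakCurl U (fun x => a • σ x + τ x) (fun x => a • d x + d' x) := by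
  intro i φ hφ hs
  have hi {υ : Plane → EuclideanSpace ℝ TIdx} (hυ : MemLp υ 2 (volume.restrict U)) :
      Integrable (fun x => υ x (i, 1) * pd 0 φ x - υ x (i, 0) * pd 1 φ x) (volume.restrict U) :=
    ((memLp_apply hυ (i, 1)).integrable_mul ((hφ.memLp_pd 0).restrict _)).sub
      ((memLp_apply hυ (i, 0)).integrable_mul ((hφ.memLp_pd 1).restrict _))
  have h1 := integral_smul_add (hi hσ) (hi hτ) a
  have h2 := integral_smul_add (integrable_apply_mul hd i hφ) (integrable_apply_mul hd' i hφ) a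
  have e1 : ∫ x in U, ((a • σ x + τ x) (i, 1) * pd 0 φ x - (a • σ x + τ x) (i, 0) * pd 1 φ x) =
      ∫ x in U, (a * (σ x (i, 1) * pd 0 φ x - σ x (i, 0) * pd 1 φ x) +
        (τ x (i, 1) * pd 0 φ x - τ x (i, 0) * pd 1 φ x)) := by
    congr 1; ext x; simp; ring
  have e2 : ∫ x in U, (a • d x + d' x) i * φ x =
      ∫ x in U, (a * (d x i * φ x) + d' x i * φ x) := by
    congr 1; ext x; simp; ring
  rw [e1, e2, h1, h2, h i φ hφ hs, h' i φ hφ hs]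
  ring

end Linear

theorem IsPolyOn.memLp {ι : Type} [Fintype ι] {k : ℕ} {K : Set Plane} (hK : Bornology.IsBounded K)
    {u : Plane → EuclideanSpace ℝ ι} (h : IsPolyOn k K u) : MemLp u 2 (volume.restrict K) := by
  obtain ⟨q, hq, he⟩ := h
  refine MemLp.of_eval_piLp fun a => (memLp_polyFun (pval_mem_polyFun (hq a)) hK).ae_eq ?_
  exact he.mono fun x hx => (hx a).symm

theorem IsPolyOn.lincomb {ι : Type} {k : ℕ} {K : Set Plane} {u w : Plane → EuclideanSpace ℝ ι}
    (h : IsPolyOn k K u) (h' : IsPolyOn k K w) (a : ℝ) : IsPolyOn k K fun x => a • u x + w x := by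
  obtain ⟨q, hq, he⟩ := h
  obtain ⟨q', hq', he'⟩ := h'
  refine ⟨a • q + q', fun b => (MvPolynomial.totalDegree_add _ _).trans
    (max_le ((MvPolynomial.totalDegree_smul_le _ _).trans (hq b)) (hq' b)), ?_⟩
  filter_upwards [he, he'] with x h1 h2 b
  simp [h1 b, h2 b, pval]

namespace Polygon

variable {K : Polygon}

theorem IsNormalTrace.congr {τ τ' : Plane → EuclideanSpace ℝ TIdx}
    {g : Fin (K.m + 3) → Fin 2 → Polynomial ℝ} (h : K.IsNormalTrace τ g)
    (hτ : τ =ᵐ[volume.restrict K.carrier] τ') : K.IsNormalTrace τ' g := by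
  obtain ⟨d, hd, hw, hG⟩ := h
  refine ⟨d, hd, hw.congr hτ (ae_eq_refl _), fun i φ hφ => ?_⟩
  rw [← hG i φ hφ]
  exact integral_congr_ae (hτ.mono fun x hx => by simp only [hx])

theorem IsNormalTrace.lincomb {σ τ : Plane → EuclideanSpace ℝ TIdx}
    {g g' : Fin (K.m + 3) → Fin 2 → Polynomial ℝ}
    (hσ : MemLp σ 2 (volume.restrict K.carrier)) (hτ : MemLp τ 2 (volume.restrict K.carrier))
    (h : K.IsNormalTrace σ g) (h' : K.IsNormalTrace τ g') (a : ℝ) :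
    K.IsNormalTrace (fun x => a • σ x + τ x) (a • g + g') := by
  obtain ⟨d, hd, hw, hG⟩ := h
  obtain ⟨d', hd', hw', hG'⟩ := h'
  refine ⟨fun x => a • d x + d' x, (hd.const_smul a).add hd', hw.lincomb hσ hτ hd hd' hw' a,
    fun i φ hφ => ?_⟩
  have h1 := integral_smul_add ((integrable_row hσ i hφ).add (integrable_apply_mul hd i hφ))
    ((integrable_row hτ i hφ).add (integrable_apply_mul hd' i hφ)) a
  simp only [Pi.add_apply] at h1
  have e1 : ∫ x in K.carrier, ((∑ j, (a • σ x + τ x) (i, j) * pd j φ x) +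
        (a • d x + d' x) i * φ x) =
      ∫ x in K.carrier, (a * ((∑ j, σ x (i, j) * pd j φ x) + d x i * φ x) +
        ((∑ j, τ x (i, j) * pd j φ x) + d' x i * φ x)) := by
    congr 1; ext x; simp [Fin.sum_univ_two]; ring
  rw [e1, h1, hG i φ hφ, hG' i φ hφ, Finset.mul_sum, ← Finset.sum_add_distrib]
  refine Finset.sum_congr rfl fun e _ => ?_
  have hc (p : Polynomial ℝ) : IntervalIntegrable
      (fun s => p.eval s * φ (K.edgePoint e s)) volume (-1 / 2) (1 / 2) :=
    (p.continuous.mul (hφ.1.continuous.comp (K.continuous_edgePoint e))).intervalIntegrable _ _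
  rw [← mul_assoc, mul_comm a, mul_assoc, ← mul_add, ← intervalIntegral.integral_const_mul,
    ← intervalIntegral.integral_add ((hc _).const_mul a) (hc _)]
  congr 2
  ext s
  simp
  ring

theorem isNormalTrace_zero : K.IsNormalTrace (fun _ => 0) 0 :=
  ⟨fun _ => 0, MemLp.zero', fun i φ _ _ => by simp, fun i φ _ => by simp⟩

/-- The difference of two traces is a trace of the zero field, whose weak divergence vanishes, so
`trace_le` forces it to be zero. This makes `normalTrace`, defined by choice, computable and linear.
-/
theorem IsNormalTrace.unique {c : Plane} {ρ η₁ η₂ : ℝ} (hη₁ : 0 < η₁) (hη₂ : 0 < η₂)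
    (hS : K.Shape c ρ η₁ η₂) {τ : Plane → EuclideanSpace ℝ TIdx}
    (hτ : MemLp τ 2 (volume.restrict K.carrier))
    {g g' : Fin (K.m + 3) → Fin 2 → Polynomial ℝ} (h : K.IsNormalTrace τ g)
    (h' : K.IsNormalTrace τ g') : g = g' := by
  have h0 : K.IsNormalTrace (fun _ => 0) ((-1 : ℝ) • g + g') := by
    have := h.lincomb hτ hτ h' (-1)
    exact this.congr (ae_of_all _ fun x => by simp)
  obtain ⟨d, hd, hw, hG⟩ := h0
  have hd0 : d =ᵐ[volume.restrict K.carrier] fun _ => 0 :=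
    hw.unique K.isOpen hd MemLp.zero' fun i φ _ _ => by simp
  ext1 e
  ext1 i
  obtain ⟨C, hC, H⟩ := trace_le (((-1 : ℝ) • g + g') e i).natDegree hη₁ hη₂
  have h1 := H K c ρ hS _ _ _ (fun j => MemLp.zero') (memLp_apply hd i) (hG i) e le_rfl
  have hd1 : ∫ x in K.tri c e, d x i ^ 2 = 0 := by
    rw [integral_congr_ae (g := fun _ => 0)
      ((ae_restrict_of_ae_restrict_of_subset (hS.toStar.tri_subset e) hd0).mono
        fun x hx => by simp [hx])]
    simp
  set p := ((-1 : ℝ) • g + g') e i with hp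
  simp only [ne_eq, OfNat.ofNat_ne_zero, not_false_eq_true, zero_pow,
    integral_zero, Finset.sum_const_zero, hd1, mul_zero, add_zero] at h1
  have hI : ∫ s in (-1 / 2 : ℝ)..(1 / 2), p.eval s ^ 2 = 0 := by
    have h2 : 0 ≤ ∫ s in (-1 / 2 : ℝ)..(1 / 2), p.eval s ^ 2 :=
      intervalIntegral.integral_nonneg (by norm_num) fun _ _ => sq_nonneg _
    have h3 := K.diam_pos
    have h4 := pow_pos h3 2
    nlinarith
  have hp0 : p = 0 := by
    refine polynomial_eq_zero_of_eqOn (a := -1 / 2) (b := 1 / 2) (by norm_num) fun s hs => ?_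
    by_contra hne
    refine absurd hI (ne_of_gt ?_)
    exact intervalIntegral.integral_pos (by norm_num) (p.continuous.pow 2).continuousOn
      (fun _ _ => sq_nonneg _) ⟨s, ⟨hs.1.le, hs.2.le⟩, by positivity⟩
  have h2 : -g e i + g' e i = 0 := by simpa [hp] using hp0
  exact neg_add_eq_zero.1 h2

theorem normalTrace_eq {c : Plane} {ρ η₁ η₂ : ℝ} (hη₁ : 0 < η₁) (hη₂ : 0 < η₂)
    (hS : K.Shape c ρ η₁ η₂) {τ : Plane → EuclideanSpace ℝ TIdx}
    (hτ : MemLp τ 2 (volume.restrict K.carrier))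
    {g : Fin (K.m + 3) → Fin 2 → Polynomial ℝ} (h : K.IsNormalTrace τ g) :
    K.normalTrace τ = g := by
  have hex : ∃ g, K.IsNormalTrace τ g := ⟨g, h⟩
  rw [normalTrace, dif_pos hex]
  exact hex.choose_spec.unique hη₁ hη₂ hS hτ h

end Polygon

/-! ### The local virtual space -/

namespace Polygon

variable {K : Polygon}

/-- Restriction of a bivariate polynomial to an edge. -/
def edgePoly (K : Polygon) (e : Fin (K.m + 3)) (q : MvPolynomial (Fin 2) ℝ) : Polynomial ℝ :=
  MvPolynomial.aeval (fun j => Polynomial.C (midpoint ℝ (K.vert e) (K.vert (e + 1)) j) +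
    Polynomial.C ((K.vert (e + 1) - K.vert e) j) * Polynomial.X) q

theorem eval_edgePoly (e : Fin (K.m + 3)) (q : MvPolynomial (Fin 2) ℝ) (s : ℝ) :
    (K.edgePoly e q).eval s = pval q (K.edgePoint e s) := by
  have h : ((Polynomial.aeval s).comp (MvPolynomial.aeval fun j =>
      Polynomial.C (midpoint ℝ (K.vert e) (K.vert (e + 1)) j) +
      Polynomial.C ((K.vert (e + 1) - K.vert e) j) * Polynomial.X)) =
      MvPolynomial.aeval (R := ℝ) fun j => K.edgePoint e s j := by
    ext j
    simp [edgePoint, mul_comm]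
  have := congrArg (fun f => f q) h
  simpa [edgePoly, pval, MvPolynomial.aeval_eq_eval, Polynomial.coe_aeval_eq_eval] using this

theorem natDegree_edgePoly_le {k : ℕ} (e : Fin (K.m + 3)) {q : MvPolynomial (Fin 2) ℝ}
    (hq : q.totalDegree ≤ k) : (K.edgePoly e q).natDegree ≤ k := by
  have h (j : Fin 2) : (Polynomial.C (midpoint ℝ (K.vert e) (K.vert (e + 1)) j) +
      Polynomial.C ((K.vert (e + 1) - K.vert e) j) * Polynomial.X).natDegree ≤ 1 := by
    rw [add_comm]
    exact Polynomial.natDegree_linear_le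
  exact (MvPolynomial.aeval_natDegree_le q hq _ h).trans_eq (mul_one k)

/-- Normal trace of a polynomial tensor field. -/
def polyTrace (K : Polygon) (c : Plane) (q : TIdx → MvPolynomial (Fin 2) ℝ) (e : Fin (K.m + 3))
    (i : Fin 2) : Polynomial ℝ :=
  Polynomial.C (Star.sgn K c e / K.edgeLength e * (K.vert (e + 1) - K.vert e) 1) *
      K.edgePoly e (q (i, 0)) -
    Polynomial.C (Star.sgn K c e / K.edgeLength e * (K.vert (e + 1) - K.vert e) 0) *
      K.edgePoly e (q (i, 1))

theorem natDegree_polyTrace_le {k : ℕ} {c : Plane} {q : TIdx → MvPolynomial (Fin 2) ℝ}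
    (hq : ∀ a, (q a).totalDegree ≤ k) (e : Fin (K.m + 3)) (i : Fin 2) :
    (K.polyTrace c q e i).natDegree ≤ k :=
  (Polynomial.natDegree_sub_le _ _).trans (max_le
    ((Polynomial.natDegree_C_mul_le _ _).trans (natDegree_edgePoly_le e (hq _)))
    ((Polynomial.natDegree_C_mul_le _ _).trans (natDegree_edgePoly_le e (hq _))))

theorem _root_.ViscoVEM.contDiff_pval (q : MvPolynomial (Fin 2) ℝ) : ContDiff ℝ ∞ (pval q) :=
  contDiff_of_mem_polyFun (pval_mem_polyFun le_rfl)

/-- The tensor field defined by polynomials. -/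
def _root_.ViscoVEM.polyField {ι : Type} (q : ι → MvPolynomial (Fin 2) ℝ) (x : Plane) :
    EuclideanSpace ℝ ι := WithLp.toLp 2 fun a => pval (q a) x

theorem _root_.ViscoVEM.hasWeakDiv_poly {U : Set Plane} (hU : Bornology.IsBounded U)
    (q : TIdx → MvPolynomial (Fin 2) ℝ) : HasWeakDiv U (polyField q) fun x =>
      WithLp.toLp 2 fun i => pd 0 (pval (q (i, 0))) x + pd 1 (pval (q (i, 1))) x := by
  intro i φ hφ hs
  have hi (j) := setIntegral_mul_pd_eq_neg (contDiff_pval (q (i, j))) hφ hs j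
  have hm (j) : MemLp (pval (q (i, j))) 2 (volume.restrict U) :=
    memLp_of_continuous (contDiff_pval _).continuous hU
  have hm' (j) : MemLp (pd j (pval (q (i, j)))) 2 (volume.restrict U) :=
    memLp_of_continuous (contDiff_pd (contDiff_pval _) j).continuous hU
  have h2 := (integral_sum_mul hm fun j => (hφ.memLp_pd j).restrict _).2
  have i1 (j) : Integrable (fun x => pd j (pval (q (i, j))) x * φ x) (volume.restrict U) :=
    (hm' j).integrable_mul (hφ.memLp.restrict _)
  have h3 := integral_add (i1 0) (i1 1)
  simp only [← add_mul] at h3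
  change ∫ x in U, ∑ j, pval (q (i, j)) x * pd j φ x =
    -∫ x in U, (pd 0 (pval (q (i, 0))) x + pd 1 (pval (q (i, 1))) x) * φ x
  rw [h2, h3, Fin.sum_univ_two, hi 0, hi 1]
  ring

/-- Classical Green's formula applied to `τ φ`: on each edge the outward normal times the length is
`sgn` times the rotated edge vector. -/
theorem isNormalTrace_poly {c : Plane} {ρ : ℝ} (hS : K.Star c ρ)
    (q : TIdx → MvPolynomial (Fin 2) ℝ) :
    K.IsNormalTrace (polyField q) (K.polyTrace c q) := by
  let d : Plane → EuclideanSpace ℝ (Fin 2) := fun x =>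
    WithLp.toLp 2 fun i => pd 0 (pval (q (i, 0))) x + pd 1 (pval (q (i, 1))) x
  have hdc (i : Fin 2) : Continuous fun x => d x i :=
    (contDiff_pd (contDiff_pval _) 0).continuous.add (contDiff_pd (contDiff_pval _) 1).continuous
  have hexp (i : Fin 2) {φ : Plane → ℝ} (hφ : ContDiff ℝ ∞ φ) (x : Plane) :
      pd 0 (fun x => pval (q (i, 0)) x * φ x) x + pd 1 (fun x => pval (q (i, 1)) x * φ x) x =
        (∑ j, polyField q x (i, j) * pd j φ x) + d x i * φ x := by
    rw [pd_mul 0 (diffAt_of_contDiff (contDiff_pval _) x) (diffAt_of_contDiff hφ x),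
      pd_mul 1 (diffAt_of_contDiff (contDiff_pval _) x) (diffAt_of_contDiff hφ x)]
    simp only [Fin.sum_univ_two, polyField, d]
    ring
  have hgreen (i : Fin 2) (φ : Plane → ℝ) (hφ : ContDiff ℝ ∞ φ) :
      ∫ x in K.carrier, ((∑ j, polyField q x (i, j) * pd j φ x) + d x i * φ x) =
      ∑ e, K.edgeLength e * ∫ s in (-1 / 2 : ℝ)..(1 / 2),
        (K.polyTrace c q e i).eval s * φ (K.edgePoint e s) := by
    have h1 := hS.green ((contDiff_pval (q (i, 0))).mul hφ) ((contDiff_pval (q (i, 1))).mul hφ)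
    simp only [hexp i hφ] at h1
    rw [h1]
    refine Finset.sum_congr rfl fun e _ => ?_
    rw [← intervalIntegral.integral_const_mul, ← intervalIntegral.integral_const_mul]
    congr 1
    ext s
    have := (K.edgeLength_pos e).ne'
    simp only [polyTrace, Polynomial.eval_sub, Polynomial.eval_mul, Polynomial.eval_C,
      eval_edgePoly]
    field_simp
  exact ⟨d, MemLp.of_eval_piLp fun i => memLp_of_continuous (hdc i) K.bounded,
    hasWeakDiv_poly K.bounded q, fun i φ hφ => hgreen i φ hφ.1⟩

theorem localSpace_congr {k : ℕ} {τ τ' : Plane → EuclideanSpace ℝ TIdx}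
    (h : τ ∈ K.localSpace k) (hτ : τ =ᵐ[volume.restrict K.carrier] τ') : τ' ∈ K.localSpace k := by
  obtain ⟨hm, ⟨d, hd, hdw⟩, ⟨r, hr, hrw⟩, g, hg, hgd⟩ := h
  exact ⟨hm.ae_eq hτ, ⟨d, hd, hdw.congr hτ (ae_eq_refl _)⟩, ⟨r, hr, hrw.congr hτ (ae_eq_refl _)⟩,
    g, hg.congr hτ, hgd⟩

theorem localSpace_lincomb {k : ℕ} {σ τ : Plane → EuclideanSpace ℝ TIdx}
    (h : σ ∈ K.localSpace k) (h' : τ ∈ K.localSpace k) (a : ℝ) :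
    (fun x => a • σ x + τ x) ∈ K.localSpace k := by
  obtain ⟨hm, ⟨d, hd, hdw⟩, ⟨r, hr, hrw⟩, g, hg, hgd⟩ := h
  obtain ⟨hm', ⟨d', hd', hdw'⟩, ⟨r', hr', hrw'⟩, g', hg', hgd'⟩ := h'
  have hb := K.bounded
  refine ⟨(hm.const_smul a).add hm',
    ⟨_, hd.lincomb hd' a, hdw.lincomb hm hm' (hd.memLp hb) (hd'.memLp hb) hdw' a⟩,
    ⟨_, hr.lincomb hr' a, hrw.lincomb hm hm' (hr.memLp hb) (hr'.memLp hb) hrw' a⟩,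
    _, hg.lincomb hm hm' hg' a, fun e i => ?_⟩
  exact (Polynomial.natDegree_add_le _ _).trans (max_le
    ((Polynomial.natDegree_smul_le _ _).trans (hgd e i)) (hgd' e i))

theorem _root_.ViscoVEM.isPolyOn_of_mem_polyFun {ι : Type} {k : ℕ} {S : Set Plane}
    {u : Plane → EuclideanSpace ℝ ι} (h : ∀ a, (fun x => u x a) ∈ polyFun k) :
    IsPolyOn k S u := by
  choose q hq hqe using fun a => mem_polyFun.1 (h a)
  exact ⟨q, hq, ae_of_all _ fun x a => (congrFun (hqe a) x).symm⟩

theorem _root_.ViscoVEM.IsPolyOn.exists_polyField {ι : Type} {k : ℕ} {S : Set Plane}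
    {u : Plane → EuclideanSpace ℝ ι} (h : IsPolyOn k S u) :
    ∃ q : ι → MvPolynomial (Fin 2) ℝ, (∀ a, (q a).totalDegree ≤ k) ∧
      u =ᵐ[volume.restrict S] polyField q := by
  obtain ⟨q, hq, he⟩ := h
  exact ⟨q, hq, he.mono fun x hx => by ext a; exact hx a⟩

/-- Ensures that `τ - Πτ` stays in the virtual space, where the norm estimates hold. -/
theorem polyField_mem_localSpace {c : Plane} {ρ : ℝ} (hS : K.Star c ρ) {k : ℕ}
    {q : TIdx → MvPolynomial (Fin 2) ℝ} (hq : ∀ a, (q a).totalDegree ≤ k) :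
    polyField q ∈ K.localSpace k := by
  have hm : MemLp (polyField q) 2 (volume.restrict K.carrier) :=
    MemLp.of_eval_piLp fun a => memLp_polyFun (pval_mem_polyFun (hq a)) K.bounded
  have hpm (a) (j) := pd_mem_polyFun_pred (pval_mem_polyFun (hq a)) j
  have ht := isNormalTrace_poly hS q
  refine ⟨hm, ⟨fun x => WithLp.toLp 2 fun i =>
      pd 0 (pval (q (i, 0))) x + pd 1 (pval (q (i, 1))) x, ?_, ?_⟩,
    ⟨fun x => WithLp.toLp 2 fun i => pd 0 (pval (q (i, 1))) x - pd 1 (pval (q (i, 0))) x, ?_, ?_⟩,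
    _, ht, natDegree_polyTrace_le hq⟩
  · exact isPolyOn_of_mem_polyFun fun i => polyFun_mono (Nat.sub_le _ _)
      (Submodule.add_mem _ (hpm (i, 0) 0) (hpm (i, 1) 1))
  · exact hasWeakDiv_poly K.bounded q
  · exact isPolyOn_of_mem_polyFun fun i => Submodule.sub_mem _ (hpm (i, 1) 0) (hpm (i, 0) 1)
  · intro i φ hφ hs
    have hmq (j) : MemLp (pval (q (i, j))) 2 (volume.restrict K.carrier) :=
      memLp_of_continuous (contDiff_pval _).continuous K.bounded
    have hmq' (j l) : MemLp (pd l (pval (q (i, j)))) 2 (volume.restrict K.carrier) :=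
      memLp_of_continuous (contDiff_pd (contDiff_pval _) l).continuous K.bounded
    have i0 (j l) : Integrable (fun x => pval (q (i, j)) x * pd l φ x) (volume.restrict K.carrier) :=
      (hmq j).integrable_mul ((hφ.memLp_pd l).restrict _)
    have i1 (j l) : Integrable (fun x => pd l (pval (q (i, j))) x * φ x)
      (volume.restrict K.carrier) := (hmq' j l).integrable_mul (hφ.memLp.restrict _)
    have h3 := integral_sub (i1 1 0) (i1 0 1)
    simp only [← sub_mul] at h3
    change ∫ x in K.carrier, (pval (q (i, 1)) x * pd 0 φ x - pval (q (i, 0)) x * pd 1 φ x) =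
      -∫ x in K.carrier, (pd 0 (pval (q (i, 1))) x - pd 1 (pval (q (i, 0))) x) * φ x
    rw [integral_sub (i0 1 0) (i0 0 1), h3, setIntegral_mul_pd_eq_neg (contDiff_pval _) hφ hs 0,
      setIntegral_mul_pd_eq_neg (contDiff_pval _) hφ hs 1]
    ring

end Polygon

/-! ### Local norm equivalence -/

/-- If all moments up to degree `k` vanish, expanding one factor of `p²` in monomials gives `∫ p² =
0`, so the moments determine the polynomial. -/
theorem exists_moment_bound (k : ℕ) : ∃ C > 0, ∀ p : Polynomial ℝ, p.natDegree ≤ k →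
    ∫ s in (-1 / 2 : ℝ)..(1 / 2), p.eval s ^ 2 ≤
      C * ∑ β ∈ Finset.range (k + 1), (∫ s in (-1 / 2 : ℝ)..(1 / 2), p.eval s * s ^ β) ^ 2 := by
  have hint (p : Polynomial ℝ) (β : ℕ) :
      IntervalIntegrable (fun s => p.eval s * s ^ β) volume (-1 / 2) (1 / 2) :=
    (p.continuous.mul (continuous_pow β)).intervalIntegrable _ _
  let L₁ : Polynomial.degreeLT ℝ (k + 1) →ₗ[ℝ] Fin (k + 1) → ℝ :=
    { toFun := fun p β => ∫ s in (-1 / 2 : ℝ)..(1 / 2), (p : Polynomial ℝ).eval s * s ^ (β : ℕ)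
      map_add' := fun p q => by
        ext β
        rw [Pi.add_apply, ← intervalIntegral.integral_add (hint _ _) (hint _ _)]
        simp [add_mul]
      map_smul' := fun c p => by
        ext β
        simp [mul_assoc, intervalIntegral.integral_const_mul] }
  let L₂ : Polynomial.degreeLT ℝ (k + 1) →ₗ[ℝ] ℝ → ℝ :=
    { toFun := fun p s => (p : Polynomial ℝ).eval s
      map_add' := fun p q => by ext s; simp
      map_smul' := fun c p => by ext s; simp }
  have : FiniteDimensional ℝ (Polynomial.degreeLT ℝ (k + 1)) :=
    Module.Finite.equiv (Polynomial.degreeLTEquiv ℝ (k + 1)).symm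
  -- The vector of moments is viewed as an `L²` function for the counting measure on the indices.
  obtain ⟨C, hC, H⟩ := exists_integral_sq_le (μ := Measure.count)
    (ν := volume.restrict (Set.Ioc (-1 / 2 : ℝ) (1 / 2))) L₁ L₂
    (fun v => MemLp.of_discrete)
    (fun v => memLp_Ioc (v : Polynomial ℝ).continuous _ _) fun v hv => by
      have h0 (β : Fin (k + 1)) : L₁ v β = 0 := by
        have := (ae_iff.1 hv)
        by_contra hne
        have h1 : Measure.count {a | ¬ L₁ v a = (0 : Fin (k + 1) → ℝ) a} = 0 := this
        rw [Measure.count_eq_zero_iff] at h1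
        exact Set.eq_empty_iff_forall_notMem.1 h1 β hne
      have hI : ∫ s in (-1 / 2 : ℝ)..(1 / 2), (v : Polynomial ℝ).eval s ^ 2 = 0 := by
        have h1 (s : ℝ) : (v : Polynomial ℝ).eval s ^ 2 = ∑ β ∈ Finset.range (k + 1),
            (v : Polynomial ℝ).coeff β * ((v : Polynomial ℝ).eval s * s ^ β) := by
          have h2 : (v : Polynomial ℝ).eval s = ∑ β ∈ Finset.range (k + 1),
              (v : Polynomial ℝ).coeff β * s ^ β := by
            rcases eq_or_ne (v : Polynomial ℝ) 0 with h | h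
            · simp [h]
            · exact Polynomial.eval_eq_sum_range' ((Polynomial.natDegree_lt_iff_degree_lt h).2
                (Polynomial.mem_degreeLT.1 v.2)) s
          rw [pow_two]
          nth_rewrite 2 [h2]
          rw [Finset.mul_sum]
          exact Finset.sum_congr rfl fun β _ => by ring
        simp_rw [h1]
        rw [intervalIntegral.integral_finsetSum fun β _ => (hint _ _).const_mul _]
        refine Finset.sum_eq_zero fun β hβ => ?_
        rw [intervalIntegral.integral_const_mul,
          show ∫ s in (-1 / 2 : ℝ)..(1 / 2), (v : Polynomial ℝ).eval s * s ^ β = 0 from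
            h0 ⟨β, Finset.mem_range.1 hβ⟩, mul_zero]
      refine Subtype.ext (polynomial_eq_zero_of_eqOn (a := -1 / 2) (b := 1 / 2) (by norm_num)
        fun s hs => ?_)
      by_contra hne
      refine absurd hI (ne_of_gt ?_)
      exact intervalIntegral.integral_pos (by norm_num)
        ((v : Polynomial ℝ).continuous.pow 2).continuousOn
        (fun _ _ => sq_nonneg _) ⟨s, ⟨hs.1.le, hs.2.le⟩, by positivity⟩
  refine ⟨C, hC, fun p hp => ?_⟩
  have hmem : p ∈ Polynomial.degreeLT ℝ (k + 1) := by
    rw [Polynomial.mem_degreeLT]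
    exact (Polynomial.degree_le_of_natDegree_le hp).trans_lt (by exact_mod_cast Nat.lt_succ_self k)
  have h := H ⟨p, hmem⟩
  rw [integral_count, ← intervalIntegral.integral_of_le (by norm_num)] at h
  rwa [Finset.sum_range]

theorem sq_moment_le {p : Polynomial ℝ} (β : ℕ) :
    (∫ s in (-1 / 2 : ℝ)..(1 / 2), p.eval s * s ^ β) ^ 2 ≤
      ∫ s in (-1 / 2 : ℝ)..(1 / 2), p.eval s ^ 2 := by
  have h := sq_integral_mul_le (memLp_Ioc p.continuous (-1 / 2) (1 / 2))
    (memLp_Ioc (continuous_pow β) (-1 / 2) (1 / 2))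
  simp only [← intervalIntegral.integral_of_le (show (-1 / 2 : ℝ) ≤ 1 / 2 by norm_num)] at h
  refine h.trans (mul_le_of_le_one_right
    (intervalIntegral.integral_nonneg (by norm_num) fun _ _ => sq_nonneg _) ?_)
  calc ∫ s in (-1 / 2 : ℝ)..(1 / 2), (s ^ β) ^ 2 ≤ ∫ s in (-1 / 2 : ℝ)..(1 / 2), (1 : ℝ) := by
        refine intervalIntegral.integral_mono_on (by norm_num)
          (((continuous_pow β).pow 2).intervalIntegrable _ _) (by simp) fun s hs => ?_
        rw [← pow_mul, mul_comm, pow_mul]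
        exact pow_le_one₀ (sq_nonneg _) (by nlinarith [hs.1, hs.2])
    _ = 1 := by norm_num

namespace Polygon

variable {K : Polygon}

/-- The membership conditions may supply different representatives of the divergence; uniqueness
identifies them, so one polynomial `d` serves both the weak divergence and Green's formula. -/
theorem localSpace_rows {c : Plane} {ρ η₁ η₂ : ℝ} (hη₁ : 0 < η₁) (hη₂ : 0 < η₂)
    (hS : K.Shape c ρ η₁ η₂) {k : ℕ} {τ : Plane → EuclideanSpace ℝ TIdx}
    (hτ : τ ∈ K.localSpace k) (i : Fin 2) :
    ∃ d ∈ polyFun k, ∃ r ∈ polyFun (k - 1),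
      HasRowDiv K.carrier (fun j x => τ x (i, j)) d ∧
      K.RowGreen (fun j x => τ x (i, j)) d (fun e => K.normalTrace τ e i) ∧
      (∀ e, (K.normalTrace τ e i).natDegree ≤ k) ∧
      ∀ φ, IsTest φ → tsupport φ ⊆ K.carrier →
        ∫ x in K.carrier, (τ x (i, 1) * pd 0 φ x - τ x (i, 0) * pd 1 φ x) =
          - ∫ x in K.carrier, r x * φ x := by
  obtain ⟨hm, ⟨d, hd, hdw⟩, ⟨r, hr, hrw⟩, g, hg, hgd⟩ := hτ
  rw [normalTrace_eq hη₁ hη₂ hS hm hg]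
  obtain ⟨d', hd', hdw', hG⟩ := hg
  obtain ⟨q, hq, hqd⟩ := hd.exists_polyField
  obtain ⟨q', hq', hqr⟩ := hr.exists_polyField
  have hdd' : d' =ᵐ[volume.restrict K.carrier] polyField q :=
    (hdw'.unique K.isOpen hd' (hd.memLp K.bounded) hdw).trans hqd
  refine ⟨_, pval_mem_polyFun (hq i), _, pval_mem_polyFun (hq' i),
    (hdw'.congr (ae_eq_refl _) hdd') i, fun φ hφ => ?_, fun e => hgd e i,
    (hrw.congr (ae_eq_refl _) hqr) i⟩
  rw [← hG i φ hφ]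
  exact integral_congr_ae (hdd'.mono fun x hx => by simp only [hx]; rfl)

/-- Sum of the squares of the edge degrees of freedom. -/
def edgeSq (K : Polygon) (k : ℕ) (τ : Plane → EuclideanSpace ℝ TIdx) : ℝ :=
  ∑ e, ∑ i : Fin 2, ∑ β ∈ Finset.range (k + 1), K.edgeDof τ e i β ^ 2

/-- Row by row, `coercive` and the equivalence of moments with the trace norm; edge lengths are at
most `h`, and `h²` is bounded by the area through the inscribed ball. -/
theorem norm_le_edgeSq (k : ℕ) (hk : 1 ≤ k) {η₁ η₂ : ℝ} (hη₁ : 0 < η₁) (hη₂ : 0 < η₂) :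
    ∃ C > 0, ∀ (K : Polygon) (c : Plane) (ρ : ℝ), K.Shape c ρ η₁ η₂ → ∀ τ ∈ K.localSpace k,
    (∀ q ∈ polyFun k, ∀ a, ∫ x in K.carrier, τ x a * q x = 0) →
    ∑ a, ∫ x in K.carrier, τ x a ^ 2 ≤ C * (K.area * K.edgeSq k τ) := by
  obtain ⟨C₁, hC₁, H₁⟩ := coercive k hk hη₁
  obtain ⟨C₂, hC₂, H₂⟩ := exists_moment_bound k
  have hB := volume_real_ball_pos hη₁
  refine ⟨C₁ * C₂ / volume.real (Metric.ball (0 : Plane) η₁), by positivity,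
    fun K c ρ hS τ hτ hq => ?_⟩
  have hh := K.diam_pos
  have hrow (i : Fin 2) : ∑ j, ∫ x in K.carrier, τ x (i, j) ^ 2 ≤
      C₁ * C₂ * (K.diam ^ 2 * ∑ e, ∑ β ∈ Finset.range (k + 1), K.edgeDof τ e i β ^ 2) := by
    obtain ⟨d, hd, r, hr, -, hG, hdeg, hcurl⟩ := localSpace_rows hη₁ hη₂ hS hτ i
    refine (H₁ η₂ K c ρ hS _ d r _ (fun j => memLp_apply hτ.1 (i, j)) hd hG hr hcurl
      fun q hq' j => hq q hq' (i, j)).trans ?_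
    rw [mul_assoc]
    refine mul_le_mul_of_nonneg_left ?_ hC₁.le
    rw [pow_two, mul_assoc, mul_left_comm]
    refine mul_le_mul_of_nonneg_left ?_ hh.le
    rw [Finset.mul_sum, Finset.mul_sum]
    refine Finset.sum_le_sum fun e _ => ?_
    rw [mul_left_comm]
    exact mul_le_mul (K.edgeLength_le_diam e) (H₂ _ (hdeg e))
      (intervalIntegral.integral_nonneg (by norm_num) fun _ _ => sq_nonneg _) hh.le
  have hsum : ∑ a, ∫ x in K.carrier, τ x a ^ 2 ≤ C₁ * C₂ * (K.diam ^ 2 * K.edgeSq k τ) := by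
    have e1 : K.edgeSq k τ =
        ∑ i : Fin 2, ∑ e, ∑ β ∈ Finset.range (k + 1), K.edgeDof τ e i β ^ 2 := by
      rw [edgeSq, Finset.sum_comm]
    rw [Fintype.sum_prod_type, e1, Finset.mul_sum, Finset.mul_sum]
    exact Finset.sum_le_sum fun i _ => hrow i
  refine hsum.trans ?_
  have h0 : 0 ≤ K.edgeSq k τ := Finset.sum_nonneg fun _ _ => Finset.sum_nonneg fun _ _ =>
    Finset.sum_nonneg fun _ _ => sq_nonneg _
  rw [div_mul_eq_mul_div, le_div_iff₀ hB]
  have := mul_le_mul_of_nonneg_left (mul_le_mul_of_nonneg_right hS.le_area h0)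
    (show 0 ≤ C₁ * C₂ by positivity)
  linarith

/-- The bound of `trace_le` is summed over edges, and `h² ‖div τ‖²` is then absorbed by the inverse
estimate. -/
theorem edgeSq_le_norm (k : ℕ) {η₁ η₂ : ℝ} (hη₁ : 0 < η₁) (hη₂ : 0 < η₂) :
    ∃ C > 0, ∀ (K : Polygon) (c : Plane) (ρ : ℝ), K.Shape c ρ η₁ η₂ → ∀ τ ∈ K.localSpace k,
    K.area * K.edgeSq k τ ≤ C * ∑ a, ∫ x in K.carrier, τ x a ^ 2 := by
  obtain ⟨C₁, hC₁, H₁⟩ := trace_le k hη₁ hη₂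
  obtain ⟨C₂, hC₂, H₂⟩ := inverse_div k hη₁
  have hB : 0 < volume.real (Metric.closedBall (0 : Plane) 1) :=
    (volume_real_ball_pos one_pos).trans_le (measureReal_mono Metric.ball_subset_closedBall
      Metric.isBounded_closedBall.measure_lt_top.ne)
  refine ⟨volume.real (Metric.closedBall (0 : Plane) 1) * ((k + 1) * (C₁ * (1 + C₂))),
    by positivity, fun K c ρ hS τ hτ => ?_⟩
  have hh := K.diam_pos
  have hS' := hS.toStar
  have hrow (i : Fin 2) :
      K.diam ^ 2 * ∑ e, ∑ β ∈ Finset.range (k + 1), K.edgeDof τ e i β ^ 2 ≤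
        (k + 1) * (C₁ * (1 + C₂)) * ∑ j, ∫ x in K.carrier, τ x (i, j) ^ 2 := by
    obtain ⟨d, hd, r, hr, hD, hG, hdeg, hcurl⟩ := localSpace_rows hη₁ hη₂ hS hτ i
    have htm (j) := memLp_apply hτ.1 (i, j)
    have hdm := memLp_polyFun hd K.bounded
    have h1 (e) := H₁ K c ρ hS _ d _ htm hdm hG e (hdeg e)
    have h2 := H₂ K.carrier c K.diam hh K.isOpen.measurableSet hS.ball_subset'
      hS'.subset_closedBall _ d htm hd hD
    have h3 (e) : K.diam ^ 2 * ∑ β ∈ Finset.range (k + 1), K.edgeDof τ e i β ^ 2 ≤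
        (k + 1) * (C₁ * ((∑ j, ∫ x in K.tri c e, τ x (i, j) ^ 2) +
          K.diam ^ 2 * ∫ x in K.tri c e, d x ^ 2)) := by
      have h4 : ∑ β ∈ Finset.range (k + 1), K.edgeDof τ e i β ^ 2 ≤
          (k + 1) * ∫ s in (-1 / 2 : ℝ)..(1 / 2), (K.normalTrace τ e i).eval s ^ 2 := by
        refine (Finset.sum_le_card_nsmul _ _ _ fun β _ => sq_moment_le β).trans_eq ?_
        simp
      calc _ ≤ K.diam ^ 2 * ((k + 1) *
            ∫ s in (-1 / 2 : ℝ)..(1 / 2), (K.normalTrace τ e i).eval s ^ 2) :=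
            mul_le_mul_of_nonneg_left h4 (sq_nonneg _)
        _ = (k + 1) * (K.diam ^ 2 *
            ∫ s in (-1 / 2 : ℝ)..(1 / 2), (K.normalTrace τ e i).eval s ^ 2) := by ring
        _ ≤ _ := mul_le_mul_of_nonneg_left (h1 e) (by positivity)
    calc _ ≤ ∑ e, (k + 1) * (C₁ * ((∑ j, ∫ x in K.tri c e, τ x (i, j) ^ 2) +
          K.diam ^ 2 * ∫ x in K.tri c e, d x ^ 2)) := by
          rw [Finset.mul_sum]
          exact Finset.sum_le_sum fun e _ => h3 e
      _ = (k + 1) * (C₁ * ((∑ j, ∫ x in K.carrier, τ x (i, j) ^ 2) +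
          K.diam ^ 2 * ∫ x in K.carrier, d x ^ 2)) := by
          -- The triangles tile the element, so the local bounds add up to each integral exactly
          -- once and the number of edges does not enter.
          rw [← Finset.mul_sum, ← Finset.mul_sum, Finset.sum_add_distrib, ← Finset.mul_sum,
            Finset.sum_comm, hS'.integral_eq_sum hdm.integrable_sq,
            Finset.sum_congr rfl fun j _ => (hS'.integral_eq_sum (htm j).integrable_sq).symm]
      _ ≤ (k + 1) * (C₁ * ((∑ j, ∫ x in K.carrier, τ x (i, j) ^ 2) +
          C₂ * ∑ j, ∫ x in K.carrier, τ x (i, j) ^ 2)) := by gcongr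
      _ = _ := by ring
  have h0 : 0 ≤ K.edgeSq k τ := Finset.sum_nonneg fun _ _ => Finset.sum_nonneg fun _ _ =>
    Finset.sum_nonneg fun _ _ => sq_nonneg _
  calc K.area * K.edgeSq k τ
      ≤ K.diam ^ 2 * volume.real (Metric.closedBall (0 : Plane) 1) * K.edgeSq k τ :=
        mul_le_mul_of_nonneg_right hS'.area_le h0
    _ = volume.real (Metric.closedBall (0 : Plane) 1) * (K.diam ^ 2 *
        ∑ i : Fin 2, ∑ e, ∑ β ∈ Finset.range (k + 1), K.edgeDof τ e i β ^ 2) := by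
        rw [edgeSq, Finset.sum_comm]; ring
    _ ≤ volume.real (Metric.closedBall (0 : Plane) 1) * ((k + 1) * (C₁ * (1 + C₂)) *
        ∑ a, ∫ x in K.carrier, τ x a ^ 2) := by
        refine mul_le_mul_of_nonneg_left ?_ hB.le
        rw [Fintype.sum_prod_type, Finset.mul_sum, Finset.mul_sum]
        exact Finset.sum_le_sum fun i _ => hrow i
    _ = _ := by ring

/-- Linearity rests on uniqueness of the normal trace and is therefore restricted to the local
space. -/
theorem edgeDof_lincomb {c : Plane} {ρ η₁ η₂ : ℝ} (hη₁ : 0 < η₁) (hη₂ : 0 < η₂)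
    (hS : K.Shape c ρ η₁ η₂) {k : ℕ} {σ τ υ : Plane → EuclideanSpace ℝ TIdx}
    (hσ : σ ∈ K.localSpace k) (hτ : τ ∈ K.localSpace k) {a : ℝ}
    (hυ : υ =ᵐ[volume.restrict K.carrier] fun x => a • σ x + τ x) (e : Fin (K.m + 3)) (i : Fin 2)
    (β : ℕ) : K.edgeDof υ e i β = a * K.edgeDof σ e i β + K.edgeDof τ e i β := by
  obtain ⟨hm, -, -, g, hg, -⟩ := hσ
  obtain ⟨hm', -, -, g', hg', -⟩ := hτ
  have h := (hg.lincomb hm hm' hg' a).congr hυ.symm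
  have hυm : MemLp υ 2 (volume.restrict K.carrier) := ((hm.const_smul a).add hm').ae_eq hυ.symm
  rw [edgeDof, edgeDof, edgeDof, normalTrace_eq hη₁ hη₂ hS hυm h,
    normalTrace_eq hη₁ hη₂ hS hm hg, normalTrace_eq hη₁ hη₂ hS hm' hg']
  have hint (p : Polynomial ℝ) :
      IntervalIntegrable (fun s => p.eval s * s ^ β) volume (-1 / 2) (1 / 2) :=
    (p.continuous.mul (continuous_pow β)).intervalIntegrable _ _
  rw [← intervalIntegral.integral_const_mul,
    ← intervalIntegral.integral_add ((hint _).const_mul a) (hint _)]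
  congr 1
  ext s
  simp
  ring

end Polygon

/-! ### The mesh and piecewise polynomials -/

variable {D : PolyDomain}

theorem Polygon.ShapeRegular.exists_shape {K : Polygon} {η₁ η₂ : ℝ} (h : K.ShapeRegular η₁ η₂)
    (hη₁ : 0 < η₁) : ∃ c ρ, K.Shape c ρ η₁ η₂ := by
  obtain ⟨⟨c, ρ, hρ, hst⟩, he⟩ := h
  exact ⟨c, ρ, ⟨⟨(mul_pos hη₁ K.diam_pos).trans hρ, hst⟩, hρ, he⟩⟩

theorem Mesh.ae_eq_iUnion (M : Mesh D) :
    D.carrier =ᵐ[volume] ⋃ i, (M.elem i).carrier := by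
  refine Filter.EventuallyLE.antisymm ?_
    (Set.iUnion_subset M.subset).eventuallyLE
  have h : ∀ᵐ x : Plane, ∀ i, x ∉ frontier (M.elem i).carrier :=
    ae_all_iff.2 fun i => measure_eq_zero_iff_ae_notMem.1 (M.elem i).volume_frontier
  filter_upwards [h] with x hx hxD
  have hx' : x ∈ closure D.carrier := subset_closure hxD
  rw [M.cover] at hx'
  obtain ⟨i, hi⟩ := Set.mem_iUnion.1 hx'
  refine Set.mem_iUnion.2 ⟨i, ?_⟩
  by_contra hn
  exact hx i ⟨hi, by rwa [(M.elem i).isOpen.interior_eq]⟩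

theorem Mesh.ae_of_elem (M : Mesh D) {p : Plane → Prop}
    (h : ∀ i, ∀ᵐ x ∂(volume.restrict (M.elem i).carrier), p x) :
    ∀ᵐ x ∂(volume.restrict D.carrier), p x := by
  rw [Measure.restrict_congr_set M.ae_eq_iUnion]
  exact (ae_restrict_iUnion_iff _ _).2 h

theorem Mesh.integral_eq_sum (M : Mesh D) {f : Plane → ℝ} (hf : IntegrableOn f D.carrier) :
    ∫ x in D.carrier, f x = ∑ i, ∫ x in (M.elem i).carrier, f x := by
  rw [setIntegral_congr_set M.ae_eq_iUnion, integral_iUnion_fintype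
    (fun i => (M.elem i).isOpen.measurableSet) (fun i j h => M.disjoint i j h)
    fun i => hf.mono_set (M.subset i)]

theorem L2_memLp {ι : Type} [Fintype ι] (u : L2 D.carrier ι) (a : ι) :
    MemLp (fun x => u x a) 2 (volume.restrict D.carrier) :=
  memLp_apply (Lp.memLp u) a

theorem L2_memLp_elem {ι : Type} [Fintype ι] (M : Mesh D) (i : Fin M.N) (u : L2 D.carrier ι) :
    MemLp u 2 (volume.restrict (M.elem i).carrier) :=
  (Lp.memLp u).mono_measure (Measure.restrict_mono (M.subset i) le_rfl)

theorem L2_inner_eq {ι : Type} [Fintype ι] (M : Mesh D) (u w : L2 D.carrier ι) :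
    inner ℝ u w = ∑ i, ∑ a, ∫ x in (M.elem i).carrier, u x a * w x a := by
  have hi (a) : Integrable (fun x => u x a * w x a) (volume.restrict D.carrier) :=
    (L2_memLp u a).integrable_mul (L2_memLp w a)
  have h1 (x : Plane) : inner ℝ (u x) (w x) = ∑ a, u x a * w x a := by
    simp [PiLp.inner_apply, mul_comm]
  rw [L2.inner_def]
  simp_rw [h1]
  rw [M.integral_eq_sum (integrable_finsetSum _ fun a _ => hi a)]
  refine Finset.sum_congr rfl fun i _ => integral_finsetSum _ fun a _ => ?_
  exact (hi a).mono_measure (Measure.restrict_mono (M.subset i) le_rfl)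

theorem L2_norm_sq_eq {ι : Type} [Fintype ι] (M : Mesh D) (u : L2 D.carrier ι) :
    ‖u‖ ^ 2 = ∑ i, ∑ a, ∫ x in (M.elem i).carrier, u x a ^ 2 := by
  rw [← real_inner_self_eq_norm_sq, L2_inner_eq M]
  simp_rw [pow_two]

/-! ### Assembling piecewise polynomials from elementwise ones. -/

section Glue

variable {ι : Type} (M : Mesh D) {k : ℕ}

/-- The piecewise polynomial field with given polynomials on the elements. -/
def glueFun (p : Fin M.N → ι → polyFun k) (x : Plane) : EuclideanSpace ℝ ι :=
  WithLp.toLp 2 fun a => ∑ i, (M.elem i).carrier.indicator (p i a : Plane → ℝ) x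

theorem glueFun_apply (p : Fin M.N → ι → polyFun k) {i : Fin M.N} {x : Plane}
    (hx : x ∈ (M.elem i).carrier) (a : ι) : glueFun M p x a = (p i a : Plane → ℝ) x := by
  simp only [glueFun]
  rw [Finset.sum_eq_single i]
  · simp [hx]
  · intro j _ hj
    exact Set.indicator_of_notMem (fun h => (M.disjoint j i hj).le_bot ⟨h, hx⟩) _
  · simp

variable [Fintype ι]

theorem memLp_glueFun (p : Fin M.N → ι → polyFun k) :
    MemLp (glueFun M p) 2 (volume.restrict D.carrier) := by
  refine MemLp.of_eval_piLp fun a => ?_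
  change MemLp (fun x => ∑ i, (M.elem i).carrier.indicator (p i a : Plane → ℝ) x) 2 _
  refine memLp_finsetSum _ fun i _ => ?_
  exact (memLp_polyFun (p i a).2 D.bounded).indicator (M.elem i).isOpen.measurableSet

/-- Gluing polynomials, as a linear map. -/
def glue : (Fin M.N → ι → polyFun k) →ₗ[ℝ] L2 D.carrier ι where
  toFun p := (memLp_glueFun M p).toLp
  map_add' p q := by
    rw [← MemLp.toLp_add]
    congr 1
    ext x a
    simp only [glueFun, Pi.add_apply, PiLp.add_apply, ← Finset.sum_add_distrib]
    refine Finset.sum_congr rfl fun i _ => ?_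
    by_cases h : x ∈ (M.elem i).carrier <;> simp [h]
  map_smul' c p := by
    rw [RingHom.id_apply, ← MemLp.toLp_const_smul]
    congr 1
    ext x a
    simp only [glueFun, Pi.smul_apply, PiLp.smul_apply, smul_eq_mul, Finset.mul_sum]
    refine Finset.sum_congr rfl fun i _ => ?_
    by_cases h : x ∈ (M.elem i).carrier <;> simp [h]

theorem glue_ae (p : Fin M.N → ι → polyFun k) (i : Fin M.N) :
    ∀ᵐ x ∂(volume.restrict (M.elem i).carrier), ∀ a, glue M p x a = (p i a : Plane → ℝ) x := by
  filter_upwards [ae_restrict_elem M i (memLp_glueFun M p).coeFn_toLp,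
    ae_restrict_mem (M.elem i).isOpen.measurableSet] with x hx hxi a
  change ((memLp_glueFun M p).toLp _ : Plane → EuclideanSpace ℝ ι) x a = _
  rw [hx, glueFun_apply M p hxi]

theorem glue_mem (p : Fin M.N → ι → polyFun k) : glue M p ∈ pwPoly M k ι := by
  intro i
  choose q hq hqe using fun a => mem_polyFun.1 (p i a).2
  refine ⟨q, hq, ?_⟩
  filter_upwards [glue_ae M p i] with x hx a
  rw [hx a, hqe a]

theorem pwPoly_le_range_glue : pwPoly M k ι ≤ LinearMap.range (glue (ι := ι) (k := k) M) := by
  intro u hu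
  choose q hq hqe using hu
  refine ⟨fun i a => ⟨pval (q i a), pval_mem_polyFun (hq i a)⟩, Lp.ext ?_⟩
  refine M.ae_of_elem fun i => ?_
  filter_upwards [glue_ae M (fun i a => ⟨pval (q i a), pval_mem_polyFun (hq i a)⟩) i,
    hqe i] with x h1 h2
  ext a
  rw [h1 a, h2 a]

instance : FiniteDimensional ℝ (pwPoly M k ι) :=
  Submodule.finiteDimensional_of_le (pwPoly_le_range_glue M)

end Glue

/-! ### Orthogonality and locality of the projection. -/

theorem proj_mem (M : Mesh D) (k : ℕ) (τ : L2 D.carrier TIdx) : proj M k τ ∈ pwPoly M k TIdx := by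
  have h : (pwPoly M k TIdx).topologicalClosure = pwPoly M k TIdx :=
    (Submodule.closed_of_finiteDimensional _).submodule_topologicalClosure_eq
  have := Submodule.starProjection_apply_mem (pwPoly M k TIdx).topologicalClosure τ
  rw [proj]
  exact h.le this

theorem inner_sub_proj (M : Mesh D) (k : ℕ) (τ : L2 D.carrier TIdx) {p : L2 D.carrier TIdx}
    (hp : p ∈ pwPoly M k TIdx) : inner ℝ (τ - proj M k τ) p = 0 := by
  have := (pwPoly M k TIdx).topologicalClosure.sub_starProjection_mem_orthogonal τ
  exact (Submodule.mem_orthogonal' _ _).1 this p (Submodule.le_topologicalClosure _ hp)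

theorem norm_sq_eq_proj (M : Mesh D) (k : ℕ) (τ : L2 D.carrier TIdx) :
    ‖τ‖ ^ 2 = ‖proj M k τ‖ ^ 2 + ‖τ - proj M k τ‖ ^ 2 := by
  have h := inner_sub_proj M k τ (proj_mem M k τ)
  have h1 : τ = proj M k τ + (τ - proj M k τ) := by abel
  have h2 := norm_add_sq_real (proj M k τ) (τ - proj M k τ)
  rw [← h1, real_inner_comm, h] at h2
  linarith

theorem proj_lincomb (M : Mesh D) (k : ℕ) (σ τ : L2 D.carrier TIdx) (a : ℝ) :
    proj M k (a • σ + τ) = a • proj M k σ + proj M k τ := by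
  simp [proj]

/-- A polynomial in one component on one element, extended by zero, is an admissible piecewise
polynomial, so the global orthogonality localises. -/
theorem integral_sub_proj_mul (M : Mesh D) (k : ℕ) (τ : L2 D.carrier TIdx) (i : Fin M.N)
    {q : Plane → ℝ} (hq : q ∈ polyFun k) (a : TIdx) :
    ∫ x in (M.elem i).carrier, (τ - proj M k τ : L2 D.carrier TIdx) x a * q x = 0 := by
  classical
  set p : Fin M.N → TIdx → polyFun k := Pi.single i (Pi.single a ⟨q, hq⟩) with hp
  have h := inner_sub_proj M k τ (glue_mem M p)
  have hz (j : Fin M.N) (b : TIdx) : ∫ x in (M.elem j).carrier,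
      (τ - proj M k τ : L2 D.carrier TIdx) x b * glue M p x b =
      ∫ x in (M.elem j).carrier, (τ - proj M k τ : L2 D.carrier TIdx) x b *
        (p j b : Plane → ℝ) x :=
    integral_congr_ae ((glue_ae M p j).mono fun x hx => by simp only [hx b])
  rw [L2_inner_eq M, Finset.sum_eq_single i, Finset.sum_eq_single a] at h
  · rw [hz] at h
    simpa [hp] using h
  · intro b _ hb
    rw [hz]
    simp [hp, hb]
  · simp
  · intro j _ hj
    refine Finset.sum_eq_zero fun b _ => ?_
    rw [hz]
    simp [hp, hj]
  · simp

/-! ### The discrete bilinear forms -/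

variable {D : PolyDomain}

theorem pval_pderiv (j : Fin 2) (q : MvPolynomial (Fin 2) ℝ) :
    pval (MvPolynomial.pderiv j q) = pd j (pval q) := by
  induction q using MvPolynomial.induction_on with
  | C a =>
    ext x
    have h : pval (MvPolynomial.C a) = fun _ => a := by ext y; simp [pval]
    rw [h, pd_const]
    simp [pval]
  | add p q hp hq =>
    ext x
    have h : pval (p + q) = pval p + pval q := by ext y; simp [pval]
    rw [h, pd_add j (diffAt_of_contDiff (contDiff_pval p) x)
      (diffAt_of_contDiff (contDiff_pval q) x), ← hp, ← hq]
    simp [pval]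
  | mul_X p n hp =>
    ext x
    have h : pval (p * MvPolynomial.X n) = fun y => pval p y * y n := by ext y; simp [pval]
    rw [h, pd_mul j (diffAt_of_contDiff (contDiff_pval p) x)
      (diffAt_of_contDiff (by fun_prop) x), ← hp, pd_coord]
    rw [Derivation.leibniz, MvPolynomial.pderiv_X]
    simp only [pval, smul_eq_mul, map_add, map_mul, MvPolynomial.eval_X]
    by_cases hjn : j = n
    · subst hjn; simp
    · simp [Ne.symm hjn]

theorem interiorDof_sub_proj (M : Mesh D) {k : ℕ} (τ : L2 D.carrier TIdx) (i : Fin M.N)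
    {g : TIdx → MvPolynomial (Fin 2) ℝ} (hg : ∀ a, pval (g a) ∈ polyFun k) :
    (M.elem i).interiorDof (τ - proj M k τ : L2 D.carrier TIdx) g = 0 := by
  rw [Polygon.interiorDof, integral_finsetSum _ fun a _ => ?_,
    Finset.sum_eq_zero fun a _ => integral_sub_proj_mul M k τ i (hg a) a, mul_zero]
  exact (memLp_apply (L2_memLp_elem M i _) a).integrable_mul
    (memLp_polyFun (hg a) (M.elem i).bounded)

/-- The edge part of the stabilisation. -/
def Polygon.edgeProd (K : Polygon) (k : ℕ) (σ τ : Plane → EuclideanSpace ℝ TIdx) : ℝ :=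
  ∑ e, ∑ i : Fin 2, ∑ β ∈ Finset.range (k + 1), K.edgeDof σ e i β * K.edgeDof τ e i β

theorem Polygon.edgeProd_self (K : Polygon) (k : ℕ) (τ : Plane → EuclideanSpace ℝ TIdx) :
    K.edgeProd k τ τ = K.edgeSq k τ := by
  simp only [edgeProd, edgeSq, pow_two]

/-- All interior test tensors have degree at most `k`, so their moments against the remainders of
the projection vanish and only the edge part survives. -/
theorem stab_sub_proj {M : Mesh D} {k : ℕ} (hk : 1 ≤ k) {i : Fin M.N}
    (B : InteriorBasis k (M.elem i)) (σ τ : L2 D.carrier TIdx) :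
    stab B (σ - proj M k σ : L2 D.carrier TIdx) (τ - proj M k τ : L2 D.carrier TIdx) =
      (M.elem i).area * (M.elem i).edgeProd k (σ - proj M k σ : L2 D.carrier TIdx)
        (τ - proj M k τ : L2 D.carrier TIdx) := by
  have h1 (l) (a) : pval (B.grad l a) ∈ polyFun k := by
    have h : B.grad l ∈ gradPoly (k - 1) := by
      rw [← B.grad_span]
      exact Submodule.subset_span ⟨l, rfl⟩
    obtain ⟨q, hq, hqe⟩ := h
    rw [show B.grad l a = MvPolynomial.pderiv a.2 (q a.1) from hqe a.1 a.2, pval_pderiv]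
    exact pd_mem_polyFun (pval_mem_polyFun ((hq a.1).trans (by omega))) _
  have h2 (l) (a) : pval (B.perp l a) ∈ polyFun k := by
    have h : B.perp l ∈ gradPolyPerp k (M.elem i) := by
      rw [← B.perp_span]
      exact Submodule.subset_span ⟨l, rfl⟩
    exact pval_mem_polyFun (h.1 a)
  simp only [stab, fun l => interiorDof_sub_proj M σ i (h1 l),
    fun l => interiorDof_sub_proj M σ i (h2 l), zero_mul, Finset.sum_const_zero, add_zero,
    Polygon.edgeProd]

/-- The broken virtual space: no continuity of normal traces across edges. -/
def brokenSpace (M : Mesh D) (k : ℕ) : Submodule ℝ (L2 D.carrier TIdx) where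
  carrier := {τ | ∀ i, (τ : Plane → EuclideanSpace ℝ TIdx) ∈ (M.elem i).localSpace k}
  zero_mem' := fun i => by
    have h0 (n : ℕ) : IsPolyOn n (M.elem i).carrier
        (fun _ => (0 : EuclideanSpace ℝ (Fin 2))) :=
      isPolyOn_of_mem_polyFun fun a => const_mem_polyFun n 0
    have h : (fun _ => (0 : EuclideanSpace ℝ TIdx)) ∈ (M.elem i).localSpace k :=
      ⟨MemLp.zero', ⟨_, h0 k, fun _ _ _ _ => by simp⟩, ⟨_, h0 (k - 1), fun _ _ _ _ => by simp⟩,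
        0, Polygon.isNormalTrace_zero, fun _ _ => by simp⟩
    refine Polygon.localSpace_congr h ?_
    filter_upwards [ae_restrict_elem M i
      (Lp.coeFn_zero (EuclideanSpace ℝ TIdx) 2 (volume.restrict D.carrier))] with x hx
    rw [hx]; rfl
  add_mem' := fun {σ τ} hσ hτ i => by
    refine Polygon.localSpace_congr (Polygon.localSpace_lincomb (hσ i) (hτ i) 1) ?_
    filter_upwards [ae_restrict_elem M i (Lp.coeFn_add σ τ)] with x hx
    rw [hx, one_smul]; rfl
  smul_mem' := fun c σ hσ i => by
    -- The combination lemma always adds a second field, hence `c σ` is written as `(c - 1) σ + σ`.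
    refine Polygon.localSpace_congr (Polygon.localSpace_lincomb (hσ i) (hσ i) (c - 1)) ?_
    filter_upwards [ae_restrict_elem M i (Lp.coeFn_smul c σ)] with x hx
    rw [hx, Pi.smul_apply]
    module

theorem pwPoly_le_brokenSpace {M : Mesh D} {k : ℕ} {η₁ η₂ : ℝ} (hη₁ : 0 < η₁)
    (hM : ∀ i, (M.elem i).ShapeRegular η₁ η₂) : pwPoly M k TIdx ≤ brokenSpace M k := by
  intro p hp i
  obtain ⟨c, ρ, hS⟩ := (hM i).exists_shape hη₁
  obtain ⟨q, hq, hpq⟩ := (hp i).exists_polyField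
  exact Polygon.localSpace_congr (Polygon.polyField_mem_localSpace hS.toStar hq) hpq.symm

theorem sub_proj_mem {M : Mesh D} {k : ℕ} {η₁ η₂ : ℝ} (hη₁ : 0 < η₁)
    (hM : ∀ i, (M.elem i).ShapeRegular η₁ η₂) {τ : L2 D.carrier TIdx}
    (hτ : τ ∈ brokenSpace M k) : τ - proj M k τ ∈ brokenSpace M k :=
  Submodule.sub_mem _ hτ (pwPoly_le_brokenSpace hη₁ hM (proj_mem M k τ))

theorem coeFn_lincomb {ι : Type} [Fintype ι] (M : Mesh D) (i : Fin M.N) (σ τ : L2 D.carrier ι)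
    (a : ℝ) : (a • σ + τ : L2 D.carrier ι) =ᵐ[volume.restrict (M.elem i).carrier]
      fun x => a • σ x + τ x := by
  filter_upwards [ae_restrict_elem M i (Lp.coeFn_add (a • σ) τ),
    ae_restrict_elem M i (Lp.coeFn_smul a σ)] with x h1 h2
  rw [h1, Pi.add_apply, h2, Pi.smul_apply]

theorem edgeDof_sub_proj_lincomb {M : Mesh D} {k : ℕ} {η₁ η₂ : ℝ} (hη₁ : 0 < η₁) (hη₂ : 0 < η₂)
    (hM : ∀ i, (M.elem i).ShapeRegular η₁ η₂) {σ τ : L2 D.carrier TIdx}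
    (hσ : σ ∈ brokenSpace M k) (hτ : τ ∈ brokenSpace M k) (a : ℝ) (i : Fin M.N)
    (e : Fin ((M.elem i).m + 3)) (j : Fin 2) (β : ℕ) :
    (M.elem i).edgeDof (a • σ + τ - proj M k (a • σ + τ) : L2 D.carrier TIdx) e j β =
      a * (M.elem i).edgeDof (σ - proj M k σ : L2 D.carrier TIdx) e j β +
        (M.elem i).edgeDof (τ - proj M k τ : L2 D.carrier TIdx) e j β := by
  obtain ⟨c, ρ, hS⟩ := (hM i).exists_shape hη₁
  have h : a • σ + τ - proj M k (a • σ + τ) = a • (σ - proj M k σ) + (τ - proj M k τ) := by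
    rw [proj_lincomb]; module
  rw [h]
  exact Polygon.edgeDof_lincomb hη₁ hη₂ hS (sub_proj_mem hη₁ hM hσ i) (sub_proj_mem hη₁ hM hτ i)
    (coeFn_lincomb M i _ _ a) e j β

/-! Compliance -/

theorem inner_compliance (P : Lame) (A B : EuclideanSpace ℝ TIdx) :
    inner ℝ (compliance P A) B = 1 / (2 * P.μ) * ((∑ a, A a * B a) -
      P.lam / (2 * P.μ + 2 * P.lam) * (tr A * tr B)) := by
  simp only [PiLp.inner_apply, compliance, tr, Fintype.sum_prod_type, Fin.sum_univ_two]
  simp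
  ring

/-- With `κ = λ / (2 μ + 2 λ)` positivity of the moduli gives `κ < 1 / 2`, and `tr(A)² ≤ 2 |A|²`.
The minimum in the lower constant covers both signs of `κ`. -/
theorem compliance_bounds (P : Lame) : ∃ c > 0, ∃ C > 0, ∀ A : EuclideanSpace ℝ TIdx,
    c * ∑ a, A a ^ 2 ≤ inner ℝ (compliance P A) A ∧
      inner ℝ (compliance P A) A ≤ C * ∑ a, A a ^ 2 := by
  have hμ := P.μ_pos
  have hb := P.bulk_pos
  set κ := P.lam / (2 * P.μ + 2 * P.lam) with hκ
  have hκ1 : 2 * κ < 1 := by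
    have : κ < 1 / 2 := by rw [hκ, div_lt_iff₀ hb]; linarith
    linarith
  refine ⟨1 / (2 * P.μ) * min 1 (1 - 2 * κ),
    mul_pos (by positivity) (lt_min one_pos (by linarith)),
    1 / (2 * P.μ) * (1 + 2 * |κ|), by positivity, fun A => ?_⟩
  rw [inner_compliance, mul_assoc, mul_assoc]
  have ht : tr A * tr A ≤ 2 * ∑ a, A a ^ 2 := by
    simp only [tr, Fintype.sum_prod_type, Fin.sum_univ_two]
    nlinarith [sq_nonneg (A (0, 0) - A (1, 1)), sq_nonneg (A (0, 1)), sq_nonneg (A (1, 0))]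
  have ht0 : 0 ≤ tr A * tr A := mul_self_nonneg _
  have hs : ∑ a, A a * A a = ∑ a, A a ^ 2 := by simp_rw [pow_two]
  rw [hs, ← hκ]
  set S := ∑ a, A a ^ 2 with hS
  have hS0 : 0 ≤ S := Finset.sum_nonneg fun _ _ => sq_nonneg _
  refine ⟨mul_le_mul_of_nonneg_left ?_ (by positivity),
    mul_le_mul_of_nonneg_left ?_ (by positivity)⟩
  · rcases le_total κ 0 with h | h
    · have := mul_le_mul_of_nonneg_right (min_le_left 1 (1 - 2 * κ)) hS0
      nlinarith [mul_nonneg (neg_nonneg.2 h) ht0]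
    · have := mul_le_mul_of_nonneg_right (min_le_right 1 (1 - 2 * κ)) hS0
      nlinarith
  · have h1 := neg_abs_le κ
    have h2 := mul_le_mul_of_nonneg_right h1 ht0
    have h3 := mul_le_mul_of_nonneg_left ht (abs_nonneg κ)
    linarith

theorem integrable_compliance (P : Lame) (M : Mesh D) (i : Fin M.N) (σ τ : L2 D.carrier TIdx) :
    Integrable (fun x => inner ℝ (compliance P (σ x)) (τ x))
      (volume.restrict (M.elem i).carrier) := by
  have hσ (a) := memLp_apply (L2_memLp_elem M i σ) a
  have hτ (a) := memLp_apply (L2_memLp_elem M i τ) a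
  simp_rw [inner_compliance]
  refine Integrable.const_mul (Integrable.sub (integrable_finsetSum _ fun a _ =>
    (hσ a).integrable_mul (hτ a)) (Integrable.const_mul ?_ _)) _
  exact ((hσ _).add (hσ _)).integrable_mul ((hτ _).add (hτ _))

theorem form_eq {M : Mesh D} {k : ℕ} (hk : 1 ≤ k) (B : ∀ i, InteriorBasis k (M.elem i)) (P : Lame)
    (σ τ : L2 D.carrier TIdx) : form B P σ τ =
      ∑ i, ((∫ x in (M.elem i).carrier, inner ℝ (compliance P (proj M k σ x)) (proj M k τ x)) +
        (M.elem i).area * (M.elem i).edgeProd k (σ - proj M k σ : L2 D.carrier TIdx)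
          (τ - proj M k τ : L2 D.carrier TIdx)) := by
  simp only [form, stab_sub_proj hk]

theorem form_symm {M : Mesh D} {k : ℕ} (hk : 1 ≤ k) (B : ∀ i, InteriorBasis k (M.elem i))
    (P : Lame) (σ τ : L2 D.carrier TIdx) : form B P σ τ = form B P τ σ := by
  rw [form_eq hk, form_eq hk]
  refine Finset.sum_congr rfl fun i _ => ?_
  congr 1
  · refine integral_congr_ae (ae_of_all _ fun x => ?_)
    simp only [inner_compliance]
    rw [mul_comm (tr _), Finset.sum_congr rfl fun a _ => mul_comm _ _]
  · simp only [Polygon.edgeProd]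
    congr 1
    exact Finset.sum_congr rfl fun e _ => Finset.sum_congr rfl fun j _ =>
      Finset.sum_congr rfl fun β _ => mul_comm _ _

/-- Restricted to the broken space in the first argument, since edge moments are linear only where
polynomial normal traces exist. -/
theorem form_lincomb {M : Mesh D} {k : ℕ} (hk : 1 ≤ k) {η₁ η₂ : ℝ} (hη₁ : 0 < η₁) (hη₂ : 0 < η₂)
    (hM : ∀ i, (M.elem i).ShapeRegular η₁ η₂) (B : ∀ i, InteriorBasis k (M.elem i)) (P : Lame)
    {σ τ : L2 D.carrier TIdx} (hσ : σ ∈ brokenSpace M k) (hτ : τ ∈ brokenSpace M k) (a : ℝ)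
    (υ : L2 D.carrier TIdx) :
    form B P (a • σ + τ) υ = a * form B P σ υ + form B P τ υ := by
  rw [form_eq hk, form_eq hk, form_eq hk, Finset.mul_sum, ← Finset.sum_add_distrib]
  refine Finset.sum_congr rfl fun i _ => ?_
  have h1 : ∫ x in (M.elem i).carrier, inner ℝ (compliance P (proj M k (a • σ + τ) x))
        (proj M k υ x) =
      a * (∫ x in (M.elem i).carrier, inner ℝ (compliance P (proj M k σ x)) (proj M k υ x)) +
        ∫ x in (M.elem i).carrier, inner ℝ (compliance P (proj M k τ x)) (proj M k υ x) := by
    rw [← integral_smul_add (integrable_compliance P M i _ _) (integrable_compliance P M i _ _) a,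
      proj_lincomb]
    refine integral_congr_ae ?_
    filter_upwards [coeFn_lincomb M i (proj M k σ) (proj M k τ) a] with x hx
    rw [hx]
    simp only [inner_compliance, tr, Fintype.sum_prod_type, Fin.sum_univ_two, PiLp.add_apply,
      PiLp.smul_apply, smul_eq_mul]
    ring
  have h2 : (M.elem i).edgeProd k (a • σ + τ - proj M k (a • σ + τ) : L2 D.carrier TIdx)
        (υ - proj M k υ : L2 D.carrier TIdx) =
      a * (M.elem i).edgeProd k (σ - proj M k σ : L2 D.carrier TIdx)
        (υ - proj M k υ : L2 D.carrier TIdx) +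
      (M.elem i).edgeProd k (τ - proj M k τ : L2 D.carrier TIdx)
        (υ - proj M k υ : L2 D.carrier TIdx) := by
    simp only [Polygon.edgeProd, edgeDof_sub_proj_lincomb hη₁ hη₂ hM hσ hτ a, add_mul,
      Finset.sum_add_distrib, Finset.mul_sum, mul_assoc]
  rw [h1, h2]
  ring

/-- The discrete form is equivalent to the `L²` norm, uniformly in the mesh. -/
theorem form_bounds (k : ℕ) (hk : 1 ≤ k) (P : Lame) {η₁ η₂ : ℝ} (hη₁ : 0 < η₁) (hη₂ : 0 < η₂) :
    ∃ c > 0, ∃ C > 0, ∀ {D : PolyDomain} (M : Mesh D) (B : ∀ i, InteriorBasis k (M.elem i)),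
      (∀ i, (M.elem i).ShapeRegular η₁ η₂) → ∀ σ ∈ brokenSpace M k,
      c * ‖σ‖ ^ 2 ≤ form B P σ σ ∧ form B P σ σ ≤ C * ‖σ‖ ^ 2 := by
  obtain ⟨c₀, hc₀, C₀, hC₀, H₀⟩ := compliance_bounds P
  obtain ⟨C₁, hC₁, H₁⟩ := Polygon.norm_le_edgeSq k hk hη₁ hη₂
  obtain ⟨C₂, hC₂, H₂⟩ := Polygon.edgeSq_le_norm k hη₁ hη₂
  refine ⟨min c₀ C₁⁻¹, lt_min hc₀ (inv_pos.2 hC₁), max C₀ C₂, lt_max_of_lt_left hC₀,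
    fun {D} M B hM σ hσ => ?_⟩
  -- Pythagoras splits the norm in the same way as the form: compliance against the projected part,
  -- stabilisation against the remainder.
  rw [norm_sq_eq_proj M k σ, form_eq hk, Finset.sum_add_distrib, mul_add, mul_add]
  have hm (i) (a) := memLp_apply (L2_memLp_elem M i (proj M k σ)) a
  have hsum (i) : ∑ a, ∫ x in (M.elem i).carrier, proj M k σ x a ^ 2 =
      ∫ x in (M.elem i).carrier, ∑ a, proj M k σ x a ^ 2 :=
    (integral_finsetSum _ fun a _ => (hm i a).integrable_sq).symm
  have hint (i) : Integrable (fun x => ∑ a, proj M k σ x a ^ 2)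
      (volume.restrict (M.elem i).carrier) :=
    integrable_finsetSum _ fun a _ => (hm i a).integrable_sq
  have hn0 : (0 : ℝ) ≤ ‖proj M k σ‖ ^ 2 := sq_nonneg _
  have hn1 : (0 : ℝ) ≤ ‖σ - proj M k σ‖ ^ 2 := sq_nonneg _
  have hP₁ : c₀ * ‖proj M k σ‖ ^ 2 ≤ ∑ i, ∫ x in (M.elem i).carrier,
      inner ℝ (compliance P (proj M k σ x)) (proj M k σ x) := by
    rw [L2_norm_sq_eq M, Finset.mul_sum]
    refine Finset.sum_le_sum fun i _ => ?_
    rw [hsum, ← integral_const_mul]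
    exact integral_mono ((hint i).const_mul _) (integrable_compliance P M i _ _)
      fun x => (H₀ _).1
  have hP₂ : ∑ i, ∫ x in (M.elem i).carrier,
      inner ℝ (compliance P (proj M k σ x)) (proj M k σ x) ≤ C₀ * ‖proj M k σ‖ ^ 2 := by
    rw [L2_norm_sq_eq M, Finset.mul_sum]
    refine Finset.sum_le_sum fun i _ => ?_
    rw [hsum, ← integral_const_mul]
    exact integral_mono (integrable_compliance P M i _ _) ((hint i).const_mul _)
      fun x => (H₀ _).2
  have hE₁ : C₁⁻¹ * ‖σ - proj M k σ‖ ^ 2 ≤ ∑ i, (M.elem i).area *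
      (M.elem i).edgeProd k (σ - proj M k σ : L2 D.carrier TIdx)
        (σ - proj M k σ : L2 D.carrier TIdx) := by
    rw [L2_norm_sq_eq M, Finset.mul_sum]
    refine Finset.sum_le_sum fun i _ => ?_
    obtain ⟨c, ρ, hS⟩ := (hM i).exists_shape hη₁
    rw [inv_mul_le_iff₀ hC₁, Polygon.edgeProd_self]
    exact H₁ _ c ρ hS _ (sub_proj_mem hη₁ hM hσ i) fun q hq a =>
      integral_sub_proj_mul M k σ i hq a
  have hE₂ : ∑ i, (M.elem i).area *
      (M.elem i).edgeProd k (σ - proj M k σ : L2 D.carrier TIdx)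
        (σ - proj M k σ : L2 D.carrier TIdx) ≤ C₂ * ‖σ - proj M k σ‖ ^ 2 := by
    rw [L2_norm_sq_eq M, Finset.mul_sum]
    refine Finset.sum_le_sum fun i _ => ?_
    obtain ⟨c, ρ, hS⟩ := (hM i).exists_shape hη₁
    rw [Polygon.edgeProd_self]
    exact H₂ _ c ρ hS _ (sub_proj_mem hη₁ hM hσ i)
  constructor
  · exact add_le_add ((mul_le_mul_of_nonneg_right (min_le_left _ _) hn0).trans hP₁)
      ((mul_le_mul_of_nonneg_right (min_le_right _ _) hn1).trans hE₁)
  · exact add_le_add (hP₂.trans (mul_le_mul_of_nonneg_right (le_max_left _ _) hn0))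
      (hE₂.trans (mul_le_mul_of_nonneg_right (le_max_right _ _) hn1))

/-- The projection together with the edge moments of the remainder determines a field, by
`norm_le_edgeSq`, and these data range over a finite-dimensional space. It supplies the orthogonal
projection used when differentiating in time. -/
theorem finiteDimensional_brokenSpace {M : Mesh D} {k : ℕ} (hk : 1 ≤ k) {η₁ η₂ : ℝ}
    (hη₁ : 0 < η₁) (hη₂ : 0 < η₂) (hM : ∀ i, (M.elem i).ShapeRegular η₁ η₂) :
    FiniteDimensional ℝ (brokenSpace M k) := by
  let T : brokenSpace M k → pwPoly M k TIdx ×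
      ((i : Fin M.N) → Fin ((M.elem i).m + 3) → Fin 2 → Fin (k + 1) → ℝ) := fun σ =>
    (⟨proj M k σ, proj_mem M k σ⟩, fun i e j β =>
      (M.elem i).edgeDof ((σ : L2 D.carrier TIdx) - proj M k σ : L2 D.carrier TIdx) e j β)
  have hT (a : ℝ) (σ τ : brokenSpace M k) : T (a • σ + τ) = a • T σ + T τ := by
    refine Prod.ext (Subtype.ext (proj_lincomb M k _ _ a)) ?_
    ext i e j β
    exact edgeDof_sub_proj_lincomb hη₁ hη₂ hM σ.2 τ.2 a i e j β
  let L := IsLinearMap.mk' T (IsLinearMap.mk (fun σ τ => by simpa using hT 1 σ τ) fun a σ => by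
    have h0 : T 0 = 0 := by simpa using hT 1 0 0
    simpa [h0] using hT a σ 0)
  refine FiniteDimensional.of_injective L ((injective_iff_map_eq_zero L).2 fun σ hσ => ?_)
  obtain ⟨C₁, hC₁, H₁⟩ := Polygon.norm_le_edgeSq k hk hη₁ hη₂
  have hσ1 : proj M k (σ : L2 D.carrier TIdx) = 0 := congrArg (fun p => (p.1 : L2 D.carrier TIdx)) hσ
  have hσ2 (i e j β) (hβ : β ∈ Finset.range (k + 1)) : (M.elem i).edgeDof
      ((σ : L2 D.carrier TIdx) - proj M k σ : L2 D.carrier TIdx) e j β = 0 :=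
    congrArg (fun p => p.2 i e j ⟨β, Finset.mem_range.1 hβ⟩) hσ
  have h : ‖(σ : L2 D.carrier TIdx)‖ ^ 2 ≤ 0 := by
    rw [norm_sq_eq_proj M k, hσ1, norm_zero, zero_pow two_ne_zero, zero_add, L2_norm_sq_eq M,
      ← hσ1]
    refine Finset.sum_nonpos fun i _ => ?_
    obtain ⟨c, ρ, hS⟩ := (hM i).exists_shape hη₁
    refine (H₁ _ c ρ hS _ (sub_proj_mem hη₁ hM σ.2 i) fun q hq a =>
      integral_sub_proj_mul M k _ i hq a).trans_eq ?_
    rw [Polygon.edgeSq, Finset.sum_eq_zero fun e _ => Finset.sum_eq_zero fun j _ =>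
      Finset.sum_eq_zero fun β hβ => by rw [hσ2 i e j β hβ, zero_pow two_ne_zero], mul_zero,
      mul_zero]
  have h0 : ‖(σ : L2 D.carrier TIdx)‖ = 0 := pow_eq_zero_iff two_ne_zero |>.1
    (le_antisymm h (sq_nonneg _))
  exact Subtype.ext (norm_eq_zero.1 h0)

/-! ### The energy identity -/

/-! ### Differentiating a quadratic form along a curve in a subspace. -/

section Abstract

variable {E : Type*} [NormedAddCommGroup E] [InnerProductSpace ℝ E] {W : Submodule ℝ E}

/-- Projecting the curve onto `W` does not change it, so the derivative equals its own projection.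
-/
theorem derivWithin_mem_submodule [W.HasOrthogonalProjection] {σ : ℝ → E} {σ' : E} {s : Set ℝ}
    {t : ℝ} (hs : UniqueDiffWithinAt ℝ s t) (ht : t ∈ s) (hσ : ∀ u ∈ s, σ u ∈ W)
    (h : HasDerivWithinAt σ σ' s t) : σ' ∈ W := by
  have h1 : HasDerivWithinAt (fun u => W.starProjection (σ u)) (W.starProjection σ') s t :=
    W.starProjection.hasFDerivAt.comp_hasDerivWithinAt t h
  have h2 : HasDerivWithinAt σ (W.starProjection σ') s t :=
    h1.congr (fun u hu => (Submodule.starProjection_eq_self_iff.2 (hσ u hu)).symm)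
      (Submodule.starProjection_eq_self_iff.2 (hσ t ht)).symm
  rw [hs.eq_deriv s h h2]
  exact Submodule.starProjection_apply_mem W σ'

/-- The polynomial `a ↦ b (a x + y) (a x + y)` is nonnegative, so its discriminant is not positive.
-/
theorem sq_le_of_quadratic_nonneg {b : E → E → ℝ}
    (hlin : ∀ x ∈ W, ∀ y ∈ W, ∀ (a : ℝ) z, b (a • x + y) z = a * b x z + b y z)
    (hsymm : ∀ x y, b x y = b y x) (hpos : ∀ x ∈ W, 0 ≤ b x x) {x y : E} (hx : x ∈ W)
    (hy : y ∈ W) : b x y ^ 2 ≤ b x x * b y y := by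
  have h := discrim_le_zero (a := b x x) (b := 2 * b x y) (c := b y y) fun a => by
    have h1 := hpos (a • x + y) (W.add_mem (W.smul_mem a hx) hy)
    rw [hlin x hx y hy, hsymm x (a • x + y), hlin x hx y hy, hsymm y (a • x + y), hlin x hx y hy,
      hsymm y x] at h1
    linarith
  rw [discrim] at h
  linarith

/-- Since `b` is known to be linear only on `W`, it is repackaged there as a continuous bilinear
form, continuity coming from Cauchy–Schwarz and the quadratic bound. The product rule is applied to
the projected curve, which coincides with the original one. -/
theorem hasDerivWithinAt_quadratic [W.HasOrthogonalProjection] {b : E → E → ℝ} {C : ℝ}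
    (hlin : ∀ x ∈ W, ∀ y ∈ W, ∀ (a : ℝ) z, b (a • x + y) z = a * b x z + b y z)
    (hsymm : ∀ x y, b x y = b y x) (hpos : ∀ x ∈ W, 0 ≤ b x x) (hC : 0 ≤ C)
    (hbound : ∀ x ∈ W, b x x ≤ C * ‖x‖ ^ 2) {σ : ℝ → E} {σ' : E} {s : Set ℝ}
    {t : ℝ} (ht : t ∈ s) (hσ : ∀ u ∈ s, σ u ∈ W) (hσ' : σ' ∈ W) (h : HasDerivWithinAt σ σ' s t) :
    HasDerivWithinAt (fun u => b (σ u) (σ u)) (2 * b σ' (σ t)) s t := by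
  have hzero (z : E) : b 0 z = 0 := by
    have := hlin 0 W.zero_mem 0 W.zero_mem 1 z
    simp only [smul_zero, add_zero, one_mul] at this
    linarith
  have hadd (x y : W) (z : E) : b (x + y) z = b x z + b y z := by
    simpa using hlin x x.2 y y.2 1 z
  have hsmul (a : ℝ) (x : W) (z : E) : b (a • x) z = a * b x z := by
    simpa [hzero] using hlin x x.2 0 W.zero_mem a z
  let L : W →ₗ[ℝ] W →ₗ[ℝ] ℝ := LinearMap.mk₂ ℝ (fun x y => b x y)
    (fun x y z => hadd x y z) (fun a x z => hsmul a x z)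
    (fun z x y => by rw [hsymm, hsymm z, hsymm z]; exact hadd x y z)
    (fun a z x => by rw [hsymm, hsymm z]; exact hsmul a x z)
  let Bl : W →L[ℝ] W →L[ℝ] ℝ := L.mkContinuous₂ C fun x y => by
    refine abs_le_of_sq_le_sq ?_ (by positivity)
    refine (sq_le_of_quadratic_nonneg hlin hsymm hpos x.2 y.2).trans ?_
    calc b x x * b y y ≤ (C * ‖(x : E)‖ ^ 2) * (C * ‖(y : E)‖ ^ 2) :=
          mul_le_mul (hbound x x.2) (hbound y y.2) (hpos y y.2) (by positivity)
      _ = (C * ‖x‖ * ‖y‖) ^ 2 := by rw [Submodule.coe_norm, Submodule.coe_norm]; ring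
  have hBl (x y : W) : Bl x y = b x y := rfl
  let π := W.orthogonalProjectionOnto
  have hπ {x : E} (hx : x ∈ W) : (π x : E) = x := Submodule.starProjection_eq_self_iff.2 hx
  have h1 : HasDerivWithinAt (fun u => π (σ u)) (π σ') s t :=
    π.hasFDerivAt.comp_hasDerivWithinAt t h
  have h2 := Bl.hasDerivWithinAt_of_bilinear h1 h1
  have h3 : Bl (π (σ t)) (π σ') + Bl (π σ') (π (σ t)) = 2 * b σ' (σ t) := by
    rw [hBl, hBl, hπ hσ', hπ (hσ t ht), hsymm]
    ring
  rw [h3] at h2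
  exact h2.congr (fun u hu => by rw [hBl, hπ (hσ u hu)]) (by rw [hBl, hπ (hσ t ht)])

end Abstract

variable {D : PolyDomain}

/-- The weak divergence is defined by choice; uniqueness makes it additive. -/
theorem weakDiv_add {σ τ : L2 D.carrier TIdx} (hσ : HasWeakDiv D.carrier σ (weakDiv σ))
    (hτ : HasWeakDiv D.carrier τ (weakDiv τ)) : weakDiv (σ + τ) = weakDiv σ + weakDiv τ := by
  have h : HasWeakDiv D.carrier (σ + τ : L2 D.carrier TIdx)
      (weakDiv σ + weakDiv τ : L2 D.carrier (Fin 2)) := by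
    refine (hσ.lincomb (Lp.memLp σ) (Lp.memLp τ) (Lp.memLp _) (Lp.memLp _) hτ 1).congr ?_ ?_
    · filter_upwards [Lp.coeFn_add σ τ] with x hx
      rw [hx, one_smul]; rfl
    · filter_upwards [Lp.coeFn_add (weakDiv σ) (weakDiv τ)] with x hx
      rw [hx, one_smul]; rfl
  have hex : ∃ d : L2 D.carrier (Fin 2), HasWeakDiv D.carrier (σ + τ : L2 D.carrier TIdx) d :=
    ⟨_, h⟩
  rw [weakDiv, dif_pos hex]
  exact Lp.ext (hex.choose_spec.unique D.isOpen (Lp.memLp _) (Lp.memLp _) h)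

/-! ### Energy balance and stability of semi-discrete solutions. -/

section Solution

variable {M : Mesh D} {k : ℕ} {B : ∀ i, InteriorBasis k (M.elem i)} {P₀ P₀' P₁ : Lame} {ρ T : ℝ}
  {f : ℝ → L2 D.carrier (Fin 2)} {σ₀ σ₁ : ℝ → L2 D.carrier TIdx} {v : ℝ → L2 D.carrier (Fin 2)}
  {r : ℝ → L2 D.carrier TIdx}

theorem hasDerivWithinAt_of_C1 {E : Type*} [NormedAddCommGroup E] [NormedSpace ℝ E] {u : ℝ → E}
    (hu : ContDiffOn ℝ 1 u (Set.Icc 0 T)) {t : ℝ} (ht : t ∈ Set.Icc 0 T) :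
    HasDerivWithinAt u (derivWithin u (Set.Icc 0 T) t) (Set.Icc 0 T) t :=
  ((hu.differentiableOn (by simp)) t ht).hasDerivWithinAt

/-- The fourth equation says that the time derivative of this pairing vanishes, so weak symmetry
propagates from the initial time. -/
theorem IsSemiDiscreteSolution.inner_rotation (hT : 0 < T)
    (h : IsSemiDiscreteSolution B P₀ P₀' P₁ ρ T f σ₀ σ₁ v r)
    (hsym : ∀ η ∈ rotationSpace M k, inner ℝ (σ₀ 0 + σ₁ 0) η = 0) {t : ℝ}
    (ht : t ∈ Set.Icc 0 T) {η : L2 D.carrier TIdx} (hη : η ∈ rotationSpace M k) :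
    inner ℝ (σ₀ t + σ₁ t) η = 0 := by
  have hd (s) (hs : s ∈ Set.Icc 0 T) :
      HasDerivWithinAt (fun s => inner ℝ (σ₀ s + σ₁ s) η) 0 (Set.Icc 0 T) s := by
    have h1 := (hasDerivWithinAt_of_C1 h.σ₀_C1 hs).add (hasDerivWithinAt_of_C1 h.σ₁_C1 hs)
    have h2 := h1.inner ℝ (hasDerivWithinAt_const s (Set.Icc 0 T) η)
    simpa [h.eq_r s hs η hη] using h2
  have := constant_of_derivWithin_zero (fun s hs => (hd s hs).differentiableWithinAt)
    (fun s hs => (hd s ⟨hs.1, hs.2.le⟩).derivWithin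
      (uniqueDiffOn_Icc hT s ⟨hs.1, hs.2.le⟩)) t ht
  exact this.trans (hsym η hη)

/-- The stress is frozen at time `t` and the vanishing pairing with `r s` is differentiated in `s`;
membership of the derivative of `r` in the rotation space is not needed. -/
theorem IsSemiDiscreteSolution.inner_deriv_rotation (hT : 0 < T)
    (h : IsSemiDiscreteSolution B P₀ P₀' P₁ ρ T f σ₀ σ₁ v r)
    (hsym : ∀ η ∈ rotationSpace M k, inner ℝ (σ₀ 0 + σ₁ 0) η = 0) {t : ℝ}
    (ht : t ∈ Set.Icc 0 T) :
    inner ℝ (σ₀ t + σ₁ t) (derivWithin r (Set.Icc 0 T) t) = 0 := by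
  have h1 := (hasDerivWithinAt_const t (Set.Icc 0 T) (σ₀ t + σ₁ t)).inner ℝ
    (hasDerivWithinAt_of_C1 h.r_C1 ht)
  rw [inner_zero_left, add_zero] at h1
  have h2 : HasDerivWithinAt (fun s => inner ℝ (σ₀ t + σ₁ t) (r s)) 0 (Set.Icc 0 T) t :=
    (hasDerivWithinAt_const t (Set.Icc 0 T) (0 : ℝ)).congr
      (fun s hs => h.inner_rotation hT hsym ht (h.r_mem s hs))
      (h.inner_rotation hT hsym ht (h.r_mem t ht))
  exact (uniqueDiffOn_Icc hT t ht).eq_deriv _ h1 h2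

theorem form_self_nonneg (hk : 1 ≤ k) {η₁ η₂ : ℝ} (hη₁ : 0 < η₁) (hη₂ : 0 < η₂)
    (hM : ∀ i, (M.elem i).ShapeRegular η₁ η₂) (P : Lame) {σ : L2 D.carrier TIdx}
    (hσ : σ ∈ brokenSpace M k) : 0 ≤ form B P σ σ := by
  obtain ⟨c, hc, C, -, H⟩ := form_bounds k hk P hη₁ hη₂
  exact le_trans (by positivity) (H M B hM σ hσ).1

theorem form_hasDerivWithinAt (hk : 1 ≤ k) {η₁ η₂ : ℝ} (hη₁ : 0 < η₁) (hη₂ : 0 < η₂)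
    (hM : ∀ i, (M.elem i).ShapeRegular η₁ η₂) (P : Lame) (hT : 0 < T)
    {σ : ℝ → L2 D.carrier TIdx} (hσ : ∀ t ∈ Set.Icc 0 T, σ t ∈ brokenSpace M k)
    (hC : ContDiffOn ℝ 1 σ (Set.Icc 0 T)) {t : ℝ} (ht : t ∈ Set.Icc 0 T) :
    HasDerivWithinAt (fun s => form B P (σ s) (σ s))
      (2 * form B P (derivWithin σ (Set.Icc 0 T) t) (σ t)) (Set.Icc 0 T) t := by
  have := finiteDimensional_brokenSpace hk hη₁ hη₂ hM
  obtain ⟨c, hc, C, hC0, H⟩ := form_bounds k hk P hη₁ hη₂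
  have hd := hasDerivWithinAt_of_C1 hC ht
  refine hasDerivWithinAt_quadratic (W := brokenSpace M k) (C := C)
    (fun x hx y hy a z => form_lincomb hk hη₁ hη₂ hM B P hx hy a z)
    (form_symm hk B P) (fun x hx => form_self_nonneg hk hη₁ hη₂ hM P hx) hC0.le
    (fun x hx => (H M B hM x hx).2) ht hσ ?_ hd
  exact derivWithin_mem_submodule (uniqueDiffOn_Icc hT t ht) ht hσ hd

/-- The test functions are the solution components `σ₀`, `σ₁` and `v`. Adding the three identities
cancels the divergence pairings, and the rotation terms add up to the pairing killed by
`inner_deriv_rotation`. -/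
theorem IsSemiDiscreteSolution.energy_hasDerivWithinAt (hk : 1 ≤ k) {η₁ η₂ : ℝ} (hη₁ : 0 < η₁)
    (hη₂ : 0 < η₂) (hM : ∀ i, (M.elem i).ShapeRegular η₁ η₂) (hT : 0 < T)
    (h : IsSemiDiscreteSolution B P₀ P₀' P₁ ρ T f σ₀ σ₁ v r)
    (hsym : ∀ η ∈ rotationSpace M k, inner ℝ (σ₀ 0 + σ₁ 0) η = 0) {t : ℝ}
    (ht : t ∈ Set.Icc 0 T) :
    HasDerivWithinAt (fun s => energy B P₀ P₁ ρ (σ₀ s) (σ₁ s) (v s))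
      (inner ℝ (ρ • f t) (v t) - form B P₀' (σ₀ t) (σ₀ t)) (Set.Icc 0 T) t := by
  have d₀ := form_hasDerivWithinAt (B := B) hk hη₁ hη₂ hM P₀ hT (fun s hs => (h.σ₀_mem s hs).2)
    h.σ₀_C1 ht
  have d₁ := form_hasDerivWithinAt (B := B) hk hη₁ hη₂ hM P₁ hT (fun s hs => (h.σ₁_mem s hs).2)
    h.σ₁_C1 ht
  have hv := hasDerivWithinAt_of_C1 h.v_C1 ht
  have dv := (hv.const_smul ρ).inner ℝ hv
  have d := ((d₀.add d₁).add dv).const_mul (1 / 2 : ℝ)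
  have e₀ := h.eq₀ t ht (σ₀ t) (h.σ₀_mem t ht)
  have e₁ := h.eq₁ t ht (σ₁ t) (h.σ₁_mem t ht)
  have ev := h.eq_v t ht (v t) (h.v_mem t ht)
  have er := h.inner_deriv_rotation hT hsym ht
  rw [weakDiv_add (h.σ₀_mem t ht).1.1 (h.σ₁_mem t ht).1.1, inner_add_left] at ev
  rw [inner_add_left] at er
  refine d.congr_deriv ?_
  have hvv : inner ℝ ((ρ • v) t) (derivWithin v (Set.Icc 0 T) t) =
      inner ℝ (ρ • derivWithin v (Set.Icc 0 T) t) (v t) := by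
    rw [Pi.smul_apply, real_inner_smul_left, real_inner_smul_left, real_inner_comm]
  rw [hvv]
  linarith

/-- Evaluating the energy growth at a maximum point of `N` bounds the velocity inside the integral
by a constant, so no exponential factor in `T` arises. The constant is chosen before the domain and
the mesh. -/
theorem stability (k : ℕ) (hk : 1 ≤ k) (P₀ P₀' P₁ : Lame) {ρ : ℝ} (hρ : 0 < ρ) {η₁ η₂ : ℝ}
    (hη₁ : 0 < η₁) (hη₂ : 0 < η₂) : ∃ C : ℝ, 0 < C ∧ ∀ {D : PolyDomain} (M : Mesh D)
      (B : ∀ i, InteriorBasis k (M.elem i)), (∀ i, (M.elem i).ShapeRegular η₁ η₂) →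
      ∀ (T : ℝ) (f : ℝ → L2 D.carrier (Fin 2)) (σ₀ σ₁ : ℝ → L2 D.carrier TIdx)
        (v : ℝ → L2 D.carrier (Fin 2)) (r : ℝ → L2 D.carrier TIdx),
        0 < T → IntegrableOn f (Set.Icc 0 T) →
        IsSemiDiscreteSolution B P₀ P₀' P₁ ρ T f σ₀ σ₁ v r →
        (∀ η ∈ rotationSpace M k, inner ℝ (σ₀ 0 + σ₁ 0) η = 0) →
        ∀ s ∈ Set.Icc 0 T, ‖σ₀ s‖ + ‖σ₁ s‖ + ‖v s‖ ≤
          C * (‖σ₀ 0‖ + ‖σ₁ 0‖ + ‖v 0‖ + ∫ t in (0 : ℝ)..T, ‖f t‖) := by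
  obtain ⟨c₀, hc₀, C₀, hC₀, H₀⟩ := form_bounds k hk P₀ hη₁ hη₂
  obtain ⟨c₁, hc₁, C₁, hC₁, H₁⟩ := form_bounds k hk P₁ hη₁ hη₂
  set c := min (min c₀ c₁) ρ with hc
  set C := max (max C₀ C₁) ρ with hC
  have hcpos : 0 < c := lt_min (lt_min hc₀ hc₁) hρ
  have hCpos : 0 < C := lt_max_of_lt_right hρ
  refine ⟨6 / c * max (C / 2) ρ, by positivity,
    fun {D} M B hM T f σ₀ σ₁ v r hT hf h hsym => ?_⟩
  let N : ℝ → ℝ := fun s => ‖σ₀ s‖ + ‖σ₁ s‖ + ‖v s‖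
  let En : ℝ → ℝ := fun s => energy B P₀ P₁ ρ (σ₀ s) (σ₁ s) (v s)
  set F := ∫ t in (0 : ℝ)..T, ‖f t‖ with hF
  have hN0 (s) : 0 ≤ N s := by positivity
  have hNc : ContinuousOn N (Set.Icc 0 T) :=
    (h.σ₀_C1.continuousOn.norm.add h.σ₁_C1.continuousOn.norm).add h.v_C1.continuousOn.norm
  have h0 : (0 : ℝ) ∈ Set.Icc 0 T := ⟨le_rfl, hT.le⟩
  obtain ⟨s₀, hs₀, hmax⟩ := isCompact_Icc.exists_isMaxOn ⟨0, h0⟩ hNc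
  have hvv (s) : inner ℝ (ρ • v s) (v s) = ρ * ‖v s‖ ^ 2 := by
    rw [real_inner_smul_left, real_inner_self_eq_norm_sq]
  have hlow (s) (hs : s ∈ Set.Icc 0 T) : c / 6 * N s ^ 2 ≤ En s := by
    have e0 := (H₀ M B hM _ (h.σ₀_mem s hs).2).1
    have e1 := (H₁ M B hM _ (h.σ₁_mem s hs).2).1
    have k0 : c * ‖σ₀ s‖ ^ 2 ≤ c₀ * ‖σ₀ s‖ ^ 2 := mul_le_mul_of_nonneg_right
      ((min_le_left _ _).trans (min_le_left _ _)) (sq_nonneg _)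
    have k1 : c * ‖σ₁ s‖ ^ 2 ≤ c₁ * ‖σ₁ s‖ ^ 2 := mul_le_mul_of_nonneg_right
      ((min_le_left _ _).trans (min_le_right _ _)) (sq_nonneg _)
    have k2 : c * ‖v s‖ ^ 2 ≤ ρ * ‖v s‖ ^ 2 :=
      mul_le_mul_of_nonneg_right (min_le_right _ _) (sq_nonneg _)
    -- This factor `3` and the `1 / 2` in the energy make up the `6` in the lower bound.
    have k3 : N s ^ 2 ≤ 3 * (‖σ₀ s‖ ^ 2 + ‖σ₁ s‖ ^ 2 + ‖v s‖ ^ 2) := by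
      simp only [N]
      nlinarith [sq_nonneg (‖σ₀ s‖ - ‖σ₁ s‖), sq_nonneg (‖σ₀ s‖ - ‖v s‖),
        sq_nonneg (‖σ₁ s‖ - ‖v s‖)]
    have k4 := mul_le_mul_of_nonneg_left k3 hcpos.le
    simp only [En, energy, hvv]
    linarith
  have hup : En 0 ≤ C / 2 * N 0 ^ 2 := by
    have e0 := (H₀ M B hM _ (h.σ₀_mem 0 h0).2).2
    have e1 := (H₁ M B hM _ (h.σ₁_mem 0 h0).2).2
    have k0 : C₀ * ‖σ₀ 0‖ ^ 2 ≤ C * ‖σ₀ 0‖ ^ 2 := mul_le_mul_of_nonneg_right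
      ((le_max_left _ _).trans (le_max_left _ _)) (sq_nonneg _)
    have k1 : C₁ * ‖σ₁ 0‖ ^ 2 ≤ C * ‖σ₁ 0‖ ^ 2 := mul_le_mul_of_nonneg_right
      ((le_max_right _ _).trans (le_max_left _ _)) (sq_nonneg _)
    have k2 : ρ * ‖v 0‖ ^ 2 ≤ C * ‖v 0‖ ^ 2 :=
      mul_le_mul_of_nonneg_right (le_max_right _ _) (sq_nonneg _)
    have k3 : ‖σ₀ 0‖ ^ 2 + ‖σ₁ 0‖ ^ 2 + ‖v 0‖ ^ 2 ≤ N 0 ^ 2 := by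
      simp only [N]
      nlinarith [mul_nonneg (norm_nonneg (σ₀ 0)) (norm_nonneg (σ₁ 0)),
        mul_nonneg (norm_nonneg (σ₀ 0)) (norm_nonneg (v 0)),
        mul_nonneg (norm_nonneg (σ₁ 0)) (norm_nonneg (v 0))]
    have k4 := mul_le_mul_of_nonneg_left k3 hCpos.le
    simp only [En, energy, hvv]
    linarith
  have hd (t) (ht : t ∈ Set.Icc 0 T) := h.energy_hasDerivWithinAt hk hη₁ hη₂ hM hT hsym ht
  have hfi : IntegrableOn (fun t => ‖f t‖) (Set.Icc 0 T) := hf.norm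
  have hsub : Set.Icc 0 s₀ ⊆ Set.Icc 0 T := Set.Icc_subset_Icc_right hs₀.2
  -- The load is only integrable in time, so an integrable majorant of the derivative is integrated;
  -- the dissipation `form B P₀'` is dropped by its sign.
  have hgrow : En s₀ - En 0 ≤ ∫ t in (0 : ℝ)..s₀, ρ * N s₀ * ‖f t‖ := by
    refine intervalIntegral.sub_le_integral_of_hasDeriv_right_of_le hs₀.1
      (fun t ht => ((hd t (hsub ht)).continuousWithinAt.mono hsub))
      (g' := fun t => inner ℝ (ρ • f t) (v t) - form B P₀' (σ₀ t) (σ₀ t))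
      (fun t ht => ?_) ((hfi.mono_set hsub).const_mul _) fun t ht => ?_
    · have ht' : t ∈ Set.Ioo 0 T := ⟨ht.1, ht.2.trans_le hs₀.2⟩
      exact ((hd t ⟨ht'.1.le, ht'.2.le⟩).hasDerivAt (Icc_mem_nhds ht'.1 ht'.2)).hasDerivWithinAt
    · have ht' : t ∈ Set.Icc 0 T := hsub ⟨ht.1.le, ht.2.le⟩
      have p1 : 0 ≤ form B P₀' (σ₀ t) (σ₀ t) :=
        form_self_nonneg hk hη₁ hη₂ hM P₀' (h.σ₀_mem t ht').2
      have p2 : inner ℝ (ρ • f t) (v t) ≤ ρ * (‖f t‖ * ‖v t‖) := by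
        rw [real_inner_smul_left]
        exact mul_le_mul_of_nonneg_left (real_inner_le_norm _ _) hρ.le
      have p3 : ‖v t‖ ≤ N s₀ := by
        have : N t ≤ N s₀ := hmax ht'
        have := norm_nonneg (σ₀ t)
        have := norm_nonneg (σ₁ t)
        simp only [N] at *
        linarith
      have p4 := mul_le_mul_of_nonneg_left (mul_le_mul_of_nonneg_left p3 (norm_nonneg (f t))) hρ.le
      linarith
  have hFle : ∫ t in (0 : ℝ)..s₀, ρ * N s₀ * ‖f t‖ ≤ ρ * N s₀ * F := by
    rw [intervalIntegral.integral_const_mul]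
    refine mul_le_mul_of_nonneg_left ?_ (mul_nonneg hρ.le (hN0 _))
    rw [hF, intervalIntegral.integral_of_le hs₀.1, intervalIntegral.integral_of_le hT.le]
    exact setIntegral_mono_set (hfi.mono_set Set.Ioc_subset_Icc_self)
      (ae_of_all _ fun _ => norm_nonneg _)
      (Set.Ioc_subset_Ioc_right hs₀.2).eventuallyLE
  have hF0 : 0 ≤ F := intervalIntegral.integral_nonneg hT.le fun _ _ => norm_nonneg _
  have hN0s : N 0 ≤ N s₀ := hmax h0
  -- Using `N 0 ≤ N s₀`, the right-hand side gets a factor `N s₀`, which cancels next unless it is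
  -- zero.
  have key : c / 6 * N s₀ ^ 2 ≤ (C / 2 * N 0 + ρ * F) * N s₀ := by
    have q1 := hlow s₀ hs₀
    have q2 : C / 2 * N 0 ^ 2 ≤ C / 2 * N 0 * N s₀ := by
      rw [pow_two, ← mul_assoc]
      exact mul_le_mul_of_nonneg_left hN0s (mul_nonneg (by positivity) (hN0 0))
    linarith
  have hmaxb : c / 6 * N s₀ ≤ C / 2 * N 0 + ρ * F := by
    rcases (hN0 s₀).eq_or_lt with hz | hz
    · rw [← hz, mul_zero]
      exact add_nonneg (mul_nonneg (by positivity) (hN0 0)) (mul_nonneg hρ.le hF0)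
    · refine le_of_mul_le_mul_right ?_ hz
      linarith
  intro s hs
  have q1 : N s ≤ N s₀ := hmax hs
  have q2 : C / 2 * N 0 + ρ * F ≤ max (C / 2) ρ * (N 0 + F) := by
    rw [mul_add (max (C / 2) ρ)]
    exact add_le_add (mul_le_mul_of_nonneg_right (le_max_left _ _) (hN0 0))
      (mul_le_mul_of_nonneg_right (le_max_right _ _) hF0)
  have q3 : N s ≤ 6 / c * (max (C / 2) ρ * (N 0 + F)) := by
    rw [div_mul_eq_mul_div, le_div_iff₀ hcpos]
    have := mul_le_mul_of_nonneg_right q1 hcpos.le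
    linarith
  calc ‖σ₀ s‖ + ‖σ₁ s‖ + ‖v s‖ = N s := rfl
    _ ≤ _ := q3
    _ = _ := by rw [mul_assoc]

end Solution

end ViscoVEM

end

open ViscoVEM MeasureTheory in
theorem mainTheorem6 (D : PolyDomain) (k : ℕ) (hk : 1 ≤ k)
    (P₀ P₀' P₁ : Lame) (ρ : ℝ) (hρ : 0 < ρ)
    (η₁ η₂ θ₁ θ₂ : ℝ) (hη₁ : 0 < η₁) (hη₂ : 0 < η₂) (hθ₁ : 0 < θ₁) (hθ₂ : 0 < θ₂) :
    ∃ C : ℝ, 0 < C ∧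
      ∀ (M : Mesh D) (B : ∀ i, InteriorBasis k (M.elem i)),
        (∀ i, (M.elem i).ShapeRegular η₁ η₂) →
        (∀ i, (M.elem i).WellScaled (B i).grad θ₁ θ₂ ∧ (M.elem i).WellScaled (B i).perp θ₁ θ₂) →
      ∀ (T : ℝ) (f : ℝ → L2 D.carrier (Fin 2)) (σ₀ σ₁ : ℝ → L2 D.carrier TIdx)
        (v : ℝ → L2 D.carrier (Fin 2)) (r : ℝ → L2 D.carrier TIdx),
        0 < T → IntegrableOn f (Set.Icc 0 T) →
        IsSemiDiscreteSolution B P₀ P₀' P₁ ρ T f σ₀ σ₁ v r →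
        (∀ η ∈ rotationSpace M k, inner ℝ (σ₀ 0 + σ₁ 0) η = 0) →
        (∀ t ∈ Set.Icc 0 T,
          HasDerivWithinAt (fun s => energy B P₀ P₁ ρ (σ₀ s) (σ₁ s) (v s))
            (inner ℝ (ρ • f t) (v t) - form B P₀' (σ₀ t) (σ₀ t)) (Set.Icc 0 T) t ∧
          0 ≤ form B P₀' (σ₀ t) (σ₀ t)) ∧
        ∀ s ∈ Set.Icc 0 T,
          ‖σ₀ s‖ + ‖σ₁ s‖ + ‖v s‖ ≤
            C * (‖σ₀ 0‖ + ‖σ₁ 0‖ + ‖v 0‖ + ∫ t in (0 : ℝ)..T, ‖f t‖) := by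
  obtain ⟨C, hC, H⟩ := stability k hk P₀ P₀' P₁ hρ hη₁ hη₂
  refine ⟨C, hC, fun M B hM _ T f σ₀ σ₁ v r hT hf h hsym => ⟨fun t ht => ⟨?_, ?_⟩,
    H M B hM T f σ₀ σ₁ v r hT hf h hsym⟩⟩
  · exact h.energy_hasDerivWithinAt hk hη₁ hη₂ hM hT hsym ht
  · exact form_self_nonneg hk hη₁ hη₂ hM P₀' (h.σ₀_mem t ht).2
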